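/- **Setting.** Let $\Gamma$ be a countable connected graph with graph metric $\mathrm{dist}$ that is $d$-dimensional: for some $\kappa<\infty$ every ball of radius $r\ge 1$ has at most $\kappa r^d$ points. To each $x\in\Gamma$ belongs a Hilbert space $\mathcal H_x\neq 0$, with $\sup_x\dim\mathcal H_x<\infty$; for finite $\Lambda\subset\Gamma$ let $\mathcal A^\Lambda$ be the algebra of operators on $\bigotimes_{x\in\Lambda}\mathcal H_x$, and regard $\mathcal A^{X}\subset\mathcal A^\Lambda$ for $X\subset\Lambda$ via $A\mapsto A\otimes 1$. A (time- and volume-dependent) interaction $\Phi$ assigns to each $s\in[0,1]$ and all finite $\Lambda,Z\subset\Gamma$ a self-adjoint $\Phi^\Lambda_s(Z)\in\mathcal A^Z$, which is $0$ unless $Z\subset\Lambda$. For $n\in\mathbb N$ and $\zeta:[0,\infty)\to(0,\infty)$ put $$\|\Phi\|_{\zeta,n}=\sup_{\Lambda}\sup_{x,y\in\Gamma}\sum_{Z\ni x,y}\sup_{s\in[0,1]}|Z|^n\frac{\|\Phi_s^\Lambda(Z)\|}{F_\zeta(\mathrm{dist}(x,y))},\qquad F_\zeta(r)=\frac{\zeta(r)}{(1+r)^{d+1}}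 .$$ Let $\mathcal S$ be the set of bounded, non-increasing $\zeta:[0,\infty)\to(0,\infty)$ with $\zeta(r+s)\ge\zeta(r)\zeta(s)$ and $\sup_r r^n\zeta(r)<\infty$ for all $n\in\mathbb N$. A family $H=\{H_s^\Lambda\in\mathcal A^\Lambda\}$ is a local Hamiltonian if $H^\Lambda_s=\sum_{Z\subset\Lambda}\Phi^\Lambda_s(Z)$ for all $\Lambda$ and $s\in[0,1]$, for some interaction $\Phi$. It belongs to $\mathcal L_{\mathcal S,\infty}$ (to $\mathcal L_{\mathcal E,\infty}$) if $\Phi$ can be chosen such that for every $n$ there is $\zeta\in\mathcal S$ (there is $\mu>0$, with $\zeta(r)=e^{-\mu r}$) such that $\|\Phi\|_{\zeta,n}<\infty$. Write $H\in\mathcal C^k$ if for every $\Lambda$ the derivatives $H^{(j)}=\frac{d^j}{ds^j}H^\Lambda_s$ exist on $[0,1]$ for $1\le j\le k$ (one-sided at the end points). Let $H$ be a local Hamiltonian with a gap: there is $\gamma>0$ such that, for all $\Lambda$ and all $s\in[0,1]$, the spectrum of $H_s^\Lambda$ is $\Sigma^1\cup\Sigma^2$ (sets depending on $\Lambda$ and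 $s$), where no point of $\Sigma^2$ lies between two points of $\Sigma^1$, and $|a-b|\ge\gamma$ for all $a\in\Sigma^1$, $b\in\Sigma^2$. Let $P=P^\Lambda_s$ be the spectral projection of $H^\Lambda_s$ associated with $\Sigma^1$. Let $W_\gamma\in L^1(\mathbb R)$ be real-valued with $\sup_{|t|>1}|t|^n|W_\gamma(t)|<\infty$ for all $n\in\mathbb N$ and $$\widehat W_\gamma(\xi)=\frac1{\sqrt{2\pi}}\int_{\mathbb R}W_\gamma(t)e^{-\mathrm i t\xi}\,dt=\frac{-\mathrm i}{\sqrt{2\pi}\,\xi}\quad\text{for }|\xi|\ge\gamma .$$ For $A\in\mathcal A^\Lambda$ put $\mathcal I(A)=\mathcal I_s^\Lambda(A)=\int_{\mathbb R}W_\gamma(t)\,\tau_t(A)\,dt$ with $\tau_t(A)=e^{\mathrm i tH_s^\Lambda}Ae^{-\mathrm i tH_s^\Lambda}$, and for a family $G$ put $\mathcal I(G)=\{\mathcal I_s^\Lambda(G_s^\Lambda)\}$. **Proposition.** 1. For all $\Lambda$, $s\in[0,1]$ and $A\in\mathcal A^\Lambda$: if $A=PA(1-P)+(1-P)AP$, then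 $A=-\mathrm i[H,\mathcal I(A)]$. 2. For all $\Lambda$, $s\in[0,1]$ and $L\in\mathcal A^\Lambda$: $[L,P]-\mathrm i[[\mathcal I(L),H],P]=0$. 3. If $H\in\mathcal L_{\mathcal E,\infty}$ and $G\in\mathcal L_{\mathcal S,\infty}$, then $\mathcal I(G)\in\mathcal L_{\mathcal S,\infty}$. 4. If $k\in\mathbb N$, $H,G\in\mathcal C^k$, and $H^{(j)}\in\mathcal L_{\mathcal E,\infty}$, $G^{(j)}\in\mathcal L_{\mathcal S,\infty}$ for $0\le j\le k$, then $\mathcal I(G)\in\mathcal C^k$ and $\mathcal I(G)^{(j)}\in\mathcal L_{\mathcal S,\infty}$ for $1\le j\le k$. -/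

import Mathlib

open scoped ENNReal Matrix.Norms.L2Operator

noncomputable section

namespace SpinSystem

/-! ### Observables

`Γ` is the set of sites, and the Hilbert space at the site `x` is `ℂ ^ (q x)`. -/

section Observables

variable {Γ : Type*} [DecidableEq Γ]

/-- The labels of the standard orthonormal (product) basis of `⨂ x ∈ Λ, ℂ ^ (q x)`. -/
abbrev Config (q : Γ → ℕ) (Λ : Finset Γ) : Type _ := (x : {x // x ∈ Λ}) → Fin (q x.1)

/-- The algebra of observables of the finite volume `Λ`: all operators on `⨂ x ∈ Λ, ℂ ^ (q x)`,
written as matrices in the product basis. The norm is the operator norm. -/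
abbrev Obs (q : Γ → ℕ) (Λ : Finset Γ) : Type _ := Matrix (Config q Λ) (Config q Λ) ℂ

/-- Restriction of basis labels to a smaller volume. -/
def Config.restrict {q : Γ → ℕ} {X Λ : Finset Γ} (h : X ⊆ Λ) (σ : Config q Λ) : Config q X :=
  fun x => σ ⟨x.1, h x.2⟩

/-- The embedding `A ↦ A ⊗ 1` of the observables of `X` into those of `Λ ⊇ X`. -/
def embed {q : Γ → ℕ} {X Λ : Finset Γ} (h : X ⊆ Λ) (A : Obs q X) : Obs q Λ :=
  Matrix.of fun σ τ =>
    if ∀ x : {x // x ∈ Λ}, x.1 ∉ X → σ x = τ x then A (σ.restrict h) (τ.restrict h) else 0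

end Observables

/-! ### The lattice -/

section Lattice

variable {Γ : Type*}

/-- The graph is `d`-dimensional: balls of radius `r ≥ 1` have at most `κ r ^ d` elements. -/
def HasDimension (gr : SimpleGraph Γ) (d : ℕ) : Prop :=
  ∃ κ : ℕ, ∀ y : Γ, ∀ r : ℕ, 1 ≤ r →
    {x : Γ | gr.dist x y ≤ r}.encard ≤ ((κ * r ^ d : ℕ) : ℕ∞)

/-- `F_ζ(r) = ζ(r) (1 + r) ^ (-(d + 1))`. -/
def decayF (d : ℕ) (ζ : ℝ → ℝ) (r : ℝ) : ℝ := ζ r * ((1 + r) ^ (d + 1))⁻¹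

/-- The class `𝓢` of decay functions on `[0, ∞)` (values at negative arguments play no role). -/
structure IsFastDecay (ζ : ℝ → ℝ) : Prop where
  pos : ∀ r, 0 ≤ r → 0 < ζ r
  bounded : ∃ M, ∀ r, 0 ≤ r → ζ r ≤ M
  antitone : AntitoneOn ζ (Set.Ici 0)
  superadditive : ∀ r s, 0 ≤ r → 0 ≤ s → ζ r * ζ s ≤ ζ (r + s)
  decay : ∀ n : ℕ, ∃ C, ∀ r, 0 ≤ r → r ^ n * ζ r ≤ C

end Lattice

/-! ### Interactions and local Hamiltonians -/

section Interactions

variable {Γ : Type*} [DecidableEq Γ]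

/-- An interaction: for every volume `Λ` a family of self-adjoint `Φ^Λ(Z)`, each an observable of
the finite set `Z`, with `Φ^Λ(Z) = 0` unless `Z ⊆ Λ`. -/
structure Interaction (q : Γ → ℕ) where
  term : Finset Γ → (Z : Finset Γ) → Obs q Z
  selfAdjoint : ∀ Λ Z, IsSelfAdjoint (term Λ Z)
  eq_zero : ∀ Λ Z, ¬ Z ⊆ Λ → term Λ Z = 0

/-- The Hamiltonian `∑_{Z ⊆ Λ} Φ^Λ(Z)` of an interaction. -/
def Interaction.hamiltonian {q : Γ → ℕ} (Φ : Interaction q) (Λ : Finset Γ) : Obs q Λ :=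
  ∑ Z ∈ Λ.powerset.attach, embed (Finset.mem_powerset.1 Z.2) (Φ.term Λ Z.1)

/-- The norm `‖Φ‖_{ζ,n}` of a time-dependent interaction, `s ∈ [0,1]`, with values in `[0,∞]`:
the supremum over `Λ`, `x`, `y` of
`∑_{Z ∋ x, y} sup_s |Z| ^ n ‖Φ_s^Λ(Z)‖ / F_ζ(dist(x,y))`.
Only `Z ⊆ Λ` contribute to this sum. -/
def interactionNorm {q : Γ → ℕ} (gr : SimpleGraph Γ) (d : ℕ) (ζ : ℝ → ℝ) (n : ℕ)
    (Φ : ℝ → Interaction q) : ℝ≥0∞ :=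
  ⨆ (Λ : Finset Γ) (x : Γ) (y : Γ),
    ∑ Z ∈ Λ.powerset with x ∈ Z ∧ y ∈ Z,
      ⨆ s ∈ Set.Icc (0 : ℝ) 1,
        (Z.card : ℝ≥0∞) ^ n * ‖(Φ s).term Λ Z‖ₑ /
          ENNReal.ofReal (decayF d ζ (gr.dist x y))

/-- `𝓑_{ζ,n}`: the time-dependent interactions of finite norm. -/
def classB {q : Γ → ℕ} (gr : SimpleGraph Γ) (d : ℕ) (ζ : ℝ → ℝ) (n : ℕ) :
    Set (ℝ → Interaction q) :=
  {Φ | interactionNorm gr d ζ n Φ < ⊤}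

/-- `𝓑_{𝓔,∞}`, the intersection over `n` of the unions over `μ > 0` of `𝓑_{exp(-μ ·),n}`. -/
def classBE {q : Γ → ℕ} (gr : SimpleGraph Γ) (d : ℕ) : Set (ℝ → Interaction q) :=
  ⋂ n : ℕ, ⋃ μ : {μ : ℝ // 0 < μ}, classB gr d (fun r => Real.exp (-(μ.1 * r))) n

/-- `𝓑_{𝓢,∞}`, the intersection over `n` of the unions over `ζ ∈ 𝓢` of `𝓑_{ζ,n}`. -/
def classBS {q : Γ → ℕ} (gr : SimpleGraph Γ) (d : ℕ) : Set (ℝ → Interaction q) :=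
  ⋂ n : ℕ, ⋃ ζ : {ζ : ℝ → ℝ // IsFastDecay ζ}, classB gr d ζ.1 n

/-- A family of operators indexed by the finite volumes `Λ` and the time `s` (only the times
`s ∈ [0,1]` play a role). -/
abbrev Family (q : Γ → ℕ) : Type _ := (Λ : Finset Γ) → ℝ → Obs q Λ

/-- `Φ` is an interaction associated to the family `H`. -/
def IsAssociated {q : Γ → ℕ} (Φ : ℝ → Interaction q) (H : Family q) : Prop :=
  ∀ Λ : Finset Γ, ∀ s ∈ Set.Icc (0 : ℝ) 1, H Λ s = (Φ s).hamiltonian Λ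

/-- `H` is a local Hamiltonian. -/
def IsLocalHamiltonian {q : Γ → ℕ} (H : Family q) : Prop :=
  ∃ Φ : ℝ → Interaction q, IsAssociated Φ H

/-- `𝓛_{𝓔,∞}`. -/
def classLE {q : Γ → ℕ} (gr : SimpleGraph Γ) (d : ℕ) : Set (Family q) :=
  {H | ∃ Φ ∈ classBE gr d, IsAssociated Φ H}

/-- `𝓛_{𝓢,∞}`. -/
def classLS {q : Γ → ℕ} (gr : SimpleGraph Γ) (d : ℕ) : Set (Family q) :=
  {H | ∃ Φ ∈ classBS gr d, IsAssociated Φ H}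

/-- The `j`-th time derivative `H^{(j)}` on `[0,1]` (one-sided at the end points). -/
def timeDeriv {q : Γ → ℕ} (j : ℕ) (H : Family q) : Family q :=
  fun Λ s => iteratedDerivWithin j (H Λ) (Set.Icc 0 1) s

/-- `H ∈ 𝓒^k`: in every volume the time derivatives of order `1, …, k` exist on `[0,1]`. -/
def IsTimesDiff {q : Γ → ℕ} (k : ℕ) (H : Family q) : Prop :=
  ∀ Λ : Finset Γ, ∀ j < k, DifferentiableOn ℝ (timeDeriv j H Λ) (Set.Icc 0 1)

end Interactions

/-! ### Gap, spectral projection, and the map `𝓘` -/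

section Gap

variable {Γ : Type*} [DecidableEq Γ]

/-- The gap assumption: for all `Λ` and all `s ∈ [0,1]` the spectrum of `H_s^Λ` is `Σ¹ ∪ Σ²`, no
point of `Σ²` lies between two points of `Σ¹`, and `Σ¹`, `Σ²` have distance at least `γ`. -/
structure IsGapped {q : Γ → ℕ} (γ : ℝ) (H : Family q) (S₁ S₂ : Finset Γ → ℝ → Set ℝ) : Prop where
  spectrum_eq : ∀ Λ, ∀ s ∈ Set.Icc (0 : ℝ) 1, spectrum ℝ (H Λ s) = S₁ Λ s ∪ S₂ Λ s
  not_between : ∀ Λ, ∀ s ∈ Set.Icc (0 : ℝ) 1, ∀ a ∈ S₁ Λ s, ∀ b ∈ S₁ Λ s,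
    Disjoint (Set.Icc a b) (S₂ Λ s)
  gap : ∀ Λ, ∀ s ∈ Set.Icc (0 : ℝ) 1, ∀ a ∈ S₁ Λ s, ∀ b ∈ S₂ Λ s, γ ≤ |a - b|

/-- The spectral projection `1_S(H)` of a self-adjoint `H`. -/
def spectralProj {q : Γ → ℕ} {Λ : Finset Γ} (H : Obs q Λ) (S : Set ℝ) : Obs q Λ :=
  cfc (S.indicator (1 : ℝ → ℝ)) H

/-- The dynamics `τ_t(A) = exp(i t H) A exp(-i t H)` generated by a time-independent `H`. -/
def dynamics {q : Γ → ℕ} {Λ : Finset Γ} (H : Obs q Λ) (t : ℝ) (A : Obs q Λ) : Obs q Λ :=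
  NormedSpace.exp ((Complex.I * t) • H) * A * NormedSpace.exp ((-(Complex.I * t)) • H)

/-- The unitary Fourier transform `(2π)^{-1/2} ∫ W(t) exp(-i t ξ) dt`. -/
def fourierHat (W : ℝ → ℝ) (ξ : ℝ) : ℂ :=
  (Real.sqrt (2 * Real.pi) : ℂ)⁻¹ * ∫ t : ℝ, (W t : ℂ) * Complex.exp (-(Complex.I * t * ξ))

/-- The properties required of the weight `W_γ`. -/
structure IsWeight (γ : ℝ) (W : ℝ → ℝ) : Prop where
  integrable : MeasureTheory.Integrable W
  decay : ∀ n : ℕ, ∃ C, ∀ t : ℝ, 1 < |t| → |t| ^ n * |W t| ≤ C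
  fourier : ∀ ξ : ℝ, γ ≤ |ξ| →
    fourierHat W ξ = -Complex.I / ((Real.sqrt (2 * Real.pi) : ℂ) * ξ)

/-- `𝓘(A) = ∫ W(t) τ_t(A) dt`, where `τ` is the dynamics generated by `H`. -/
def mapI {q : Γ → ℕ} {Λ : Finset Γ} (W : ℝ → ℝ) (H A : Obs q Λ) : Obs q Λ :=
  ∫ t : ℝ, (W t : ℂ) • dynamics H t A

/-- The map `𝓘` on families: `𝓘(G)_s^Λ = 𝓘_s^Λ(G_s^Λ)`, with the dynamics of the frozen
Hamiltonian `H_s^Λ`. -/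
def mapIFamily {q : Γ → ℕ} (W : ℝ → ℝ) (H G : Family q) : Family q :=
  fun Λ s => mapI W (H Λ s) (G Λ s)

end Gap

end SpinSystem

end

/-! The four claims rest on two independent arguments.

**Inverting the commutator.** In an orthonormal eigenbasis of `H` with eigenvalues `λ_j`, the matrix
elements of `𝓘(A)` are `√(2π) Ŵ(λ_k - λ_j) A_jk`. If exactly one of `λ_j`, `λ_k` belongs to `Σ¹` then
`|λ_j - λ_k| ≥ γ`, and the condition on `Ŵ` turns this into `(λ_j - λ_k) 𝓘(A)_jk = i A_jk`
(`sub_mul_eigenMatrix_mapI_apply`). The two commutator identities are this equation, read off matrix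
element by matrix element; on the diagonal blocks both sides vanish.

**Locality.** Interactions are traded for sums `T = ∑_{x ∈ Λ} g_x` of self-adjoint operators such that
the part of `g_x` outside the ball of radius `r` around `x` is `O((1 + r) ^ (-n))` for every `n`,
uniformly in the volume and polynomially in an extra time `t` (`IsAnchored`). The part outside a
region is measured with the conditional expectation `condExp`, the average over all unitary Weyl
operators outside the region, which is a contraction. Up to scalar operators, `𝓛_{𝓢,∞}` consists of
these sums:

* an interaction gives such a sum, by distributing each term evenly over the sites of its support
  (`isAnchored_of_mem_classLS`);
* conversely, cutting each `g_x` into shells supported in balls gives an interaction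
  (`mem_classLS_of_isAnchored`). Its terms decay faster than every power, and one function
  `ζ ∈ 𝓢` dominates any given sequence of polynomial bounds (`exists_isFastDecay_le_decayF`).

Exponential decay of the interaction of `H` enters only through the Lieb–Robinson bound
(`norm_lie_evolve_le_exp`), which shows that the Heisenberg dynamics preserves localization at a
site with constants that grow polynomially in time (`hasLightCone_of_mem_classLE`). Since `W`
decays faster than every power, integration against `W` preserves localization, so that
`𝓘(G) ∈ 𝓛_{𝓢,∞}`.

For the derivatives, `τ_t(G)` is viewed as the solution of the inhomogeneous Heisenberg equation
`∂_t X = i [H, X] + F`, here with `F = 0`, given by variation of constants (`duhamel`). The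
`s`-derivative of a solution solves the same equation with differentiated data and the additional
source `i [H', X]` (`hasDerivWithinAt_duhamel`). Sums of localized operators are stable under
commutators, under solving this equation and under integration against `W`, so an induction on
the number of derivatives (`IsSmoothAnchored.duhamel`) gives all of them. Scalars are fixed by the
dynamics and are carried separately throughout, as the normalized trace `condExp ∅`. -/

noncomputable section

namespace SpinSystem

/-! ### The Heisenberg dynamics in a C*-algebra -/

section Dynamics

variable {𝔸 : Type*} [CStarAlgebra 𝔸] {H A : 𝔸}

/-- The unitary `exp(i t H)`. -/
def propagator (H : 𝔸) (t : ℝ) : 𝔸 := NormedSpace.exp ((Complex.I * t) • H)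

/-- The Heisenberg dynamics `exp(i t H) A exp(-i t H)`. -/
def evolve (H : 𝔸) (t : ℝ) (A : 𝔸) : 𝔸 := propagator H t * A * propagator H (-t)

lemma propagator_eq (H : 𝔸) (t : ℝ) :
    propagator H t = NormedSpace.exp (t • (Complex.I • H)) := by
  rw [propagator, mul_comm, mul_smul, Complex.coe_smul]

lemma propagator_zero (H : 𝔸) : propagator H 0 = 1 := by
  simp [propagator, NormedSpace.exp_zero]

lemma propagator_add (H : 𝔸) (s t : ℝ) :
    propagator H (s + t) = propagator H s * propagator H t := by
  let _ : NormedAlgebra ℚ 𝔸 := NormedAlgebra.restrictScalars ℚ ℂ 𝔸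
  simp only [propagator_eq, add_smul]
  exact NormedSpace.exp_add_of_commute
    (((Commute.refl _).smul_left _).smul_right _)

lemma propagator_mul_neg (H : 𝔸) (t : ℝ) : propagator H t * propagator H (-t) = 1 := by
  rw [← propagator_add, add_neg_cancel, propagator_zero]

lemma propagator_neg_mul (H : 𝔸) (t : ℝ) : propagator H (-t) * propagator H t = 1 := by
  rw [← propagator_add, neg_add_cancel, propagator_zero]

lemma propagator_neg_left (H : 𝔸) (t : ℝ) : propagator (-H) t = propagator H (-t) := by
  simp [propagator_eq]

lemma star_propagator (hH : IsSelfAdjoint H) (t : ℝ) :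
    star (propagator H t) = propagator H (-t) := by
  rw [propagator, propagator, NormedSpace.star_exp, star_smul, hH.star_eq]
  simp

lemma propagator_mem_unitary (hH : IsSelfAdjoint H) (t : ℝ) :
    propagator H t ∈ unitary (𝔸) := by
  rw [Unitary.mem_iff, star_propagator hH]
  exact ⟨propagator_neg_mul H t, propagator_mul_neg H t⟩

lemma hasDerivAt_propagator (H : 𝔸) (t : ℝ) :
    HasDerivAt (propagator H) (propagator H t * (Complex.I • H)) t := by
  have h := hasDerivAt_exp_smul_const (𝕂 := ℝ) (Complex.I • H) t
  have e : propagator H = fun u : ℝ => NormedSpace.exp (u • (Complex.I • H)) :=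
    funext (propagator_eq H)
  rw [e]
  exact h

lemma commute_propagator (H : 𝔸) (t : ℝ) : Commute (propagator H t) H := by
  rw [propagator_eq]
  exact (((Commute.refl H).smul_left _).smul_left _).exp_left

lemma commute_propagator_of_commute (h : Commute H A) (t : ℝ) : Commute (propagator H t) A := by
  rw [propagator_eq]
  exact ((h.smul_left _).smul_left _).exp_left

lemma hasDerivAt_propagator_neg (H : 𝔸) (t : ℝ) :
    HasDerivAt (fun t => propagator H (-t)) (-((Complex.I • H) * propagator H (-t))) t := by
  have h := (hasDerivAt_propagator H (-t)).scomp t (hasDerivAt_neg t)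
  have e : propagator H (-t) * (Complex.I • H) = (Complex.I • H) * propagator H (-t) := by
    rw [mul_smul_comm, smul_mul_assoc, (commute_propagator H (-t)).eq]
  rw [e] at h
  exact h.congr_deriv (by simp)

@[fun_prop]
lemma continuous_propagator (H : 𝔸) : Continuous (propagator H) :=
  continuous_iff_continuousAt.2 fun t => (hasDerivAt_propagator H t).continuousAt

lemma norm_unitary_conj {U : 𝔸} (hU : U ∈ unitary 𝔸) (A : 𝔸) :
    ‖U * A * star U‖ = ‖A‖ := by
  have h1 := CStarRing.norm_coe_unitary_mul ⟨U, hU⟩ (A * star U)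
  have h2 := CStarRing.norm_mul_coe_unitary A (star ⟨U, hU⟩ : unitary 𝔸)
  simp only [Unitary.coe_star] at h1 h2
  rw [mul_assoc, h1, h2]

lemma norm_evolve (hH : IsSelfAdjoint H) (t : ℝ) (A : 𝔸) :
    ‖evolve H t A‖ = ‖A‖ := by
  rw [evolve, ← star_propagator hH]
  exact norm_unitary_conj (propagator_mem_unitary hH t) A

lemma isSelfAdjoint_evolve (hH : IsSelfAdjoint H) (hA : IsSelfAdjoint A) (t : ℝ) :
    IsSelfAdjoint (evolve H t A) := by
  rw [evolve, ← star_propagator hH]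
  exact hA.conjugate (propagator H t)

lemma evolve_add_right (H : 𝔸) (t : ℝ) (A B : 𝔸) :
    evolve H t (A + B) = evolve H t A + evolve H t B := by
  simp [evolve, mul_add, add_mul]

lemma evolve_sub_right (H : 𝔸) (t : ℝ) (A B : 𝔸) :
    evolve H t (A - B) = evolve H t A - evolve H t B := by
  simp [evolve, mul_sub, sub_mul]

lemma evolve_smul (H : 𝔸) (t : ℝ) (c : ℂ) (A : 𝔸) :
    evolve H t (c • A) = c • evolve H t A := by
  simp [evolve]

lemma evolve_one (H : 𝔸) (t : ℝ) : evolve H t 1 = 1 := by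
  rw [evolve, mul_one, propagator_mul_neg]

lemma evolve_sum {ι : Type*} (s : Finset ι) (H : 𝔸) (t : ℝ) (A : ι → 𝔸) :
    evolve H t (∑ i ∈ s, A i) = ∑ i ∈ s, evolve H t (A i) := by
  simp [evolve, Finset.mul_sum, Finset.sum_mul]

lemma evolve_zero (H : 𝔸) (A : 𝔸) : evolve H 0 A = A := by
  simp [evolve, propagator_zero]

lemma evolve_evolve (H : 𝔸) (s t : ℝ) (A : 𝔸) :
    evolve H s (evolve H t A) = evolve H (s + t) A := by
  simp only [evolve, neg_add, propagator_add H s t]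
  rw [add_comm (-s), propagator_add]
  simp only [mul_assoc]

lemma evolve_neg_left (H : 𝔸) (t : ℝ) (A : 𝔸) :
    evolve (-H) t A = evolve H (-t) A := by
  simp [evolve, propagator_neg_left]

/-- Adding a scalar to the Hamiltonian does not change the dynamics. -/
lemma evolve_add_smul_one (H : 𝔸) (c : ℂ) (t : ℝ) (A : 𝔸) :
    evolve (H + c • 1) t A = evolve H t A := by
  have h : ∀ t : ℝ, propagator (H + c • 1) t =
      propagator H t * propagator (c • (1 : 𝔸)) t := by
    intro t
    let _ : NormedAlgebra ℚ 𝔸 := NormedAlgebra.restrictScalars ℚ ℂ 𝔸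
    simp only [propagator_eq, smul_add]
    exact NormedSpace.exp_add_of_commute
      (((((Commute.one_right H).smul_right c).smul_left _).smul_right _).smul_left _ |>.smul_right _)
  have hc : Commute (propagator (c • (1 : 𝔸)) t) A :=
    commute_propagator_of_commute ((Commute.one_left A).smul_left c) t
  have hH : Commute (propagator (c • (1 : 𝔸)) t) (propagator H (-t)) :=
    commute_propagator_of_commute ((Commute.one_left _).smul_left c) t
  rw [evolve, evolve, h, h]
  calc propagator H t * propagator (c • (1 : 𝔸)) t * A *
        (propagator H (-t) * propagator (c • (1 : 𝔸)) (-t))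
      = propagator H t * (propagator (c • (1 : 𝔸)) t * A) *
        (propagator H (-t) * propagator (c • (1 : 𝔸)) (-t)) := by simp only [mul_assoc]
    _ = propagator H t * A * (propagator (c • (1 : 𝔸)) t * propagator H (-t)) *
        propagator (c • (1 : 𝔸)) (-t) := by rw [hc.eq]; simp only [mul_assoc]
    _ = propagator H t * A * propagator H (-t) * (propagator (c • (1 : 𝔸)) t *
        propagator (c • (1 : 𝔸)) (-t)) := by rw [hH.eq]; simp only [mul_assoc]
    _ = _ := by rw [propagator_mul_neg, mul_one]

lemma hasDerivAt_evolve_comp (H : 𝔸) {f : ℝ → 𝔸} {f' : 𝔸} {t : ℝ}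
    (hf : HasDerivAt f f' t) :
    HasDerivAt (fun t => evolve H t (f t))
      (evolve H t (Complex.I • ⁅H, f t⁆ + f')) t := by
  have h := ((hasDerivAt_propagator H t).mul hf).mul (hasDerivAt_propagator_neg H t)
  simp only [evolve]
  refine h.congr_deriv ?_
  simp only [Ring.lie_def, mul_add, add_mul, mul_sub, sub_mul, smul_sub, mul_smul_comm,
    smul_mul_assoc, mul_neg, mul_assoc, Pi.mul_apply]
  abel

lemma hasDerivAt_evolve_neg_comp (H : 𝔸) {f : ℝ → 𝔸} {f' : 𝔸} {t : ℝ}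
    (hf : HasDerivAt f f' t) :
    HasDerivAt (fun t => evolve H (-t) (f t))
      (evolve H (-t) (f' - Complex.I • ⁅H, f t⁆)) t := by
  have h := hasDerivAt_evolve_comp (-H) hf
  simp only [evolve_neg_left] at h
  refine h.congr_deriv ?_
  congr 1
  simp only [Ring.lie_def, neg_mul, mul_neg, smul_sub, smul_neg]
  abel

lemma continuous_evolve_comp (H : 𝔸) {f g : ℝ → _} (hg : Continuous g)
    (hf : Continuous f) : Continuous fun t => evolve H (g t) (f t) := by
  simp only [evolve]
  exact (((continuous_propagator H).comp hg).mul hf).mul ((continuous_propagator H).comp hg.neg)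

lemma norm_lie_le (A B : 𝔸) : ‖⁅A, B⁆‖ ≤ 2 * ‖A‖ * ‖B‖ := by
  rw [Ring.lie_def]
  calc ‖A * B - B * A‖ ≤ ‖A * B‖ + ‖B * A‖ := norm_sub_le _ _
    _ ≤ ‖A‖ * ‖B‖ + ‖B‖ * ‖A‖ := add_le_add (norm_mul_le _ _) (norm_mul_le _ _)
    _ = _ := by ring

lemma lie_eq_add_add (A A₀ B B₀ : 𝔸) :
    ⁅A, B⁆ = ⁅A - A₀, B⁆ + ⁅A₀, B - B₀⁆ + ⁅A₀, B₀⁆ := by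
  simp only [Ring.lie_def]
  noncomm_ring

/-- The basic Lieb–Robinson inequality: if `K` collects the part of the Hamiltonian that does
not commute with `A`, then the growth of `[τ_t(A), B]` is driven by `[τ_t(K), B]` only. The
evolution `U(t) = exp(itH) exp(-it(H - K))` satisfies `τ_t(A) = U(t) A U(t)*`, and the derivative
of `U(t)* B U(t)` is a conjugate of `-i [τ_t(K), B]`. -/
lemma norm_lie_evolve_le {H K A B : 𝔸} (hH : IsSelfAdjoint H) (hK : IsSelfAdjoint K)
    (hA : Commute (H - K) A) {b b' : ℝ → ℝ} (h0 : ‖⁅A, B⁆‖ ≤ b 0)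
    (hb : ∀ t, HasDerivAt b (b' t) t) {T : ℝ}
    (hbb : ∀ t ∈ Set.Ico 0 T, 2 * ‖A‖ * ‖⁅evolve H t K, B⁆‖ ≤ b' t) :
    ∀ t ∈ Set.Icc 0 T, ‖⁅evolve H t A, B⁆‖ ≤ b t := by
  set L := H - K with hL
  have hLs : IsSelfAdjoint L := hH.sub hK
  set U : ℝ → 𝔸 := fun t => propagator H t * propagator L (-t) with hU
  set V : ℝ → 𝔸 := fun t => propagator L t * propagator H (-t) with hV
  have hVstar : ∀ t, V t = star (U t) := fun t => by
    simp only [hU, hV, star_mul, star_propagator hH, star_propagator hLs, neg_neg]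
  have hUu : ∀ t, U t ∈ unitary (𝔸) := fun t =>
    mul_mem (propagator_mem_unitary hH t) (propagator_mem_unitary hLs (-t))
  have hUV : ∀ t, U t * V t = 1 := fun t => by rw [hVstar]; exact (hUu t).2
  have hVU : ∀ t, V t * U t = 1 := fun t => by rw [hVstar]; exact (hUu t).1
  have hdyn : ∀ t, evolve H t A = U t * A * V t := by
    intro t
    have hc : Commute (propagator L (-t)) A := commute_propagator_of_commute hA _
    simp only [hU, hV, evolve]
    calc propagator H t * A * propagator H (-t)
        = propagator H t * (A * (propagator L (-t) * propagator L t)) * propagator H (-t) := by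
          rw [propagator_neg_mul, mul_one]
      _ = _ := by rw [← mul_assoc A, ← hc.eq]; simp only [mul_assoc]
  have hUd : ∀ t, HasDerivAt U (Complex.I • (evolve H t K * U t)) t := by
    intro t
    refine ((hasDerivAt_propagator H t).mul (hasDerivAt_propagator_neg L t)).congr_deriv ?_
    simp only [hU, evolve]
    have : propagator H t * K * propagator H (-t) * (propagator H t * propagator L (-t)) =
        propagator H t * K * propagator L (-t) := by
      rw [mul_assoc _ (propagator H (-t)), ← mul_assoc (propagator H (-t)), propagator_neg_mul,
        one_mul]
    rw [this, hL]
    simp only [mul_smul_comm, smul_mul_assoc, mul_neg, ← smul_neg, ← smul_add, mul_assoc,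
      sub_mul, mul_sub]
    congr 1
    abel
  have hVd : ∀ t, HasDerivAt V (-(Complex.I • (V t * evolve H t K))) t := by
    intro t
    refine ((hasDerivAt_propagator L t).mul (hasDerivAt_propagator_neg H t)).congr_deriv ?_
    simp only [hV, evolve]
    have e1 : propagator L t * propagator H (-t) * (propagator H t * K * propagator H (-t)) =
        propagator L t * K * propagator H (-t) := by
      simp only [mul_assoc]
      rw [← mul_assoc (propagator H (-t)) (propagator H t), propagator_neg_mul, one_mul]
    rw [e1, hL]
    simp only [mul_smul_comm, smul_mul_assoc, mul_neg, ← smul_neg, ← smul_add, mul_assoc,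
      sub_mul, mul_sub]
    congr 1
    abel
  set g : ℝ → 𝔸 := fun t => ⁅A, V t * B * U t⁆ with hg
  have hgd : ∀ t, HasDerivAt g (⁅A, -(Complex.I • (V t * ⁅evolve H t K, B⁆ * U t))⁆) t := by
    intro t
    have h1 := ((hVd t).mul_const B).mul (hUd t)
    have h2 := ((hasDerivAt_const t A).mul h1).sub (h1.mul (hasDerivAt_const t A))
    simp only [hg, Ring.lie_def]
    refine h2.congr_deriv ?_
    simp only [zero_mul, mul_zero, zero_add, add_zero, neg_mul, mul_neg, smul_mul_assoc,
      mul_smul_comm, mul_assoc, mul_sub, sub_mul, smul_sub, mul_add, add_mul, neg_sub]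
    abel
  have hgn : ∀ t, ‖⁅evolve H t A, B⁆‖ = ‖g t‖ := by
    intro t
    have : ⁅evolve H t A, B⁆ = U t * g t * star (U t) := by
      rw [hdyn, ← hVstar]
      simp only [hg, Ring.lie_def, mul_sub, sub_mul]
      congr 1
      · calc U t * A * V t * B = U t * A * V t * B * (U t * V t) := by rw [hUV, mul_one]
          _ = _ := by simp only [mul_assoc]
      · calc B * (U t * A * V t) = (U t * V t) * (B * (U t * A * V t)) := by rw [hUV, one_mul]
          _ = _ := by simp only [mul_assoc]
    rw [this, norm_unitary_conj (hUu t)]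
  have hconj : ∀ t (C : 𝔸), ‖V t * C * U t‖ = ‖C‖ := by
    intro t C
    have h := norm_unitary_conj (Unitary.star_mem (hUu t)) C
    rwa [star_star, ← hVstar] at h
  have hgc : Continuous g :=
    continuous_iff_continuousAt.2 fun t => (hgd t).continuousAt
  intro t ht
  rw [hgn]
  refine image_norm_le_of_norm_deriv_right_le_deriv_boundary (a := 0) (b := T) hgc.continuousOn
    (fun t _ => (hgd t).hasDerivWithinAt) ?_ hb (fun t ht => ?_) ht
  · rw [← hgn, evolve_zero]
    exact h0
  · refine (norm_lie_le _ _).trans (le_trans (le_of_eq ?_) (hbb t ht))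
    rw [norm_neg, norm_smul, Complex.norm_I, one_mul, hconj]

end Dynamics

/-! ### Weyl operators, supports and conditional expectations -/

section Local

variable {Γ : Type*} [DecidableEq Γ] {q : Γ → ℕ} [∀ x, NeZero (q x)] {Λ : Finset Γ}

/-- The basis label `σ` with its part in `X` set to zero. Labels form an additive group, with
addition modulo `q x` at the site `x`. -/
def Config.off (X : Finset Γ) (σ : Config q Λ) : Config q Λ :=
  fun x => if x.1 ∈ X then 0 else σ x

namespace Config

variable {X Y : Finset Γ} {σ τ : Config q Λ}

lemma off_add : (σ + τ).off X = σ.off X + τ.off X := by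
  funext x; by_cases h : x.1 ∈ X <;> simp [off, h]

lemma off_neg : (-σ).off X = -σ.off X := by
  funext x; by_cases h : x.1 ∈ X <;> simp [off, h]

lemma off_sub : (σ - τ).off X = σ.off X - τ.off X := by
  rw [sub_eq_add_neg, off_add, off_neg, sub_eq_add_neg]

@[simp] lemma off_off : (σ.off X).off X = σ.off X := by
  funext x; by_cases h : x.1 ∈ X <;> simp [off, h]

lemma off_off_of_subset (h : X ⊆ Y) : (σ.off X).off Y = σ.off Y := by
  funext x
  by_cases hy : x.1 ∈ Y
  · simp [off, hy]
  · have hx : x.1 ∉ X := fun hx => hy (h hx)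
    simp [off, hx, hy]

lemma off_eq_self_iff : σ.off X = σ ↔ ∀ x : {x // x ∈ Λ}, x.1 ∈ X → σ x = 0 := by
  constructor
  · intro h x hx
    rw [← h]; simp [off, hx]
  · intro h
    funext x
    by_cases hx : x.1 ∈ X
    · simp [off, hx, h x hx]
    · simp [off, hx]

lemma off_eq_zero_iff : σ.off X = 0 ↔ ∀ x : {x // x ∈ Λ}, x.1 ∉ X → σ x = 0 := by
  constructor
  · intro h x hx
    simpa [off, hx] using congrFun h x
  · intro h
    funext x
    by_cases hx : x.1 ∈ X
    · simp [off, hx]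
    · simp [off, hx, h x hx]

lemma off_eq_self_of_disjoint (h : Disjoint X Y) (hσ : σ.off Y = 0) : σ.off X = σ :=
  off_eq_self_iff.2 fun x hx => off_eq_zero_iff.1 hσ x (Finset.disjoint_left.1 h hx)

lemma off_eq_off_iff : σ.off X = τ.off X ↔ ∀ x : {x // x ∈ Λ}, x.1 ∉ X → σ x = τ x := by
  rw [← sub_eq_zero, ← off_sub, off_eq_zero_iff]
  simp [sub_eq_zero]

end Config

open Config

/-- `A ∈ 𝓐^X ⊗ 1`: the operator `A` on the volume `Λ` is supported in `X`. In the product basis,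
`A` is diagonal in the labels outside `X`, with entries that do not change when these labels are
translated. -/
structure IsSupported (X : Finset Γ) (A : Obs q Λ) : Prop where
  diag : ∀ σ τ : Config q Λ, σ.off X ≠ τ.off X → A σ τ = 0
  trans : ∀ σ τ η : Config q Λ, A (σ + η.off X) (τ + η.off X) = A σ τ

/-- The Weyl operator outside `X` with translation `η` and character `ψ`. -/
def weyl (X : Finset Γ) (η : Config q Λ) (ψ : AddChar (Config q Λ) ℂ) : Obs q Λ :=
  Matrix.of fun σ τ => if τ = σ + η.off X then ψ (σ.off X) else 0

/-- The conditional expectation onto the operators supported in `X` (the normalized partial trace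
over the sites outside `X`), written as the average over conjugation by the Weyl operators. -/
def condExp (X : Finset Γ) : Obs q Λ →L[ℂ] Obs q Λ :=
  ((Fintype.card (Config q Λ) : ℂ) ^ 2)⁻¹ • ∑ η : Config q Λ, ∑ ψ : AddChar (Config q Λ) ℂ,
    (ContinuousLinearMap.mul ℂ (Obs q Λ) (weyl X η ψ)) ∘L
      (ContinuousLinearMap.mul ℂ (Obs q Λ)).flip (star (weyl X η ψ))

lemma condExp_apply (X : Finset Γ) (A : Obs q Λ) :
    condExp X A = ((Fintype.card (Config q Λ) : ℂ) ^ 2)⁻¹ •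
      ∑ η : Config q Λ, ∑ ψ : AddChar (Config q Λ) ℂ,
        weyl X η ψ * A * star (weyl X η ψ) := by
  simp [condExp, mul_assoc]

variable {X Y : Finset Γ}

lemma weyl_mul_apply (η : Config q Λ) (ψ : AddChar (Config q Λ) ℂ) (A : Obs q Λ)
    (σ τ : Config q Λ) :
    (weyl X η ψ * A) σ τ = ψ (σ.off X) * A (σ + η.off X) τ := by
  simp [Matrix.mul_apply, weyl]

lemma mul_star_weyl_apply (η : Config q Λ) (ψ : AddChar (Config q Λ) ℂ) (A : Obs q Λ)
    (σ τ : Config q Λ) :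
    (A * star (weyl X η ψ)) σ τ = A σ (τ + η.off X) * star (ψ (τ.off X)) := by
  simp [Matrix.mul_apply, weyl, Matrix.star_apply, apply_ite]

omit [DecidableEq Γ] in
lemma addChar_mul_star (ψ : AddChar (Config q Λ) ℂ) (σ : Config q Λ) : ψ σ * star (ψ σ) = 1 := by
  have h := Complex.mul_conj (ψ σ)
  rw [Complex.normSq_eq_norm_sq, AddChar.norm_apply] at h
  simpa using h

omit [DecidableEq Γ] in
lemma addChar_star (ψ : AddChar (Config q Λ) ℂ) (σ : Config q Λ) : star (ψ σ) = ψ (-σ) := by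
  have h := addChar_mul_star ψ σ
  have h2 : ψ (-σ) * ψ σ = 1 := by
    rw [← AddChar.map_add_eq_mul]; simp
  calc star (ψ σ) = (ψ (-σ) * ψ σ) * star (ψ σ) := by rw [h2, one_mul]
    _ = ψ (-σ) := by rw [mul_assoc, h, mul_one]

lemma weyl_mem_unitary (η : Config q Λ) (ψ : AddChar (Config q Λ) ℂ) :
    weyl X η ψ ∈ unitary (Obs q Λ) := by
  have h : weyl X η ψ * star (weyl X η ψ) = 1 := by
    ext σ τ
    rw [mul_star_weyl_apply]
    simp only [weyl, Matrix.of_apply, Matrix.one_apply, add_left_inj]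
    by_cases h : τ = σ
    · subst h; simpa using addChar_mul_star ψ _
    · simp [h, Ne.symm h]
  exact (Matrix.mem_unitaryGroup_iff).2 h

lemma isSupported_weyl (h : Λ ⊆ X ∪ Y) (η : Config q Λ) (ψ : AddChar (Config q Λ) ℂ) :
    IsSupported Y (weyl X η ψ) where
  diag σ τ hne := by
    have : τ ≠ σ + η.off X := by
      rintro rfl
      apply hne
      rw [off_eq_off_iff]
      intro x hx
      have : x.1 ∈ X := by
        rcases Finset.mem_union.1 (h x.2) with h | h
        · exact h
        · exact absurd h hx
      simp [off, this]
    simp [weyl, this]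
  trans σ τ ξ := by
    have h1 : (ξ.off Y).off X = 0 := by
      rw [off_eq_zero_iff]
      intro x hx
      have : x.1 ∈ Y := by
        rcases Finset.mem_union.1 (h x.2) with h | h
        · exact absurd h hx
        · exact h
      simp [off, this]
    simp only [weyl, Matrix.of_apply, off_add, h1, add_zero, add_right_comm σ, add_left_inj]

lemma condExp_entry (A : Obs q Λ) (σ τ : Config q Λ) :
    condExp X A σ τ = if σ.off X = τ.off X then
      (Fintype.card (Config q Λ) : ℂ)⁻¹ * ∑ η : Config q Λ, A (σ + η.off X) (τ + η.off X)
      else 0 := by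
  have hN : (Fintype.card (Config q Λ) : ℂ) ≠ 0 := by
    exact_mod_cast Fintype.card_ne_zero
  have key : ∀ η : Config q Λ, ∑ ψ : AddChar (Config q Λ) ℂ,
      (weyl X η ψ * A * star (weyl X η ψ)) σ τ =
        if σ.off X = τ.off X then (Fintype.card (Config q Λ) : ℂ) *
          A (σ + η.off X) (τ + η.off X) else 0 := by
    intro η
    have : ∀ ψ : AddChar (Config q Λ) ℂ, (weyl X η ψ * A * star (weyl X η ψ)) σ τ =
        ψ (σ.off X - τ.off X) * A (σ + η.off X) (τ + η.off X) := by
      intro ψ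
      rw [mul_star_weyl_apply, weyl_mul_apply, addChar_star, sub_eq_add_neg,
        AddChar.map_add_eq_mul]
      ring
    simp_rw [this]
    rw [← Finset.sum_mul, AddChar.sum_apply_eq_ite]
    by_cases h : σ.off X = τ.off X
    · simp [h]
    · simp [h, sub_eq_zero]
  rw [condExp_apply, Matrix.smul_apply, Matrix.sum_apply]
  simp_rw [Matrix.sum_apply, key]
  by_cases h : σ.off X = τ.off X
  · simp only [h, if_true, smul_eq_mul, ← Finset.mul_sum]
    field_simp
  · simp [h]

lemma isSupported_condExp (A : Obs q Λ) : IsSupported X (condExp X A) where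
  diag σ τ h := by rw [condExp_entry, if_neg h]
  trans σ τ η := by
    rw [condExp_entry, condExp_entry]
    simp only [off_add, off_off, add_left_inj]
    congr 2
    refine Fintype.sum_equiv (Equiv.addLeft η) _ _ fun ξ => ?_
    simp [off_add, add_assoc]

lemma IsSupported.condExp_eq {A : Obs q Λ} (hA : IsSupported X A) : condExp X A = A := by
  have hN : (Fintype.card (Config q Λ) : ℂ) ≠ 0 := by
    exact_mod_cast Fintype.card_ne_zero
  ext σ τ
  rw [condExp_entry]
  split_ifs with h
  · simp only [hA.trans, Finset.sum_const, Finset.card_univ, nsmul_eq_mul]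
    rw [← mul_assoc, inv_mul_cancel₀ hN, one_mul]
  · exact (hA.diag σ τ h).symm

lemma IsSupported.commute_weyl {A : Obs q Λ} (hA : IsSupported X A) (η : Config q Λ)
    (ψ : AddChar (Config q Λ) ℂ) : weyl X η ψ * A * star (weyl X η ψ) = A := by
  ext σ τ
  rw [mul_star_weyl_apply, weyl_mul_apply, hA.trans]
  by_cases h : σ.off X = τ.off X
  · rw [h, mul_right_comm, addChar_mul_star, one_mul]
  · simp [hA.diag σ τ h]

lemma isSupported_iff_condExp_eq {A : Obs q Λ} : IsSupported X A ↔ condExp X A = A :=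
  ⟨fun h => h.condExp_eq, fun h => h ▸ isSupported_condExp A⟩

lemma average_weyl_const (A : Obs q Λ) : ((Fintype.card (Config q Λ) : ℂ) ^ 2)⁻¹ •
    ∑ _η : Config q Λ, ∑ _ψ : AddChar (Config q Λ) ℂ, A = A := by
  have hN : (Fintype.card (Config q Λ) : ℂ) ≠ 0 := by
    exact_mod_cast Fintype.card_ne_zero
  have hc : Fintype.card (AddChar (Config q Λ) ℂ) = Fintype.card (Config q Λ) :=
    AddChar.card_eq
  simp only [Finset.sum_const, Finset.card_univ, hc, smul_smul, ← Nat.cast_smul_eq_nsmul ℂ]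
  rw [← sq, inv_mul_cancel₀ (pow_ne_zero 2 hN), one_smul]

lemma isSupported_of_weyl {A : Obs q Λ}
    (h : ∀ η ψ, weyl X η ψ * A * star (weyl X η ψ) = A) : IsSupported X A := by
  rw [isSupported_iff_condExp_eq, condExp_apply]
  simp only [h, average_weyl_const]

namespace IsSupported

variable {A B : Obs q Λ}

lemma mul (hA : IsSupported X A) (hB : IsSupported X B) : IsSupported X (A * B) := by
  refine isSupported_of_weyl fun η ψ => ?_
  have hu : star (weyl X η ψ) * weyl X η ψ = 1 := (weyl_mem_unitary η ψ).1
  calc weyl X η ψ * (A * B) * star (weyl X η ψ)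
      = (weyl X η ψ * A * star (weyl X η ψ)) * (weyl X η ψ * B * star (weyl X η ψ)) := by
        simp only [mul_assoc]
        rw [← mul_assoc (star (weyl X η ψ)) (weyl X η ψ), hu, one_mul]
    _ = A * B := by rw [hA.commute_weyl, hB.commute_weyl]

lemma sub (hA : IsSupported X A) (hB : IsSupported X B) : IsSupported X (A - B) := by
  rw [isSupported_iff_condExp_eq, map_sub, hA.condExp_eq, hB.condExp_eq]

lemma smul (c : ℂ) (hA : IsSupported X A) : IsSupported X (c • A) := by
  rw [isSupported_iff_condExp_eq, map_smul, hA.condExp_eq]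

lemma lie (hA : IsSupported X A) (hB : IsSupported X B) : IsSupported X ⁅A, B⁆ :=
  (hA.mul hB).sub (hB.mul hA)

lemma mono (h : X ⊆ Y) (hA : IsSupported X A) : IsSupported Y A where
  diag σ τ hne := hA.diag σ τ fun he => hne (by
    rw [← off_off_of_subset h, he, off_off_of_subset h])
  trans σ τ η := by
    have : (η.off Y).off X = η.off Y := by
      rw [off_eq_self_iff]
      intro x hx
      simp [off, h hx]
    rw [← this, hA.trans]

/-- Operators with disjoint supports commute. The sums over intermediate labels agree term by
term after the reflection `ρ ↦ σ + τ - ρ`. -/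
lemma commute_of_disjoint (h : Disjoint X Y) (hA : IsSupported X A) (hB : IsSupported Y B) :
    A * B = B * A := by
  ext σ τ
  rw [Matrix.mul_apply, Matrix.mul_apply]
  refine Fintype.sum_equiv (Equiv.subLeft (σ + τ)) _ _ fun ρ => ?_
  simp only [Equiv.subLeft_apply]
  by_cases h1 : σ.off X = ρ.off X
  swap
  · rw [hA.diag _ _ h1, hA.diag (σ + τ - ρ) τ, zero_mul, mul_zero]
    intro h2
    apply h1
    rw [off_sub, off_add] at h2
    have h3 : τ.off X + (σ.off X - ρ.off X) = τ.off X := by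
      conv_rhs => rw [← h2]
      abel
    exact sub_eq_zero.1 (by simpa using h3)
  by_cases h2 : ρ.off Y = τ.off Y
  swap
  · rw [hB.diag _ _ h2, hB.diag σ (σ + τ - ρ), zero_mul, mul_zero]
    intro h3
    apply h2
    rw [off_sub, off_add] at h3
    have h4 : σ.off Y + (τ.off Y - ρ.off Y) = σ.off Y := by
      conv_rhs => rw [h3]
      abel
    exact (sub_eq_zero.1 (by simpa using h4)).symm
  have e1 : (τ - ρ).off X = τ - ρ :=
    off_eq_self_of_disjoint h (by rw [off_sub, h2, sub_self])
  have e2 : (σ - ρ).off Y = σ - ρ :=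
    off_eq_self_of_disjoint h.symm (by rw [off_sub, h1, sub_self])
  have f1 := hA.trans σ ρ (τ - ρ)
  have f2 := hB.trans ρ τ (σ - ρ)
  rw [e1] at f1
  rw [e2] at f2
  have g1 : σ + (τ - ρ) = σ + τ - ρ := by abel
  have g2 : ρ + (τ - ρ) = τ := by abel
  have g3 : ρ + (σ - ρ) = σ := by abel
  have g4 : τ + (σ - ρ) = σ + τ - ρ := by abel
  rw [g1, g2] at f1
  rw [g3, g4] at f2
  rw [f1, f2, mul_comm]

lemma lie_eq_zero_of_disjoint (h : Disjoint X Y) (hA : IsSupported X A) (hB : IsSupported Y B) :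
    ⁅A, B⁆ = 0 := by
  rw [Ring.lie_def, hA.commute_of_disjoint h hB, sub_self]

end IsSupported

lemma isSupported_univ (h : Λ ⊆ X) (A : Obs q Λ) : IsSupported X A := by
  have : ∀ σ : Config q Λ, σ.off X = 0 := fun σ =>
    off_eq_zero_iff.2 fun x hx => absurd (h x.2) hx
  exact ⟨fun σ τ hne => absurd ((this σ).trans (this τ).symm) hne, fun σ τ η => by simp [this]⟩

lemma condExp_eq_self (h : Λ ⊆ X) (A : Obs q Λ) : condExp X A = A :=
  (isSupported_univ h A).condExp_eq

lemma star_condExp (A : Obs q Λ) : star (condExp X A) = condExp X (star A) := by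
  ext σ τ
  simp only [Matrix.star_apply, condExp_entry]
  by_cases h : σ.off X = τ.off X
  · simp [h]
  · simp [h, Ne.symm h]

lemma isSelfAdjoint_condExp {A : Obs q Λ} (h : IsSelfAdjoint A) :
    IsSelfAdjoint (condExp X A) := by
  rw [IsSelfAdjoint, star_condExp, h.star_eq]

lemma norm_average_weyl_le (f : Config q Λ → AddChar (Config q Λ) ℂ → Obs q Λ) {C : ℝ}
    (h : ∀ η ψ, ‖f η ψ‖ ≤ C) :
    ‖((Fintype.card (Config q Λ) : ℂ) ^ 2)⁻¹ • ∑ η, ∑ ψ, f η ψ‖ ≤ C := by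
  have hN : (Fintype.card (Config q Λ) : ℝ) ≠ 0 := by
    exact_mod_cast Fintype.card_ne_zero
  have hc : Fintype.card (AddChar (Config q Λ) ℂ) = Fintype.card (Config q Λ) :=
    AddChar.card_eq
  have h1 : ‖∑ η, ∑ ψ, f η ψ‖ ≤ (Fintype.card (Config q Λ) : ℝ) ^ 2 * C := by
    calc ‖∑ η, ∑ ψ, f η ψ‖ ≤ ∑ _η : Config q Λ, ∑ _ψ : AddChar (Config q Λ) ℂ, C :=
          (norm_sum_le _ _).trans <| Finset.sum_le_sum fun η _ =>
            (norm_sum_le _ _).trans <| Finset.sum_le_sum fun ψ _ => h η ψ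
      _ = _ := by
          simp only [Finset.sum_const, Finset.card_univ, hc, nsmul_eq_mul]
          ring
  rw [norm_smul, norm_inv, norm_pow, Complex.norm_natCast]
  calc _ ≤ ((Fintype.card (Config q Λ) : ℝ) ^ 2)⁻¹ * ((Fintype.card (Config q Λ) : ℝ) ^ 2 * C) := by
        gcongr
    _ = C := by field_simp

lemma norm_condExp_le (A : Obs q Λ) : ‖condExp X A‖ ≤ ‖A‖ := by
  rw [condExp_apply]
  exact norm_average_weyl_le _ fun η ψ => (norm_unitary_conj (weyl_mem_unitary η ψ) A).le

/-- An operator that almost commutes with the operators supported in the complement of `X` is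
close to its conditional expectation onto `X`. -/
lemma norm_sub_condExp_le {A : Obs q Λ} {C : ℝ} (hY : Λ ⊆ X ∪ Y)
    (h : ∀ B ∈ unitary (Obs q Λ), IsSupported Y B → ‖⁅A, B⁆‖ ≤ C) :
    ‖A - condExp X A‖ ≤ C := by
  have : A - condExp X A = ((Fintype.card (Config q Λ) : ℂ) ^ 2)⁻¹ •
      ∑ η : Config q Λ, ∑ ψ : AddChar (Config q Λ) ℂ,
        (A - weyl X η ψ * A * star (weyl X η ψ)) := by
    simp only [Finset.sum_sub_distrib, smul_sub, ← condExp_apply, average_weyl_const]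
  rw [this]
  refine norm_average_weyl_le _ fun η ψ => ?_
  have hu := weyl_mem_unitary (X := X) η ψ
  have hW : A - weyl X η ψ * A * star (weyl X η ψ) = ⁅A, weyl X η ψ⁆ * star (weyl X η ψ) := by
    rw [Ring.lie_def, sub_mul, mul_assoc A, hu.2, mul_one]
  have h2 := CStarRing.norm_mul_coe_unitary ⁅A, weyl X η ψ⁆ (star ⟨_, hu⟩ : unitary (Obs q Λ))
  simp only [Unitary.coe_star] at h2
  rw [hW, h2]
  exact h _ hu (isSupported_weyl hY η ψ)

/-! ### The embedding of the observables of a smaller volume -/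

lemma restrict_off (h : X ⊆ Λ) (σ : Config q Λ) (η : Config q Λ) :
    (σ + η.off X).restrict h = σ.restrict h := by
  funext x
  simp [Config.restrict, off, x.2]

lemma embed_apply (h : X ⊆ Λ) (A : Obs q X) (σ τ : Config q Λ) :
    embed h A σ τ = if σ.off X = τ.off X then A (σ.restrict h) (τ.restrict h) else 0 := by
  simp only [embed, Matrix.of_apply, off_eq_off_iff]

lemma isSupported_embed (h : X ⊆ Λ) (A : Obs q X) : IsSupported X (embed h A) where
  diag σ τ hne := by rw [embed_apply, if_neg hne]
  trans σ τ η := by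
    simp only [embed_apply, off_add, restrict_off, add_left_inj]

/-- Extension of basis labels of `X` by zero. -/
def extendLabel (Λ : Finset Γ) (σ : Config q X) : Config q Λ :=
  fun x => if h : x.1 ∈ X then σ ⟨x.1, h⟩ else 0

lemma restrict_extendLabel (h : X ⊆ Λ) (σ : Config q X) :
    (extendLabel Λ σ).restrict h = σ := by
  funext x
  simp [extendLabel, Config.restrict]

lemma off_extendLabel (σ : Config q X) : (extendLabel Λ σ).off X = 0 := by
  rw [off_eq_zero_iff]
  intro x hx
  simp [extendLabel, hx]

lemma extendLabel_restrict (h : X ⊆ Λ) (σ : Config q Λ) :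
    extendLabel Λ (σ.restrict h) = σ - σ.off X := by
  funext x
  by_cases hx : x.1 ∈ X <;> simp [extendLabel, Config.restrict, off, hx]

/-- The observable of `X` obtained from an observable of `Λ` by fixing the labels outside `X`;
inverse to `embed` on the operators supported in `X`. -/
def reduce (X : Finset Γ) (A : Obs q Λ) : Obs q X :=
  Matrix.of fun σ τ => A (extendLabel Λ σ) (extendLabel Λ τ)

lemma embed_reduce (h : X ⊆ Λ) {A : Obs q Λ} (hA : IsSupported X A) :
    embed h (reduce X A) = A := by
  ext σ τ
  rw [embed_apply]
  split_ifs with hst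
  · simp only [reduce, Matrix.of_apply, extendLabel_restrict]
    have h1 := hA.trans σ τ (-σ)
    simp only [off_neg, ← sub_eq_add_neg] at h1
    rw [← h1, hst]
  · exact (hA.diag σ τ hst).symm

lemma reduce_embed (h : X ⊆ Λ) (A : Obs q X) : reduce X (embed h A) = A := by
  ext σ τ
  simp [reduce, embed_apply, off_extendLabel, restrict_extendLabel]

lemma embed_injective (h : X ⊆ Λ) : Function.Injective (embed (q := q) h) :=
  fun A B hAB => by rw [← reduce_embed h A, hAB, reduce_embed]

lemma reduce_star (A : Obs q Λ) : reduce X (star A) = star (reduce X A) := by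
  ext σ τ
  simp [reduce, Matrix.star_apply]

lemma reduce_mul (h : X ⊆ Λ) {A B : Obs q Λ} (hA : IsSupported X A) :
    reduce X (A * B) = reduce X A * reduce X B := by
  ext σ τ
  simp only [reduce, Matrix.of_apply, Matrix.mul_apply]
  have hinj : Function.Injective (extendLabel (q := q) (X := X) Λ) := fun a b hab => by
    rw [← restrict_extendLabel h a, hab, restrict_extendLabel]
  have hA0 : ∀ ρ ∉ Finset.univ.image (extendLabel (q := q) (X := X) Λ),
      A (extendLabel Λ σ) ρ = 0 := by
    intro ρ hρ
    refine hA.diag _ _ fun he => hρ ?_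
    rw [off_extendLabel] at he
    refine Finset.mem_image.2 ⟨ρ.restrict h, Finset.mem_univ _, ?_⟩
    rw [extendLabel_restrict, ← he, sub_zero]
  rw [← Finset.sum_image (f := fun ρ => A (extendLabel Λ σ) ρ * B ρ (extendLabel Λ τ))
    (fun a _ b _ hab => hinj hab)]
  exact (Finset.sum_subset (Finset.subset_univ _) fun ρ _ hρ => by rw [hA0 ρ hρ, zero_mul]).symm

/-- The embedding `A ↦ A ⊗ 1` as a star homomorphism. -/
def embedHom (h : X ⊆ Λ) : Obs q X →⋆ₙₐ[ℂ] Obs q Λ where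
  toFun := embed h
  map_smul' c A := by
    ext σ τ; simp [embed_apply]
  map_zero' := by
    ext σ τ; simp [embed_apply]
  map_add' A B := by
    ext σ τ
    simp only [embed_apply, Matrix.add_apply]
    split_ifs <;> simp
  map_mul' A B := by
    have h1 := isSupported_embed h A
    have h2 := isSupported_embed h B
    rw [← embed_reduce h (h1.mul h2), reduce_mul h h1, reduce_embed, reduce_embed]
  map_star' A := by
    ext σ τ
    simp only [embed_apply, Matrix.star_apply]
    by_cases hst : σ.off X = τ.off X
    · simp [hst]
    · simp [hst, Ne.symm hst]

lemma norm_embed (h : X ⊆ Λ) (A : Obs q X) : ‖embed h A‖ = ‖A‖ :=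
  NonUnitalStarAlgHom.norm_map (embedHom h) (embed_injective h) A

lemma norm_reduce (h : X ⊆ Λ) {A : Obs q Λ} (hA : IsSupported X A) : ‖reduce X A‖ = ‖A‖ := by
  rw [← norm_embed h, embed_reduce h hA]

lemma isSelfAdjoint_embed (h : X ⊆ Λ) {A : Obs q X} (hA : IsSelfAdjoint A) :
    IsSelfAdjoint (embed h A) :=
  hA.map (embedHom h)

lemma isSelfAdjoint_reduce {A : Obs q Λ} (hA : IsSelfAdjoint A) :
    IsSelfAdjoint (reduce X A) := by
  rw [IsSelfAdjoint, ← reduce_star, hA.star_eq]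

/-- Operators supported in the empty set are scalars. -/
lemma IsSupported.eq_smul_one {A : Obs q Λ} (hA : IsSupported ∅ A) : A = A 0 0 • 1 := by
  ext σ τ
  by_cases h : σ = τ
  · subst h
    have h1 := hA.trans 0 0 σ
    have h2 : σ.off ∅ = σ := off_eq_self_iff.2 (by simp)
    rw [zero_add, h2] at h1
    simp [h1]
  · have h2 : ∀ ρ : Config q Λ, ρ.off ∅ = ρ := fun ρ => off_eq_self_iff.2 (by simp)
    rw [hA.diag σ τ (by rwa [h2, h2])]
    simp [h]

end Local

/-! ### The Lieb–Robinson bound -/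

section LiebRobinson

variable {Γ : Type*} [DecidableEq Γ] {q : Γ → ℕ} [∀ x, NeZero (q x)] {Λ : Finset Γ}

lemma sum_biUnion_le {ι κ : Type*} [DecidableEq κ] (s : Finset ι) (t : ι → Finset κ) (f : κ → ℝ)
    (hf : ∀ k, 0 ≤ f k) : ∑ k ∈ s.biUnion t, f k ≤ ∑ i ∈ s, ∑ k ∈ t i, f k := by
  classical
  induction s using Finset.induction_on with
  | empty => simp
  | insert i s hi ih =>
    rw [Finset.biUnion_insert, Finset.sum_insert hi]
    calc ∑ k ∈ t i ∪ s.biUnion t, f k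
        ≤ ∑ k ∈ t i ∪ s.biUnion t, f k + ∑ k ∈ t i ∩ s.biUnion t, f k :=
          le_add_of_nonneg_right (Finset.sum_nonneg fun k _ => hf k)
      _ = ∑ k ∈ t i, f k + ∑ k ∈ s.biUnion t, f k := Finset.sum_union_inter
      _ ≤ _ := by gcongr

/-- **Lieb–Robinson bound.** The Hamiltonian is a sum of terms `φ Z` supported in `Z`, and `w` is
a weight with `∑_{Z ∋ x} ‖φ Z‖ ∑_{z ∈ Z} w z ≤ v w x`, at least one on the support of `B`. -/
lemma norm_lie_evolve_le_exp_of_nonneg (φ : Finset Γ → Obs q Λ) (hφ : ∀ Z, IsSelfAdjoint (φ Z))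
    (hsupp : ∀ Z, IsSupported Z (φ Z)) (w : Γ → ℝ) (hw : ∀ x, 0 < w x) (v : ℝ) (hv : 0 < v)
    (hvw : ∀ x ∈ Λ, ∑ Z ∈ Λ.powerset with x ∈ Z, ‖φ Z‖ * ∑ z ∈ Z, w z ≤ v * w x)
    {Y : Finset Γ} (hY : ∀ y ∈ Y, 1 ≤ w y) {B : Obs q Λ} (hB : IsSupported Y B)
    {X : Finset Γ} (hX : X ⊆ Λ) (hXne : X.Nonempty) {A : Obs q Λ} (hA : IsSupported X A)
    {t : ℝ} (ht : 0 ≤ t) :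
    ‖⁅evolve (∑ Z ∈ Λ.powerset, φ Z) t A, B⁆‖ ≤
      4 * ‖B‖ * ‖A‖ * (∑ x ∈ X, w x) * Real.exp (4 * v * t) := by
  set H := ∑ Z ∈ Λ.powerset, φ Z with hHdef
  have hH : IsSelfAdjoint H := isSelfAdjoint_sum _ fun Z _ => hφ Z
  -- `P b`: the constant `b` is admissible in the bound on `[0, t]`, for all `X` and `A`.
  set P : ℝ → Prop := fun b => 0 ≤ b ∧ ∀ X ⊆ Λ, X.Nonempty → ∀ A : Obs q Λ, IsSupported X A →
    ∀ u ∈ Set.Icc 0 t, ‖⁅evolve H u A, B⁆‖ ≤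
      b * ‖A‖ * (∑ x ∈ X, w x) * Real.exp (4 * v * u) with hP
  have hwpos : ∀ X : Finset Γ, X.Nonempty → 0 < ∑ x ∈ X, w x := fun X hX =>
    Finset.sum_pos (fun x _ => hw x) hX
  -- Inserting an admissible bound for the terms that touch `X` into the basic inequality halves the
  -- constant, since the exponent `4 v` is twice the rate `2 v` of that inequality.
  have step : ∀ b, P b → P (2 * ‖B‖ + b / 2) := by
    rintro b ⟨hb0, hb⟩
    refine ⟨by positivity, fun X hX hXne A hA => ?_⟩
    set S := ∑ x ∈ X, w x with hS
    have hSpos : 0 < S := hwpos X hXne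
    set K := ∑ Z ∈ Λ.powerset with ¬ Disjoint Z X, φ Z with hKdef
    have hK : IsSelfAdjoint K := isSelfAdjoint_sum _ fun Z _ => hφ Z
    have hHK : Commute (H - K) A := by
      have : H - K = ∑ Z ∈ Λ.powerset with Disjoint Z X, φ Z := by
        rw [hHdef, hKdef, ← Finset.sum_filter_add_sum_filter_not Λ.powerset (fun Z => Disjoint Z X)]
        abel
      rw [this]
      exact Commute.sum_left _ _ _ fun Z hZ =>
        (hsupp Z).commute_of_disjoint (Finset.mem_filter.1 hZ).2 hA
    have hKb : ∀ u ∈ Set.Ico 0 t, ‖⁅evolve H u K, B⁆‖ ≤ b * (v * S) * Real.exp (4 * v * u) := by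
      intro u hu
      have h1 : ⁅evolve H u K, B⁆ =
          ∑ Z ∈ Λ.powerset with ¬ Disjoint Z X, ⁅evolve H u (φ Z), B⁆ := by
        simp only [hKdef, evolve_sum, Ring.lie_def, Finset.sum_mul, Finset.mul_sum,
          Finset.sum_sub_distrib]
      have h2 : ∑ Z ∈ Λ.powerset with ¬ Disjoint Z X, ‖φ Z‖ * ∑ z ∈ Z, w z ≤ v * S := by
        calc ∑ Z ∈ Λ.powerset with ¬ Disjoint Z X, ‖φ Z‖ * ∑ z ∈ Z, w z
            ≤ ∑ Z ∈ X.biUnion (fun x => Λ.powerset.filter (x ∈ ·)), ‖φ Z‖ * ∑ z ∈ Z, w z := by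
              refine Finset.sum_le_sum_of_subset_of_nonneg ?_ fun Z _ _ =>
                mul_nonneg (norm_nonneg _) (Finset.sum_nonneg fun z _ => (hw z).le)
              intro Z hZ
              obtain ⟨hZ1, hZ2⟩ := Finset.mem_filter.1 hZ
              obtain ⟨x, hxZ, hxX⟩ := Finset.not_disjoint_iff.1 hZ2
              exact Finset.mem_biUnion.2 ⟨x, hxX, Finset.mem_filter.2 ⟨hZ1, hxZ⟩⟩
          _ ≤ ∑ x ∈ X, ∑ Z ∈ Λ.powerset with x ∈ Z, ‖φ Z‖ * ∑ z ∈ Z, w z :=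
              sum_biUnion_le _ _ _
                fun Z => mul_nonneg (norm_nonneg _) (Finset.sum_nonneg fun z _ => (hw z).le)
          _ ≤ ∑ x ∈ X, v * w x := Finset.sum_le_sum fun x hx => hvw x (hX hx)
          _ = v * S := by rw [hS, Finset.mul_sum]
      rw [h1]
      calc ‖∑ Z ∈ Λ.powerset with ¬ Disjoint Z X, ⁅evolve H u (φ Z), B⁆‖
          ≤ ∑ Z ∈ Λ.powerset with ¬ Disjoint Z X,
              b * ‖φ Z‖ * (∑ z ∈ Z, w z) * Real.exp (4 * v * u) := by
            refine norm_sum_le_of_le _ fun Z hZ => ?_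
            obtain ⟨hZ1, hZ2⟩ := Finset.mem_filter.1 hZ
            obtain ⟨x, hxZ, -⟩ := Finset.not_disjoint_iff.1 hZ2
            exact hb Z (Finset.mem_powerset.1 hZ1) ⟨x, hxZ⟩ _ (hsupp Z) u ⟨hu.1, hu.2.le⟩
        _ = b * (∑ Z ∈ Λ.powerset with ¬ Disjoint Z X, ‖φ Z‖ * ∑ z ∈ Z, w z) *
              Real.exp (4 * v * u) := by
            rw [Finset.mul_sum, Finset.sum_mul]
            exact Finset.sum_congr rfl fun Z _ => by ring
        _ ≤ b * (v * S) * Real.exp (4 * v * u) := by gcongr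
    have h0 : ‖⁅A, B⁆‖ ≤ 2 * ‖B‖ * ‖A‖ * S := by
      by_cases hd : Disjoint X Y
      · rw [hA.lie_eq_zero_of_disjoint hd hB, norm_zero]
        positivity
      · obtain ⟨x, hx, hxY⟩ := Finset.not_disjoint_iff.1 hd
        have : 1 ≤ S := (hY x hxY).trans
          (Finset.single_le_sum (f := w) (fun z _ => (hw z).le) hx)
        calc ‖⁅A, B⁆‖ ≤ 2 * ‖A‖ * ‖B‖ := norm_lie_le A B
          _ = 2 * ‖B‖ * ‖A‖ * 1 := by ring
          _ ≤ _ := by gcongr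
    have hexp : ∀ u : ℝ, HasDerivAt (fun u => Real.exp (4 * v * u))
        (Real.exp (4 * v * u) * (4 * v)) u := fun u => by
      simpa using ((hasDerivAt_id u).const_mul (4 * v)).exp
    have hbd : ∀ u : ℝ, HasDerivAt
        (fun u => 2 * ‖B‖ * ‖A‖ * S + b / 2 * ‖A‖ * S * (Real.exp (4 * v * u) - 1))
        (b / 2 * ‖A‖ * S * (Real.exp (4 * v * u) * (4 * v))) u := fun u =>
      (((hexp u).sub_const 1).const_mul _).const_add _
    intro u hu
    have := norm_lie_evolve_le hH hK hHK (B := B) (by simpa using h0) hbd (T := t)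
      (fun u hu => by
        calc 2 * ‖A‖ * ‖⁅evolve H u K, B⁆‖ ≤
            2 * ‖A‖ * (b * (v * S) * Real.exp (4 * v * u)) := by gcongr; exact hKb u hu
          _ = _ := by ring) u hu
    refine this.trans ?_
    have he : 1 ≤ Real.exp (4 * v * u) := Real.one_le_exp (by have := hu.1; positivity)
    have e1 : 2 * ‖B‖ * ‖A‖ * S ≤ 2 * ‖B‖ * ‖A‖ * S * Real.exp (4 * v * u) :=
      le_mul_of_one_le_right (by positivity) he
    have e2 : 0 ≤ b / 2 * ‖A‖ * S := by positivity
    nlinarith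
  -- The trivial bound shows that some constant is admissible.
  have hne : ∃ b, P b := by
    obtain ⟨x0, hx0⟩ := hXne
    obtain ⟨m, hm, hmin⟩ := Λ.exists_min_image w ⟨x0, hX hx0⟩
    refine ⟨2 * ‖B‖ / w m, div_nonneg (by positivity) (hw m).le, fun X hX hXne A hA u hu => ?_⟩
    have h1 : w m ≤ ∑ x ∈ X, w x := by
      obtain ⟨x, hx⟩ := hXne
      exact (hmin x (hX hx)).trans (Finset.single_le_sum (f := w) (fun z _ => (hw z).le) hx)
    have he : 1 ≤ Real.exp (4 * v * u) := Real.one_le_exp (by have := hu.1; positivity)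
    have hwm := hw m
    set S := ∑ x ∈ X, w x
    have hS : 0 < S := hwm.trans_le h1
    calc ‖⁅evolve H u A, B⁆‖ ≤ 2 * ‖evolve H u A‖ * ‖B‖ := norm_lie_le _ _
      _ = 2 * ‖B‖ / w m * ‖A‖ * w m * 1 := by
          rw [norm_evolve hH]; field_simp
      _ ≤ _ := by gcongr
  -- The infimum of the admissible constants is admissible, hence at most `4 ‖B‖`.
  have hbdd : BddBelow {b | P b} := ⟨0, fun b hb => hb.1⟩
  have hinf : P (sInf {b | P b}) := by
    refine ⟨le_csInf hne fun b hb => hb.1, fun X hX hXne A hA u hu => ?_⟩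
    by_cases hA0 : ‖A‖ = 0
    · rw [norm_eq_zero] at hA0
      subst hA0
      simp [evolve, Ring.lie_def]
    have hc : 0 < ‖A‖ * (∑ x ∈ X, w x) * Real.exp (4 * v * u) := by
      have := hwpos X hXne
      have := (norm_nonneg A).lt_of_ne' hA0
      positivity
    have : ‖⁅evolve H u A, B⁆‖ / (‖A‖ * (∑ x ∈ X, w x) * Real.exp (4 * v * u)) ≤
        sInf {b | P b} :=
      le_csInf hne fun b hb => by
        rw [div_le_iff₀ hc]
        simpa [mul_assoc] using hb.2 X hX hXne A hA u hu
    rw [div_le_iff₀ hc] at this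
    simpa [mul_assoc] using this
  have hle : sInf {b | P b} ≤ 4 * ‖B‖ := by
    have := csInf_le hbdd (step _ hinf)
    linarith
  refine (hinf.2 X hX hXne A hA t ⟨ht, le_rfl⟩).trans ?_
  have := hwpos X hXne
  gcongr

lemma norm_lie_evolve_le_exp (φ : Finset Γ → Obs q Λ) (hφ : ∀ Z, IsSelfAdjoint (φ Z))
    (hsupp : ∀ Z, IsSupported Z (φ Z)) (w : Γ → ℝ) (hw : ∀ x, 0 < w x) (v : ℝ) (hv : 0 < v)
    (hvw : ∀ x ∈ Λ, ∑ Z ∈ Λ.powerset with x ∈ Z, ‖φ Z‖ * ∑ z ∈ Z, w z ≤ v * w x)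
    {Y : Finset Γ} (hY : ∀ y ∈ Y, 1 ≤ w y) {B : Obs q Λ} (hB : IsSupported Y B)
    {X : Finset Γ} (hX : X ⊆ Λ) (hXne : X.Nonempty) {A : Obs q Λ} (hA : IsSupported X A)
    (t : ℝ) :
    ‖⁅evolve (∑ Z ∈ Λ.powerset, φ Z) t A, B⁆‖ ≤
      4 * ‖B‖ * ‖A‖ * (∑ x ∈ X, w x) * Real.exp (4 * v * |t|) := by
  rcases le_total 0 t with ht | ht
  · rw [abs_of_nonneg ht]
    exact norm_lie_evolve_le_exp_of_nonneg φ hφ hsupp w hw v hv hvw hY hB hX hXne hA ht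
  · have := norm_lie_evolve_le_exp_of_nonneg (fun Z => -φ Z) (fun Z => (hφ Z).neg)
      (fun Z => by simpa using (hsupp Z).smul (-1)) w hw v hv (by simpa using hvw) hY hB hX hXne
      hA (t := -t) (by linarith)
    rw [Finset.sum_neg_distrib, evolve_neg_left, neg_neg] at this
    rwa [abs_of_nonpos ht]

end LiebRobinson

/-! ### Counting on a graph of finite dimension -/

section Geometry

variable {Γ : Type*} (gr : SimpleGraph Γ)

/-- The part of the ball of radius `r` around `x` that lies in the volume `Λ`. -/
def ball (Λ : Finset Γ) (x : Γ) (r : ℕ) : Finset Γ := Λ.filter fun y => gr.dist x y ≤ r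

variable {gr} {Λ : Finset Γ} {x y : Γ} {r : ℕ}

lemma mem_ball : y ∈ ball gr Λ x r ↔ y ∈ Λ ∧ gr.dist x y ≤ r := by simp [ball]

lemma ball_subset : ball gr Λ x r ⊆ Λ := Finset.filter_subset _ _

lemma mem_ball_self (hx : x ∈ Λ) : x ∈ ball gr Λ x r := by simp [mem_ball, hx]

lemma exists_card_ball_le {d : ℕ} (hd : HasDimension gr d) :
    ∃ κ : ℝ, 0 < κ ∧ ∀ (Λ : Finset Γ) (x : Γ) (r : ℕ),
      ((ball gr Λ x r).card : ℝ) ≤ κ * (1 + r) ^ d := by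
  obtain ⟨κ, hκ⟩ := hd
  refine ⟨κ + 1, by positivity, fun Λ x r => ?_⟩
  have h1 : ((ball gr Λ x r : Set Γ)).encard ≤ ((κ * (1 + r) ^ d : ℕ) : ℕ∞) := by
    refine le_trans (Set.encard_le_encard ?_) (hκ x (1 + r) (by omega))
    intro y hy
    have := (mem_ball.1 (Finset.mem_coe.1 hy)).2
    rw [Set.mem_ofPred_eq, SimpleGraph.dist_comm]
    omega
  rw [Set.encard_coe_eq_coe_finsetCard] at h1
  have h2 : (ball gr Λ x r).card ≤ κ * (1 + r) ^ d := by exact_mod_cast h1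
  calc ((ball gr Λ x r).card : ℝ) ≤ ((κ * (1 + r) ^ d : ℕ) : ℝ) := by exact_mod_cast h2
    _ = κ * (1 + r) ^ d := by push_cast; ring
    _ ≤ (κ + 1) * (1 + r) ^ d := by gcongr; linarith

lemma exists_sum_inv_sq_le : ∃ K : ℝ, 0 < K ∧ ∀ s : Finset ℕ,
    ∑ r ∈ s, ((1 + (r : ℝ)) ^ 2)⁻¹ ≤ K := by
  have hs : Summable fun r : ℕ => ((1 + (r : ℝ)) ^ 2)⁻¹ := by
    have := (summable_nat_add_iff 1).2 (Real.summable_nat_pow_inv.2 (one_lt_two))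
    refine this.congr fun r => ?_
    push_cast
    rw [add_comm]
  refine ⟨∑' r : ℕ, ((1 + (r : ℝ)) ^ 2)⁻¹ + 1, ?_, fun s => ?_⟩
  · have : 0 ≤ ∑' r : ℕ, ((1 + (r : ℝ)) ^ 2)⁻¹ := tsum_nonneg fun r => by positivity
    linarith
  · have := hs.sum_le_tsum s fun r _ => by positivity
    linarith

lemma exists_sum_dist_le {d : ℕ} (hd : HasDimension gr d) :
    ∃ K : ℝ, 0 < K ∧ ∀ (Λ : Finset Γ) (x : Γ),
      ∑ y ∈ Λ, ((1 + (gr.dist x y : ℝ)) ^ (d + 2))⁻¹ ≤ K := by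
  obtain ⟨κ, hκ, hball⟩ := exists_card_ball_le hd
  obtain ⟨K, hK, hsum⟩ := exists_sum_inv_sq_le
  refine ⟨κ * K, by positivity, fun Λ x => ?_⟩
  rw [← Finset.sum_fiberwise_of_maps_to (s := Λ) (t := Λ.image (gr.dist x))
    (g := gr.dist x) (fun y hy => Finset.mem_image_of_mem _ hy)]
  calc ∑ r ∈ Λ.image (gr.dist x), ∑ y ∈ Λ with gr.dist x y = r,
        ((1 + (gr.dist x y : ℝ)) ^ (d + 2))⁻¹
      ≤ ∑ r ∈ Λ.image (gr.dist x), κ * ((1 + (r : ℝ)) ^ 2)⁻¹ := by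
        refine Finset.sum_le_sum fun r _ => ?_
        calc ∑ y ∈ Λ with gr.dist x y = r, ((1 + (gr.dist x y : ℝ)) ^ (d + 2))⁻¹
            = ∑ y ∈ Λ with gr.dist x y = r, ((1 + (r : ℝ)) ^ (d + 2))⁻¹ :=
              Finset.sum_congr rfl fun y hy => by rw [(Finset.mem_filter.1 hy).2]
          _ = (Λ.filter fun y => gr.dist x y = r).card * ((1 + (r : ℝ)) ^ (d + 2))⁻¹ := by
              rw [Finset.sum_const, nsmul_eq_mul]
          _ ≤ (κ * (1 + r) ^ d) * ((1 + (r : ℝ)) ^ (d + 2))⁻¹ := by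
              gcongr
              refine le_trans ?_ (hball Λ x r)
              exact_mod_cast Finset.card_le_card
                (Finset.monotone_filter_right _ fun y _ h => le_of_eq h)
          _ = κ * ((1 + (r : ℝ)) ^ 2)⁻¹ := by
              rw [pow_add]
              field_simp
    _ = κ * ∑ r ∈ Λ.image (gr.dist x), ((1 + (r : ℝ)) ^ 2)⁻¹ := by rw [Finset.mul_sum]
    _ ≤ κ * K := by gcongr; exact hsum _

lemma exists_pow_mul_exp_neg_le (m : ℕ) {c : ℝ} (hc : 0 < c) :
    ∃ M : ℝ, 0 < M ∧ ∀ ρ : ℝ, 0 ≤ ρ → (1 + ρ) ^ m * Real.exp (-(c * ρ)) ≤ M := by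
  refine ⟨(1 + (m + 1) / c) ^ m, by positivity, fun ρ hρ => ?_⟩
  set y := c * ρ / (m + 1) with hy
  have hy0 : 0 ≤ y := by positivity
  have h1 : 1 + ρ ≤ (1 + (m + 1) / c) * Real.exp y := by
    have e1 : ρ = (m + 1) / c * y := by rw [hy]; field_simp
    have e2 : 1 + y ≤ Real.exp y := by linarith [Real.add_one_le_exp y]
    have e3 : (0 : ℝ) ≤ (m + 1) / c := by positivity
    calc 1 + ρ = 1 + (m + 1) / c * y := by rw [← e1]
      _ ≤ (1 + (m + 1) / c) * (1 + y) := by nlinarith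
      _ ≤ _ := by gcongr
  calc (1 + ρ) ^ m * Real.exp (-(c * ρ))
      ≤ ((1 + (m + 1) / c) * Real.exp y) ^ m * Real.exp (-(c * ρ)) := by gcongr
    _ = (1 + (m + 1) / c) ^ m * Real.exp (m * y - c * ρ) := by
        rw [mul_pow, ← Real.exp_nat_mul, mul_assoc, ← Real.exp_add]
        rfl
    _ ≤ (1 + (m + 1) / c) ^ m * 1 := by
        gcongr
        rw [Real.exp_le_one_iff]
        have : c * ρ = (m + 1) * y := by rw [hy]; field_simp
        rw [this]
        linarith
    _ = _ := mul_one _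

end Geometry

/-! ### Operators localized near a site -/

section Localized

variable {Γ : Type*} [DecidableEq Γ] {q : Γ → ℕ} [∀ x, NeZero (q x)] {Λ : Finset Γ}
  {gr : SimpleGraph Γ}

/-- `A` is localized near the site `x` to order `n` with constant `C`: its norm is at most `C`, and
the part of `A` outside the ball of radius `r` around `x` is at most `C (1 + r) ^ (-n)`. -/
structure IsLocalized (gr : SimpleGraph Γ) (n : ℕ) (x : Γ) (C : ℝ) (A : Obs q Λ) : Prop where
  norm_le : ‖A‖ ≤ C
  tail_le : ∀ r : ℕ, (1 + (r : ℝ)) ^ n * ‖A - condExp (ball gr Λ x r) A‖ ≤ C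

lemma norm_sub_condExp_le_two_mul {X : Finset Γ} {A A' : Obs q Λ} (h : IsSupported X A') :
    ‖A - condExp X A‖ ≤ 2 * ‖A - A'‖ := by
  have : A - condExp X A = (A - A') - condExp X (A - A') := by
    rw [map_sub, h.condExp_eq]; abel
  rw [this]
  calc _ ≤ ‖A - A'‖ + ‖condExp X (A - A')‖ := norm_sub_le _ _
    _ ≤ ‖A - A'‖ + ‖A - A'‖ := by gcongr; exact norm_condExp_le _
    _ = _ := by ring

namespace IsLocalized

variable {n : ℕ} {x : Γ} {C C' : ℝ} {A B : Obs q Λ}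

lemma nonneg (h : IsLocalized gr n x C A) : 0 ≤ C := (norm_nonneg _).trans h.norm_le

lemma mono (h : IsLocalized gr n x C A) (hC : C ≤ C') : IsLocalized gr n x C' A :=
  ⟨h.norm_le.trans hC, fun r => (h.tail_le r).trans hC⟩

lemma add (hA : IsLocalized gr n x C A) (hB : IsLocalized gr n x C' B) :
    IsLocalized gr n x (C + C') (A + B) where
  norm_le := (norm_add_le _ _).trans (add_le_add hA.norm_le hB.norm_le)
  tail_le r := by
    rw [map_add, add_sub_add_comm]
    calc _ ≤ (1 + (r : ℝ)) ^ n * (‖A - condExp (ball gr Λ x r) A‖ +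
          ‖B - condExp (ball gr Λ x r) B‖) := by gcongr; exact norm_add_le _ _
      _ ≤ C + C' := by rw [mul_add]; exact add_le_add (hA.tail_le r) (hB.tail_le r)

lemma smul (c : ℂ) (hA : IsLocalized gr n x C A) : IsLocalized gr n x (‖c‖ * C) (c • A) where
  norm_le := by rw [norm_smul]; gcongr; exact hA.norm_le
  tail_le r := by
    rw [map_smul, ← smul_sub, norm_smul, mul_left_comm]
    gcongr
    exact hA.tail_le r

lemma sum {ι : Type*} (s : Finset ι) {c : ι → ℝ} {f : ι → Obs q Λ}
    (h : ∀ i ∈ s, IsLocalized gr n x (c i) (f i)) :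
    IsLocalized gr n x (∑ i ∈ s, c i) (∑ i ∈ s, f i) where
  norm_le := norm_sum_le_of_le _ fun i hi => (h i hi).norm_le
  tail_le r := by
    rw [map_sum, ← Finset.sum_sub_distrib]
    calc _ ≤ (1 + (r : ℝ)) ^ n * ∑ i ∈ s, ‖f i - condExp (ball gr Λ x r) (f i)‖ := by
          gcongr; exact norm_sum_le _ _
      _ ≤ _ := by
          rw [Finset.mul_sum]
          exact Finset.sum_le_sum fun i hi => (h i hi).tail_le r

lemma integral {c : ℝ → ℝ} {f : ℝ → Obs q Λ} (hf : MeasureTheory.Integrable f)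
    (hc : MeasureTheory.Integrable c) (h : ∀ t, IsLocalized gr n x (c t) (f t)) :
    IsLocalized gr n x (∫ t, c t) (∫ t, f t) where
  norm_le := MeasureTheory.norm_integral_le_of_norm_le hc (Filter.Eventually.of_forall
    fun t => (h t).norm_le)
  tail_le r := by
    have h1 : ∫ t, (f t - condExp (ball gr Λ x r) (f t)) =
        (∫ t, f t) - condExp (ball gr Λ x r) (∫ t, f t) := by
      rw [MeasureTheory.integral_sub hf ((condExp _).integrable_comp hf),
        ContinuousLinearMap.integral_comp_comm _ hf]
    have h2 : ‖∫ t, (f t - condExp (ball gr Λ x r) (f t))‖ ≤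
        ∫ t, ((1 + (r : ℝ)) ^ n)⁻¹ * c t :=
      MeasureTheory.norm_integral_le_of_norm_le (hc.const_mul _)
        (Filter.Eventually.of_forall fun t => by
          rw [le_inv_mul_iff₀ (by positivity)]
          exact (h t).tail_le r)
    rw [MeasureTheory.integral_const_mul, le_inv_mul_iff₀ (by positivity), h1] at h2
    exact h2

lemma intervalIntegral {c t : ℝ} {f : ℝ → Obs q Λ} (hf : Continuous f)
    (h : ∀ u ∈ Set.uIoc 0 t, IsLocalized gr n x c (f u)) :
    IsLocalized gr n x (c * |t|) (∫ u in (0 : ℝ)..t, f u) where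
  norm_le := by
    simpa using intervalIntegral.norm_integral_le_of_norm_le_const
      (a := (0 : ℝ)) (b := t) fun u hu => (h u hu).norm_le
  tail_le r := by
    have h1 : (∫ u in (0 : ℝ)..t, f u) - condExp (ball gr Λ x r) (∫ u in (0 : ℝ)..t, f u) =
        ∫ u in (0 : ℝ)..t, (f u - condExp (ball gr Λ x r) (f u)) := by
      have hE : Continuous fun u => condExp (ball gr Λ x r) (f u) :=
        (condExp (ball gr Λ x r)).continuous.comp hf
      rw [intervalIntegral.integral_sub (hf.intervalIntegrable _ _) (hE.intervalIntegrable _ _),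
        ContinuousLinearMap.intervalIntegral_comp_comm _ (hf.intervalIntegrable _ _)]
    rw [h1]
    have h2 := intervalIntegral.norm_integral_le_of_norm_le_const
      (a := (0 : ℝ)) (b := t) (f := fun u => f u - condExp (ball gr Λ x r) (f u))
      (C := ((1 + (r : ℝ)) ^ n)⁻¹ * c) fun u hu => by
        rw [le_inv_mul_iff₀ (by positivity)]
        exact (h u hu).tail_le r
    rw [sub_zero, mul_assoc, le_inv_mul_iff₀ (by positivity)] at h2
    exact h2

/-- A bound on the commutator of operators localized near two sites. -/
lemma norm_lie_le {N : ℕ} (hconn : gr.Connected) {y : Γ} {a b : ℝ} {A B : Obs q Λ}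
    (hA : IsLocalized gr N y a A) (hB : IsLocalized gr N x b B) :
    (1 + (gr.dist x y : ℝ)) ^ N * ‖⁅A, B⁆‖ ≤ 4 * 3 ^ N * (a * b) := by
  have ha := hA.nonneg
  have hb := hB.nonneg
  set R := gr.dist x y with hR
  have h3 : (1 : ℝ) ≤ 3 ^ N := one_le_pow₀ (by norm_num)
  rcases Nat.eq_zero_or_pos R with h0 | hpos
  · rw [h0]
    calc (1 + ((0 : ℕ) : ℝ)) ^ N * ‖⁅A, B⁆‖ = ‖⁅A, B⁆‖ := by simp
      _ ≤ 2 * ‖A‖ * ‖B‖ := SpinSystem.norm_lie_le A B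
      _ ≤ 2 * a * b := by gcongr; exacts [hA.norm_le, hB.norm_le]
      _ ≤ 4 * 3 ^ N * (a * b) := by nlinarith [mul_nonneg ha hb]
  set r := (R - 1) / 2 with hr
  have hdisj : Disjoint (ball gr Λ y r) (ball gr Λ x r) := by
    rw [Finset.disjoint_left]
    intro z hz1 hz2
    have e1 := (mem_ball.1 hz1).2
    have e2 := (mem_ball.1 hz2).2
    have e3 := hconn.dist_triangle (u := x) (v := z) (w := y)
    rw [SimpleGraph.dist_comm (u := z)] at e3
    omega
  have hz := (isSupported_condExp (X := ball gr Λ y r) A).lie_eq_zero_of_disjoint hdisj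
    (isSupported_condExp (X := ball gr Λ x r) B)
  have hsplit : ⁅A, B⁆ = ⁅A - condExp (ball gr Λ y r) A, B⁆ +
      ⁅condExp (ball gr Λ y r) A, B - condExp (ball gr Λ x r) B⁆ := by
    rw [lie_eq_add_add A (condExp (ball gr Λ y r) A) B (condExp (ball gr Λ x r) B), hz, add_zero]
  have hle : (1 + (R : ℝ)) ^ N ≤ 3 ^ N * (1 + (r : ℝ)) ^ N := by
    rw [← mul_pow]
    gcongr
    have : 1 + R ≤ 3 * (1 + r) := by omega
    exact_mod_cast this
  have hAt := hA.tail_le r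
  have hBt := hB.tail_le r
  calc (1 + (R : ℝ)) ^ N * ‖⁅A, B⁆‖
      ≤ 3 ^ N * (1 + (r : ℝ)) ^ N * (2 * ‖A - condExp (ball gr Λ y r) A‖ * b +
        2 * a * ‖B - condExp (ball gr Λ x r) B‖) := by
        gcongr
        rw [hsplit]
        refine (norm_add_le _ _).trans (add_le_add ?_ ?_)
        · refine (SpinSystem.norm_lie_le _ _).trans ?_
          gcongr
          exact hB.norm_le
        · refine (SpinSystem.norm_lie_le _ _).trans ?_
          gcongr
          exact (norm_condExp_le _).trans hA.norm_le
    _ = 3 ^ N * (2 * ((1 + (r : ℝ)) ^ N * ‖A - condExp (ball gr Λ y r) A‖) * b +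
        2 * a * ((1 + (r : ℝ)) ^ N * ‖B - condExp (ball gr Λ x r) B‖)) := by ring
    _ ≤ 3 ^ N * (2 * a * b + 2 * a * b) := by gcongr
    _ = _ := by ring

/-- The commutator of an operator localized near `y` and an operator localized near `x` is
localized near `x`, with a constant that decays with the distance of `x` and `y`. -/
lemma lie (n d : ℕ) (hconn : gr.Connected) {y : Γ} {a b : ℝ} {A B : Obs q Λ}
    (hA : IsLocalized gr (n + (d + 2)) y a A) (hB : IsLocalized gr (n + (d + 2)) x b B) :
    IsLocalized gr n x (8 * 6 ^ (n + (d + 2)) * (a * b) *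
      ((1 + (gr.dist x y : ℝ)) ^ (d + 2))⁻¹) ⁅A, B⁆ := by
  have ha := hA.nonneg
  have hb := hB.nonneg
  have hcomm := hA.norm_lie_le hconn hB
  set R := gr.dist x y with hR
  have h36 : (3 : ℝ) ^ (n + (d + 2)) ≤ 6 ^ (n + (d + 2)) := by gcongr; norm_num
  have h26 : (2 : ℝ) ^ (n + (d + 2)) ≤ 6 ^ (n + (d + 2)) := by gcongr; norm_num
  have hab := mul_nonneg ha hb
  refine ⟨?_, fun ρ => ?_⟩
  · rw [← div_eq_mul_inv, le_div_iff₀ (by positivity), mul_comm]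
    calc (1 + (R : ℝ)) ^ (d + 2) * ‖⁅A, B⁆‖
        ≤ (1 + (R : ℝ)) ^ (n + (d + 2)) * ‖⁅A, B⁆‖ := by
          refine mul_le_mul_of_nonneg_right (pow_le_pow_right₀ ?_ (by omega)) (norm_nonneg _)
          linarith [Nat.cast_nonneg (α := ℝ) R]
      _ ≤ 4 * 3 ^ (n + (d + 2)) * (a * b) := hcomm
      _ ≤ 8 * 6 ^ (n + (d + 2)) * (a * b) := by gcongr; norm_num
  -- It suffices to find an approximation supported in the ball of radius `ρ`.
  suffices hA' : ∃ D : Obs q Λ, IsSupported (ball gr Λ x ρ) D ∧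
      (1 + (ρ : ℝ)) ^ n * (1 + (R : ℝ)) ^ (d + 2) * ‖⁅A, B⁆ - D‖ ≤
        4 * 6 ^ (n + (d + 2)) * (a * b) by
    obtain ⟨D, hD, hle⟩ := hA'
    rw [← div_eq_mul_inv, le_div_iff₀ (by positivity)]
    calc (1 + (ρ : ℝ)) ^ n * ‖⁅A, B⁆ - condExp (ball gr Λ x ρ) ⁅A, B⁆‖ * (1 + (R : ℝ)) ^ (d + 2)
        ≤ (1 + (ρ : ℝ)) ^ n * (2 * ‖⁅A, B⁆ - D‖) * (1 + (R : ℝ)) ^ (d + 2) := by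
          gcongr; exact norm_sub_condExp_le_two_mul hD
      _ = 2 * ((1 + (ρ : ℝ)) ^ n * (1 + (R : ℝ)) ^ (d + 2) * ‖⁅A, B⁆ - D‖) := by ring
      _ ≤ 2 * (4 * 6 ^ (n + (d + 2)) * (a * b)) := by gcongr
      _ = _ := by ring
  set r := ρ / 2 with hr
  by_cases hcase : R ≤ r
  · set A₀ := condExp (ball gr Λ y r) A with hA₀
    set B₀ := condExp (ball gr Λ x r) B with hB₀
    refine ⟨⁅A₀, B₀⁆, ?_, ?_⟩
    · refine IsSupported.lie ((isSupported_condExp A).mono ?_) ((isSupported_condExp B).mono ?_)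
      · intro z hz
        rw [mem_ball] at hz ⊢
        have := hconn.dist_triangle (u := x) (v := y) (w := z)
        exact ⟨hz.1, by omega⟩
      · intro z hz
        rw [mem_ball] at hz ⊢
        exact ⟨hz.1, by omega⟩
    · have hle : (1 + (ρ : ℝ)) ^ n * (1 + (R : ℝ)) ^ (d + 2) ≤
          2 ^ (n + (d + 2)) * (1 + (r : ℝ)) ^ (n + (d + 2)) := by
        have e1 : (1 : ℝ) + ρ ≤ 2 * (1 + r) := by
          have : 1 + ρ ≤ 2 * (1 + r) := by omega
          exact_mod_cast this
        have e2 : (1 : ℝ) + R ≤ 2 * (1 + r) := by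
          have : 1 + R ≤ 2 * (1 + r) := by omega
          exact_mod_cast this
        rw [← mul_pow, pow_add _ n (d + 2)]
        gcongr
      have hsplit : ⁅A, B⁆ - ⁅A₀, B₀⁆ = ⁅A - A₀, B⁆ + ⁅A₀, B - B₀⁆ := by
        rw [lie_eq_add_add A A₀ B B₀, add_sub_cancel_right]
      have hAt := hA.tail_le r
      have hBt := hB.tail_le r
      calc (1 + (ρ : ℝ)) ^ n * (1 + (R : ℝ)) ^ (d + 2) * ‖⁅A, B⁆ - ⁅A₀, B₀⁆‖
          ≤ 2 ^ (n + (d + 2)) * (1 + (r : ℝ)) ^ (n + (d + 2)) *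
            (2 * ‖A - A₀‖ * b + 2 * a * ‖B - B₀‖) := by
            gcongr
            rw [hsplit]
            refine (norm_add_le _ _).trans (add_le_add ?_ ?_)
            · refine (SpinSystem.norm_lie_le _ _).trans ?_
              gcongr
              exact hB.norm_le
            · refine (SpinSystem.norm_lie_le _ _).trans ?_
              gcongr
              exact (norm_condExp_le _).trans hA.norm_le
        _ = 2 ^ (n + (d + 2)) * (2 * ((1 + (r : ℝ)) ^ (n + (d + 2)) * ‖A - A₀‖) * b +
            2 * a * ((1 + (r : ℝ)) ^ (n + (d + 2)) * ‖B - B₀‖)) := by ring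
        _ ≤ 2 ^ (n + (d + 2)) * (2 * a * b + 2 * a * b) := by gcongr
        _ = 4 * 2 ^ (n + (d + 2)) * (a * b) := by ring
        _ ≤ _ := by gcongr
  · refine ⟨0, ⟨fun _ _ _ => rfl, fun _ _ _ => rfl⟩, ?_⟩
    have hle : (1 + (ρ : ℝ)) ^ n * (1 + (R : ℝ)) ^ (d + 2) ≤
        2 ^ (n + (d + 2)) * (1 + (R : ℝ)) ^ (n + (d + 2)) := by
      have e1 : (1 : ℝ) + ρ ≤ 2 * (1 + R) := by
        have : 1 + ρ ≤ 2 * (1 + R) := by omega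
        exact_mod_cast this
      have e2 : (1 : ℝ) + R ≤ 2 * (1 + R) := by linarith [Nat.cast_nonneg (α := ℝ) R]
      rw [← mul_pow, pow_add _ n (d + 2)]
      gcongr
    rw [sub_zero]
    calc (1 + (ρ : ℝ)) ^ n * (1 + (R : ℝ)) ^ (d + 2) * ‖⁅A, B⁆‖
        ≤ 2 ^ (n + (d + 2)) * (1 + (R : ℝ)) ^ (n + (d + 2)) * ‖⁅A, B⁆‖ := by gcongr
      _ = 2 ^ (n + (d + 2)) * ((1 + (R : ℝ)) ^ (n + (d + 2)) * ‖⁅A, B⁆‖) := by ring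
      _ ≤ 2 ^ (n + (d + 2)) * (4 * 3 ^ (n + (d + 2)) * (a * b)) := by gcongr
      _ = 4 * (2 ^ (n + (d + 2)) * 3 ^ (n + (d + 2))) * (a * b) := by ring
      _ = _ := by rw [← mul_pow]; norm_num

end IsLocalized

/-- The commutator with a sum of operators localized near the sites of `Λ` preserves
localization. -/
lemma exists_isLocalized_sum_lie {d : ℕ} (hconn : gr.Connected) (hd : HasDimension gr d) (n : ℕ) :
    ∃ K : ℝ, 0 < K ∧ ∀ (Λ : Finset Γ) (x : Γ) (a b : ℝ) (A : Γ → Obs q Λ) (B : Obs q Λ),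
      0 ≤ a → (∀ y ∈ Λ, IsLocalized gr (n + (d + 2)) y a (A y)) →
      IsLocalized gr (n + (d + 2)) x b B →
      IsLocalized gr n x (K * a * b) (∑ y ∈ Λ, ⁅A y, B⁆) := by
  obtain ⟨K, hK, hsum⟩ := exists_sum_dist_le hd
  refine ⟨8 * 6 ^ (n + (d + 2)) * K, by positivity, fun Λ x a b A B ha hA hB => ?_⟩
  have hb := hB.nonneg
  refine (IsLocalized.sum Λ fun y hy => (hA y hy).lie n d hconn hB).mono ?_
  rw [← Finset.mul_sum]
  calc _ ≤ 8 * 6 ^ (n + (d + 2)) * (a * b) * K := by gcongr; exact hsum Λ x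
    _ = _ := by ring

lemma norm_le_one_of_mem_unitary {U : Obs q Λ} (hU : U ∈ unitary (Obs q Λ)) : ‖U‖ ≤ 1 :=
  (CStarRing.norm_of_mem_unitary hU).le

/-- The dynamics preserves localization near a site, with a constant that grows polynomially in
time. Inside the light cone `4 v |t| ≤ ν r / 4` this is the Lieb–Robinson bound; outside of it
`r` is bounded by a multiple of `|t|`. -/
lemma exists_isLocalized_evolve {d : ℕ} (hconn : gr.Connected) (hd : HasDimension gr d) (n : ℕ)
    {ν v : ℝ} (hν : 0 < ν) (hv : 0 < v) :
    ∃ K : ℝ, 0 < K ∧ ∀ (Λ : Finset Γ) (φ : Finset Γ → Obs q Λ), (∀ Z, IsSelfAdjoint (φ Z)) →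
      (∀ Z, IsSupported Z (φ Z)) →
      (∀ x ∈ Λ, ∑ Z ∈ Λ.powerset with x ∈ Z,
        ‖φ Z‖ * ∑ z ∈ Z, Real.exp (ν * gr.dist x z) ≤ v) →
      ∀ x ∈ Λ, ∀ (t b : ℝ) (A : Obs q Λ), IsLocalized gr n x b A →
        IsLocalized gr n x (K * b * (1 + |t|) ^ n) (evolve (∑ Z ∈ Λ.powerset, φ Z) t A) := by
  obtain ⟨κ, hκ, hball⟩ := exists_card_ball_le hd
  obtain ⟨M, hM, hMexp⟩ := exists_pow_mul_exp_neg_le (n + d) (c := ν / 4) (by positivity)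
  refine ⟨2 * 2 ^ n + 4 * κ * M + 2 * (1 + 16 * v / ν) ^ n + 1, by positivity,
    fun Λ φ hφ hsupp hφv x hx t b A hA => ?_⟩
  set H := ∑ Z ∈ Λ.powerset, φ Z with hHdef
  have hH : IsSelfAdjoint H := isSelfAdjoint_sum _ fun Z _ => hφ Z
  have hb := hA.nonneg
  have ht1 : 1 ≤ (1 + |t|) ^ n := one_le_pow₀ (by linarith [abs_nonneg t])
  have hp1 : 0 ≤ 4 * κ * M := by positivity
  have hp2 : 0 ≤ 2 * (1 + 16 * v / ν) ^ n := by positivity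
  have hp3 : (0 : ℝ) ≤ 2 * 2 ^ n := by positivity
  refine ⟨?_, fun ρ => ?_⟩
  · rw [norm_evolve hH]
    calc ‖A‖ ≤ b := hA.norm_le
      _ = 1 * b * 1 := by ring
      _ ≤ _ := by gcongr; linarith
  set τA := evolve H t A with hτA
  have htriv : ‖τA - condExp (ball gr Λ x ρ) τA‖ ≤ 2 * b := by
    calc _ ≤ ‖τA‖ + ‖condExp (ball gr Λ x ρ) τA‖ := norm_sub_le _ _
      _ ≤ ‖τA‖ + ‖τA‖ := by gcongr; exact norm_condExp_le _
      _ = 2 * ‖A‖ := by rw [hτA, norm_evolve hH]; ring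
      _ ≤ 2 * b := by gcongr; exact hA.norm_le
  by_cases hcone : 4 * v * |t| ≤ ν * ρ / 4
  swap
  · have hρ : 1 + (ρ : ℝ) ≤ (1 + 16 * v / ν) * (1 + |t|) := by
      have e1 : (ρ : ℝ) ≤ 16 * v / ν * |t| := by
        rw [div_mul_eq_mul_div, le_div_iff₀ hν]
        linarith
      have e2 : 0 ≤ 16 * v / ν := by positivity
      nlinarith [abs_nonneg t]
    calc (1 + (ρ : ℝ)) ^ n * ‖τA - condExp (ball gr Λ x ρ) τA‖
        ≤ ((1 + 16 * v / ν) * (1 + |t|)) ^ n * (2 * b) := by gcongr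
      _ = (2 * (1 + 16 * v / ν) ^ n) * b * (1 + |t|) ^ n := by rw [mul_pow]; ring
      _ ≤ _ := by gcongr; linarith
  set r := ρ / 2 with hr
  have hrρ : (r : ℝ) ≤ ρ / 2 := by
    rw [le_div_iff₀ two_pos]
    have : r * 2 ≤ ρ := by omega
    exact_mod_cast this
  set A₀ := condExp (ball gr Λ x r) A with hA₀
  have hA₀n : ‖A₀‖ ≤ b := (norm_condExp_le A).trans hA.norm_le
  -- The weight that decays away from the complement of the ball of radius `ρ`.
  set w : Γ → ℝ := fun z => Real.exp (ν * (gr.dist x z - ρ)) with hw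
  have hLR : ‖evolve H t A₀ - condExp (ball gr Λ x ρ) (evolve H t A₀)‖ ≤
      4 * κ * b * (1 + (ρ : ℝ)) ^ d * Real.exp (-(ν / 4 * ρ)) := by
    refine norm_sub_condExp_le (Y := Λ \ ball gr Λ x ρ) (fun z hz => ?_) fun B hBu hB => ?_
    · simp only [Finset.mem_union, Finset.mem_sdiff]
      tauto
    have hvw : ∀ y ∈ Λ, ∑ Z ∈ Λ.powerset with y ∈ Z, ‖φ Z‖ * ∑ z ∈ Z, w z ≤ v * w y := by
      intro y hy
      have hwz : ∀ z, w z ≤ Real.exp (ν * gr.dist y z) * w y := by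
        intro z
        rw [hw, ← Real.exp_add, Real.exp_le_exp, ← mul_add]
        have : (gr.dist x z : ℝ) ≤ gr.dist x y + gr.dist y z := by
          exact_mod_cast hconn.dist_triangle
        gcongr
        linarith
      calc ∑ Z ∈ Λ.powerset with y ∈ Z, ‖φ Z‖ * ∑ z ∈ Z, w z
          ≤ ∑ Z ∈ Λ.powerset with y ∈ Z, ‖φ Z‖ * ∑ z ∈ Z, Real.exp (ν * gr.dist y z) * w y := by
            gcongr with Z hZ z hz
            exact hwz z
        _ = (∑ Z ∈ Λ.powerset with y ∈ Z, ‖φ Z‖ * ∑ z ∈ Z, Real.exp (ν * gr.dist y z)) * w y := by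
            rw [Finset.sum_mul]
            exact Finset.sum_congr rfl fun Z _ => by rw [← Finset.sum_mul, mul_assoc]
        _ ≤ v * w y := by
            gcongr
            exact hφv y hy
    have h1 := norm_lie_evolve_le_exp φ hφ hsupp w (fun z => Real.exp_pos _) v hv hvw
      (Y := Λ \ ball gr Λ x ρ) (fun y hy => by
        have : ¬ gr.dist x y ≤ ρ := fun hle =>
          (Finset.mem_sdiff.1 hy).2 (mem_ball.2 ⟨(Finset.mem_sdiff.1 hy).1, hle⟩)
        refine Real.one_le_exp (mul_nonneg hν.le (sub_nonneg.2 ?_))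
        exact_mod_cast (not_le.1 this).le) hB (ball_subset (x := x) (r := r) (gr := gr))
      ⟨x, mem_ball_self hx⟩ (isSupported_condExp A) t
    have hsum : ∑ z ∈ ball gr Λ x r, w z ≤ κ * (1 + (ρ : ℝ)) ^ d * Real.exp (-(ν * ρ / 2)) := by
      calc ∑ z ∈ ball gr Λ x r, w z ≤ ∑ _z ∈ ball gr Λ x r, Real.exp (-(ν * ρ / 2)) := by
            refine Finset.sum_le_sum fun z hz => ?_
            rw [hw, Real.exp_le_exp]
            have : (gr.dist x z : ℝ) ≤ r := by exact_mod_cast (mem_ball.1 hz).2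
            nlinarith
        _ = (ball gr Λ x r).card * Real.exp (-(ν * ρ / 2)) := by
            rw [Finset.sum_const, nsmul_eq_mul]
        _ ≤ κ * (1 + (r : ℝ)) ^ d * Real.exp (-(ν * ρ / 2)) := by
            gcongr; exact hball Λ x r
        _ ≤ _ := by
            gcongr
            omega
    have hBn := norm_le_one_of_mem_unitary hBu
    have hw0 : 0 ≤ ∑ z ∈ ball gr Λ x r, w z := Finset.sum_nonneg fun z _ => (Real.exp_pos _).le
    calc ‖⁅evolve H t A₀, B⁆‖
        ≤ 4 * ‖B‖ * ‖A₀‖ * (∑ z ∈ ball gr Λ x r, w z) * Real.exp (4 * v * |t|) := h1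
      _ ≤ 4 * 1 * b * (κ * (1 + (ρ : ℝ)) ^ d * Real.exp (-(ν * ρ / 2))) *
          Real.exp (ν * ρ / 4) := by gcongr
      _ = 4 * κ * b * (1 + (ρ : ℝ)) ^ d * (Real.exp (-(ν * ρ / 2)) * Real.exp (ν * ρ / 4)) := by
          ring
      _ = _ := by
          rw [← Real.exp_add]
          congr 2
          ring
  have hsplit : τA - condExp (ball gr Λ x ρ) τA =
      (evolve H t (A - A₀) - condExp (ball gr Λ x ρ) (evolve H t (A - A₀))) +
      (evolve H t A₀ - condExp (ball gr Λ x ρ) (evolve H t A₀)) := by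
    rw [hτA, evolve_sub_right, map_sub]; abel
  have h2 : ‖evolve H t (A - A₀) - condExp (ball gr Λ x ρ) (evolve H t (A - A₀))‖ ≤
      2 * ‖A - A₀‖ := by
    calc _ ≤ ‖evolve H t (A - A₀)‖ + ‖condExp (ball gr Λ x ρ) (evolve H t (A - A₀))‖ :=
          norm_sub_le _ _
      _ ≤ ‖evolve H t (A - A₀)‖ + ‖evolve H t (A - A₀)‖ := by
          gcongr; exact norm_condExp_le _
      _ = _ := by rw [norm_evolve hH]; ring
  have hAt := hA.tail_le r
  have hrle : (1 + (ρ : ℝ)) ^ n ≤ 2 ^ n * (1 + (r : ℝ)) ^ n := by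
    rw [← mul_pow]
    gcongr
    have : 1 + ρ ≤ 2 * (1 + r) := by omega
    exact_mod_cast this
  calc (1 + (ρ : ℝ)) ^ n * ‖τA - condExp (ball gr Λ x ρ) τA‖
      ≤ (1 + (ρ : ℝ)) ^ n * (2 * ‖A - A₀‖ +
        4 * κ * b * (1 + (ρ : ℝ)) ^ d * Real.exp (-(ν / 4 * ρ))) := by
        gcongr
        rw [hsplit]
        exact (norm_add_le _ _).trans (add_le_add h2 hLR)
    _ = 2 * ((1 + (ρ : ℝ)) ^ n * ‖A - A₀‖) +
        4 * κ * b * ((1 + (ρ : ℝ)) ^ (n + d) * Real.exp (-(ν / 4 * ρ))) := by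
        rw [pow_add]; ring
    _ ≤ 2 * (2 ^ n * (1 + (r : ℝ)) ^ n * ‖A - A₀‖) + 4 * κ * b * M := by
        gcongr
        exact hMexp ρ (Nat.cast_nonneg _)
    _ = 2 * 2 ^ n * ((1 + (r : ℝ)) ^ n * ‖A - A₀‖) + 4 * κ * b * M := by ring
    _ ≤ 2 * 2 ^ n * b + 4 * κ * b * M := by gcongr
    _ = (2 * 2 ^ n + 4 * κ * M) * b * 1 := by ring
    _ ≤ _ := mul_le_mul (mul_le_mul_of_nonneg_right (by linarith) hb) ht1 zero_le_one
        (mul_nonneg (by positivity) hb)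

end Localized

/-! ### Decay functions -/

section Decay

/-- Every sequence of polynomial bounds is dominated by one function of the class `𝓢`. The function
is `ζ(r) = inf_n (1 + r / ρ_n) ^ (-n)`: each member of the family is supermultiplicative, the
infimum inherits this, and it is positive since `ρ_n ≥ n + 1`. If `n r ≤ ρ_n` then the `n`-th member
is at least `1 / e`; otherwise `r` is so large, by the choice of `ρ_n`, that the bound of order
`n + 1` suffices. -/
lemma exists_isFastDecay_le (C : ℕ → ℝ) : ∃ ζ : ℝ → ℝ, IsFastDecay ζ ∧ ∃ K : ℝ, 0 < K ∧
    ∀ a r : ℝ, 0 ≤ r → 0 ≤ a → (∀ p : ℕ, (1 + r) ^ p * a ≤ C p) → a ≤ K * ζ r := by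
  set ρ : ℕ → ℝ := fun n => (n + 1) * (1 + |C (n + 1)|) with hρ
  have hρ1 : ∀ n : ℕ, (n : ℝ) + 1 ≤ ρ n := fun n => by
    have := abs_nonneg (C (n + 1))
    simp only [hρ]
    nlinarith [Nat.cast_nonneg (α := ℝ) n]
  have hρpos : ∀ n, 0 < ρ n := fun n => by
    have := hρ1 n
    have := Nat.cast_nonneg (α := ℝ) n
    linarith
  set ζ : ℝ → ℝ := fun r => ⨅ n : ℕ, ((1 + r / ρ n) ^ n)⁻¹ with hζ
  have hterm : ∀ r : ℝ, 0 ≤ r → ∀ n, 0 < 1 + r / ρ n := fun r hr n => by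
    have := div_nonneg hr (hρpos n).le
    linarith
  have hbdd : ∀ r : ℝ, 0 ≤ r → BddBelow (Set.range fun n : ℕ => ((1 + r / ρ n) ^ n)⁻¹) :=
    fun r hr => ⟨0, by
      rintro _ ⟨n, rfl⟩
      have := hterm r hr n
      positivity⟩
  have hle : ∀ r : ℝ, 0 ≤ r → ∀ n, ζ r ≤ ((1 + r / ρ n) ^ n)⁻¹ := fun r hr n =>
    ciInf_le (hbdd r hr) n
  have hexp : ∀ (r : ℝ), 0 ≤ r → ∀ n : ℕ, (1 + r / ρ n) ^ n ≤ Real.exp (n * r / ρ n) := by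
    intro r hr n
    have h1 : 1 + r / ρ n ≤ Real.exp (r / ρ n) := by
      linarith [Real.add_one_le_exp (r / ρ n)]
    calc (1 + r / ρ n) ^ n ≤ Real.exp (r / ρ n) ^ n :=
          pow_le_pow_left₀ (hterm r hr n).le h1 n
      _ = _ := by rw [← Real.exp_nat_mul, mul_div_assoc]
  have hpos : ∀ r : ℝ, 0 ≤ r → 0 < ζ r := by
    intro r hr
    refine (Real.exp_pos (-r)).trans_le (le_ciInf fun n => ?_)
    rw [Real.exp_neg]
    refine inv_anti₀ (pow_pos (hterm r hr n) n) ((hexp r hr n).trans ?_)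
    rw [Real.exp_le_exp, div_le_iff₀ (hρpos n), mul_comm]
    have := hρ1 n
    gcongr
    linarith
  refine ⟨ζ, ⟨hpos, ⟨1, fun r hr => by simpa using hle r hr 0⟩, ?_, ?_, ?_⟩, ?_⟩
  · intro r hr s hs hrs
    rw [Set.mem_Ici] at hr hs
    refine ciInf_mono (hbdd s hs) fun n => ?_
    have := hterm r hr n
    have := hρpos n
    gcongr
  · intro r s hr hs
    refine le_ciInf fun n => ?_
    have h1 := hterm r hr n
    have h2 := hterm s hs n
    have h3 := hterm (r + s) (add_nonneg hr hs) n
    calc ζ r * ζ s ≤ ((1 + r / ρ n) ^ n)⁻¹ * ((1 + s / ρ n) ^ n)⁻¹ :=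
          mul_le_mul (hle r hr n) (hle s hs n) (hpos s hs).le (by positivity)
      _ = (((1 + r / ρ n) * (1 + s / ρ n)) ^ n)⁻¹ := by rw [mul_pow, mul_inv]
      _ ≤ ((1 + (r + s) / ρ n) ^ n)⁻¹ := by
          have : 0 ≤ r / ρ n * (s / ρ n) :=
            mul_nonneg (div_nonneg hr (hρpos n).le) (div_nonneg hs (hρpos n).le)
          gcongr
          rw [add_div]
          nlinarith
  · intro n
    refine ⟨ρ n ^ n, fun r hr => ?_⟩
    have h1 := hterm r hr n
    calc r ^ n * ζ r ≤ r ^ n * ((1 + r / ρ n) ^ n)⁻¹ := by gcongr; exact hle r hr n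
      _ = (r / (1 + r / ρ n)) ^ n := by rw [div_pow, div_eq_mul_inv (r ^ n)]
      _ ≤ ρ n ^ n := by
          have hp := hρpos n
          gcongr
          rw [div_le_iff₀ h1, mul_add, mul_div_cancel₀ _ hp.ne']
          linarith
  · refine ⟨Real.exp 1 * |C 0| + 1, by positivity, fun a r hr ha hC => ?_⟩
    have hK : 0 < Real.exp 1 * |C 0| + 1 := by positivity
    rw [← div_le_iff₀' hK]
    refine le_ciInf fun n => ?_
    have h1 := hterm r hr n
    rw [div_le_iff₀' hK, ← div_eq_mul_inv, le_div_iff₀ (pow_pos h1 n)]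
    have hp := hρpos n
    by_cases hc : n * r ≤ ρ n
    · have ha0 : a ≤ |C 0| := by simpa using (hC 0).trans (le_abs_self _)
      calc a * (1 + r / ρ n) ^ n ≤ |C 0| * Real.exp 1 := by
            gcongr
            refine (hexp r hr n).trans ?_
            rw [Real.exp_le_exp]
            exact (div_le_one hp).2 hc
        _ ≤ _ := by linarith [mul_comm |C 0| (Real.exp 1)]
    · have hn : (0 : ℝ) < n := by
        rcases Nat.eq_zero_or_pos n with h | h
        · subst h
          simp only [Nat.cast_zero, zero_mul, not_le] at hc
          linarith
        · exact_mod_cast h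
      have hr1 : |C (n + 1)| ≤ 1 + r := by
        have h2 : n * |C (n + 1)| ≤ n * r := by
          have := abs_nonneg (C (n + 1))
          have h3 : ρ n = (n + 1) * (1 + |C (n + 1)|) := rfl
          nlinarith
        have := le_of_mul_le_mul_left h2 hn
        linarith
      have h4 : (1 + r) ^ n * a ≤ 1 := by
        have h5 := (hC (n + 1)).trans ((le_abs_self _).trans hr1)
        rw [pow_succ] at h5
        have h6 : (1 + r) * ((1 + r) ^ n * a) ≤ (1 + r) * 1 := by linarith
        exact le_of_mul_le_mul_left h6 (by linarith)
      calc a * (1 + r / ρ n) ^ n ≤ a * (1 + r) ^ n := by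
            gcongr
            refine div_le_self hr ?_
            have := hρ1 n
            linarith
        _ ≤ 1 := by linarith
        _ ≤ _ := by
            have : 0 ≤ Real.exp 1 * |C 0| := by positivity
            linarith

lemma exists_isFastDecay_le_decayF (d : ℕ) (C : ℕ → ℝ) : ∃ ζ : ℝ → ℝ, IsFastDecay ζ ∧
    ∃ K : ℝ, 0 < K ∧ ∀ a r : ℝ, 0 ≤ r → 0 ≤ a → (∀ p : ℕ, (1 + r) ^ p * a ≤ C p) →
      a ≤ K * decayF d ζ r := by
  obtain ⟨ζ, hζ, K, hK, h⟩ := exists_isFastDecay_le fun p => C (p + (d + 1))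
  refine ⟨ζ, hζ, K, hK, fun a r hr ha hC => ?_⟩
  have := h ((1 + r) ^ (d + 1) * a) r hr (by positivity) fun p => by
    rw [← mul_assoc, ← pow_add]
    exact hC _
  rw [decayF, ← mul_assoc, ← div_eq_mul_inv, le_div_iff₀ (by positivity), mul_comm]
  exact this

lemma IsFastDecay.exists_one_add_pow_mul_le {ζ : ℝ → ℝ} (hζ : IsFastDecay ζ) (n : ℕ) :
    ∃ C : ℝ, 0 < C ∧ ∀ r, 0 ≤ r → (1 + r) ^ n * ζ r ≤ C := by
  obtain ⟨M, hM⟩ := hζ.bounded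
  obtain ⟨C, hC⟩ := hζ.decay n
  have hM0 : 0 < M := (hζ.pos 0 le_rfl).trans_le (hM 0 le_rfl)
  have hC0 : 0 ≤ C := le_trans (mul_nonneg (by positivity) (hζ.pos 0 le_rfl).le) (hC 0 le_rfl)
  refine ⟨2 ^ n * (M + C), by positivity, fun r hr => ?_⟩
  have hz := hζ.pos r hr
  have h1 : (1 + r) ^ n ≤ 2 ^ n * (1 + r ^ n) := by
    rcases le_total r 1 with h | h
    · calc (1 + r) ^ n ≤ 2 ^ n := pow_le_pow_left₀ (by linarith) (by linarith) n
        _ ≤ 2 ^ n * (1 + r ^ n) := by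
          refine le_mul_of_one_le_right (by positivity) ?_
          linarith [pow_nonneg hr n]
    · calc (1 + r) ^ n ≤ (2 * r) ^ n := pow_le_pow_left₀ (by linarith) (by linarith) n
        _ = 2 ^ n * r ^ n := mul_pow _ _ _
        _ ≤ _ := by gcongr; linarith
  calc (1 + r) ^ n * ζ r ≤ 2 ^ n * (1 + r ^ n) * ζ r := by gcongr
    _ = 2 ^ n * (ζ r + r ^ n * ζ r) := by ring
    _ ≤ _ := by gcongr; exacts [hM r hr, hC r hr]

lemma isFastDecay_exp {μ : ℝ} (hμ : 0 < μ) : IsFastDecay fun r => Real.exp (-(μ * r)) where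
  pos r _ := Real.exp_pos _
  bounded := ⟨1, fun r hr => Real.exp_le_one_iff.2 (by have := mul_nonneg hμ.le hr; linarith)⟩
  antitone r _ s _ h := Real.exp_le_exp.2 (by have := mul_le_mul_of_nonneg_left h hμ.le; linarith)
  superadditive r s _ _ := by rw [← Real.exp_add]; exact le_of_eq (by ring_nf)
  decay n := by
    obtain ⟨M, -, hM⟩ := exists_pow_mul_exp_neg_le n hμ
    refine ⟨M, fun r hr => le_trans ?_ (hM r hr)⟩
    gcongr
    linarith

end Decay

/-! ### From interactions to sums of localized operators -/

section Anchored

variable {Γ : Type*} [DecidableEq Γ] {q : Γ → ℕ} {gr : SimpleGraph Γ} {d : ℕ}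

lemma classLE_subset_classLS : classLE (q := q) gr d ⊆ classLS gr d := by
  rintro H ⟨Φ, hΦ, hH⟩
  refine ⟨Φ, ?_, hH⟩
  simp only [classBE, classBS, Set.mem_iInter, Set.mem_iUnion] at hΦ ⊢
  intro n
  obtain ⟨⟨μ, hμ⟩, h⟩ := hΦ n
  exact ⟨⟨_, isFastDecay_exp hμ⟩, h⟩

/-- The interaction term of `Z`, as an operator on the volume `Λ`. -/
def Interaction.localTerm (Φ : Interaction q) (Λ Z : Finset Γ) : Obs q Λ :=
  if h : Z ⊆ Λ then embed h (Φ.term Λ Z) else 0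

lemma decayF_pos {ζ : ℝ → ℝ} (hζ : IsFastDecay ζ) (d : ℕ) {r : ℝ} (hr : 0 ≤ r) :
    0 < decayF d ζ r := by
  have := hζ.pos r hr
  unfold decayF
  positivity

variable [∀ x, NeZero (q x)]

namespace Interaction

variable (Φ : Interaction q) {Λ : Finset Γ}

lemma isSelfAdjoint_localTerm (Z : Finset Γ) : IsSelfAdjoint (Φ.localTerm Λ Z) := by
  unfold localTerm
  split_ifs with h
  · exact isSelfAdjoint_embed h (Φ.selfAdjoint Λ Z)
  · exact .zero _

lemma isSupported_localTerm (Z : Finset Γ) : IsSupported Z (Φ.localTerm Λ Z) := by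
  unfold localTerm
  split_ifs with h
  · exact isSupported_embed h _
  · exact ⟨fun _ _ _ => rfl, fun _ _ _ => rfl⟩

lemma norm_localTerm_le (Z : Finset Γ) : ‖Φ.localTerm Λ Z‖ ≤ ‖Φ.term Λ Z‖ := by
  unfold localTerm
  split_ifs with h
  · exact (norm_embed h _).le
  · simp

omit [∀ x, NeZero (q x)] in
lemma hamiltonian_eq : Φ.hamiltonian Λ = ∑ Z ∈ Λ.powerset, Φ.localTerm Λ Z := by
  rw [hamiltonian, ← Finset.sum_attach Λ.powerset]
  refine Finset.sum_congr rfl fun Z _ => ?_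
  rw [localTerm, dif_pos (Finset.mem_powerset.1 Z.2)]

end Interaction

/-- An interaction of finite norm: the terms that contain two given sites are summable. -/
lemma exists_sum_norm_localTerm_le {ζ : ℝ → ℝ} (hζ : IsFastDecay ζ) {Φ : ℝ → Interaction q}
    (hΦ : Φ ∈ classB gr d ζ 0) : ∃ M : ℝ, 0 < M ∧ ∀ (Λ : Finset Γ), ∀ s ∈ Set.Icc (0 : ℝ) 1,
      ∀ x y : Γ, ∑ Z ∈ Λ.powerset with x ∈ Z ∧ y ∈ Z, ‖(Φ s).localTerm Λ Z‖ ≤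
        M * decayF d ζ (gr.dist x y) := by
  have hfin : interactionNorm gr d ζ 0 Φ < ⊤ := hΦ
  refine ⟨(interactionNorm gr d ζ 0 Φ).toReal + 1, by positivity, fun Λ s hs x y => ?_⟩
  have hF := decayF_pos hζ d (Nat.cast_nonneg (α := ℝ) (gr.dist x y))
  set F := decayF d ζ (gr.dist x y) with hFdef
  have h1 : ∑ Z ∈ Λ.powerset with x ∈ Z ∧ y ∈ Z, ‖(Φ s).term Λ Z‖ₑ / ENNReal.ofReal F ≤
      interactionNorm gr d ζ 0 Φ := by
    unfold interactionNorm
    refine le_trans ?_ (le_iSup_of_le Λ <| le_iSup_of_le x <| le_iSup_of_le y le_rfl)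
    refine Finset.sum_le_sum fun Z _ => ?_
    refine le_trans ?_ (le_iSup₂_of_le s hs le_rfl)
    rw [pow_zero, one_mul]
  have h2 : ENNReal.ofReal ((∑ Z ∈ Λ.powerset with x ∈ Z ∧ y ∈ Z, ‖(Φ s).term Λ Z‖) / F) ≤
      interactionNorm gr d ζ 0 Φ := by
    refine le_trans (le_of_eq ?_) h1
    rw [Finset.sum_div, ENNReal.ofReal_sum_of_nonneg fun Z _ => by positivity]
    refine Finset.sum_congr rfl fun Z _ => ?_
    rw [ENNReal.ofReal_div_of_pos hF, ofReal_norm]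
  have h3 := (ENNReal.ofReal_le_iff_le_toReal hfin.ne).1 h2
  rw [div_le_iff₀ hF] at h3
  calc _ ≤ ∑ Z ∈ Λ.powerset with x ∈ Z ∧ y ∈ Z, ‖(Φ s).term Λ Z‖ :=
        Finset.sum_le_sum fun Z _ => (Φ s).norm_localTerm_le Z
    _ ≤ (interactionNorm gr d ζ 0 Φ).toReal * F := h3
    _ ≤ _ := by gcongr; linarith

/-- `T = ∑_{x ∈ Λ} g_x` with self-adjoint `g_x` that are localized near `x` to every order,
uniformly in the volume and in `s ∈ [0,1]`. The operators depend on a further time `t ∈ ℝ`,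
continuously and with polynomially growing constants. -/
structure IsAnchoredBy (gr : SimpleGraph Γ) (g : (Λ : Finset Γ) → ℝ → ℝ → Γ → Obs q Λ)
    (T : (Λ : Finset Γ) → ℝ → ℝ → Obs q Λ) : Prop where
  eq_sum : ∀ Λ, ∀ s ∈ Set.Icc (0 : ℝ) 1, ∀ t, T Λ s t = ∑ x ∈ Λ, g Λ s t x
  selfAdjoint : ∀ Λ, ∀ s ∈ Set.Icc (0 : ℝ) 1, ∀ t, ∀ x ∈ Λ, IsSelfAdjoint (g Λ s t x)
  continuous : ∀ Λ, ∀ s ∈ Set.Icc (0 : ℝ) 1, ∀ x ∈ Λ, Continuous fun t => g Λ s t x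
  localized : ∀ n : ℕ, ∃ (C : ℝ) (m : ℕ), 0 ≤ C ∧ ∀ Λ, ∀ s ∈ Set.Icc (0 : ℝ) 1, ∀ t, ∀ x ∈ Λ,
    IsLocalized gr n x (C * (1 + |t|) ^ m) (g Λ s t x)

/-- The families of operators that are sums over the sites of localized operators. -/
def IsAnchored (gr : SimpleGraph Γ) (T : (Λ : Finset Γ) → ℝ → ℝ → Obs q Λ) : Prop :=
  ∃ g, IsAnchoredBy gr g T

/-- A family in `𝓛_{𝓢,∞}`, made traceless, is a sum of localized operators. The term of `Z` is
distributed evenly among the sites of `Z`. The trace is removed since the norm of an interaction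
does not control its term for `Z = ∅`. -/
lemma isAnchored_of_mem_classLS (hd : HasDimension gr d) {G : Family q} (hG : G ∈ classLS gr d) :
    IsAnchored gr fun Λ s _ => G Λ s - condExp ∅ (G Λ s) := by
  obtain ⟨Φ, hΦ, hGΦ⟩ := hG
  simp only [classBS, Set.mem_iInter, Set.mem_iUnion] at hΦ
  obtain ⟨⟨ζ, hζ⟩, hΦ⟩ := hΦ 0
  obtain ⟨M, hM, hsum⟩ := exists_sum_norm_localTerm_le hζ hΦ
  obtain ⟨K, hK, hdist⟩ := exists_sum_dist_le hd
  set φ : (Λ : Finset Γ) → ℝ → Finset Γ → Obs q Λ := fun Λ s Z =>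
    (Φ s).localTerm Λ Z - condExp ∅ ((Φ s).localTerm Λ Z) with hφ
  have hφs : ∀ Λ s Z, IsSelfAdjoint (φ Λ s Z) := fun Λ s Z =>
    ((Φ s).isSelfAdjoint_localTerm Z).sub
      (isSelfAdjoint_condExp ((Φ s).isSelfAdjoint_localTerm Z))
  have hφn : ∀ Λ s Z, ‖φ Λ s Z‖ ≤ 2 * ‖(Φ s).localTerm Λ Z‖ := fun Λ s Z => by
    refine (norm_sub_le _ _).trans ?_
    have := norm_condExp_le (X := ∅) ((Φ s).localTerm Λ Z)
    linarith
  have hφsupp : ∀ Λ s Z, IsSupported Z (φ Λ s Z) := fun Λ s Z =>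
    ((Φ s).isSupported_localTerm Z).sub ((isSupported_condExp _).mono (Finset.empty_subset Z))
  have hφ0 : ∀ Λ s, φ Λ s ∅ = 0 := fun Λ s => by
    simp only [hφ]
    rw [((Φ s).isSupported_localTerm ∅).condExp_eq, sub_self]
  have hcard : ∀ Z : Finset Γ, ‖((Z.card : ℂ))⁻¹‖ ≤ 1 := fun Z => by
    rw [norm_inv, Complex.norm_natCast]
    rcases Nat.eq_zero_or_pos Z.card with h | h
    · simp [h]
    · exact inv_le_one_of_one_le₀ (by exact_mod_cast h)
  refine ⟨fun Λ s _ x => ∑ Z ∈ Λ.powerset with x ∈ Z, (Z.card : ℂ)⁻¹ • φ Λ s Z, ?_, ?_, ?_, ?_⟩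
  · intro Λ s hs _
    have h1 : G Λ s - condExp ∅ (G Λ s) = ∑ Z ∈ Λ.powerset, φ Λ s Z := by
      rw [hGΦ Λ s hs, Interaction.hamiltonian_eq, map_sum, ← Finset.sum_sub_distrib]
    simp only [h1, Finset.sum_filter]
    rw [Finset.sum_comm]
    refine Finset.sum_congr rfl fun Z hZ => ?_
    rw [← Finset.sum_filter, Finset.filter_mem_eq_inter,
      Finset.inter_eq_right.2 (Finset.mem_powerset.1 hZ), Finset.sum_const,
      ← Nat.cast_smul_eq_nsmul ℂ, smul_smul]
    rcases Z.eq_empty_or_nonempty with h | h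
    · rw [h, hφ0, smul_zero]
    · rw [mul_inv_cancel₀, one_smul]
      exact_mod_cast h.card_pos.ne'
  · intro Λ s hs _ x hx
    refine isSelfAdjoint_sum _ fun Z _ => IsSelfAdjoint.smul ?_ (hφs Λ s Z)
    simp [IsSelfAdjoint]
  · intro Λ s hs x hx
    exact continuous_const
  · intro n
    obtain ⟨C, hC, hCζ⟩ := hζ.exists_one_add_pow_mul_le (n + 1)
    refine ⟨2 * (M * decayF d ζ 0) + 4 * (M * C * K), 0, ?_, fun Λ s hs t x hx => ?_⟩
    · have := decayF_pos hζ d le_rfl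
      positivity
    have hF0 := decayF_pos hζ d le_rfl
    rw [pow_zero, mul_one]
    refine ⟨?_, fun r => ?_⟩
    · calc ‖∑ Z ∈ Λ.powerset with x ∈ Z, (Z.card : ℂ)⁻¹ • φ Λ s Z‖
          ≤ ∑ Z ∈ Λ.powerset with x ∈ Z, 2 * ‖(Φ s).localTerm Λ Z‖ := by
            refine norm_sum_le_of_le _ fun Z _ => ?_
            rw [norm_smul]
            calc _ ≤ 1 * (2 * ‖(Φ s).localTerm Λ Z‖) := by gcongr; exacts [hcard Z, hφn Λ s Z]
              _ = _ := one_mul _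
        _ = 2 * ∑ Z ∈ Λ.powerset with x ∈ Z ∧ x ∈ Z, ‖(Φ s).localTerm Λ Z‖ := by
            simp only [and_self, Finset.mul_sum]
        _ ≤ 2 * (M * decayF d ζ (gr.dist x x)) := by gcongr; exact hsum Λ s hs x x
        _ = 2 * (M * decayF d ζ 0) := by simp
        _ ≤ _ := by
            have : 0 ≤ 4 * (M * C * K) := by positivity
            linarith
    · have h1 : ‖(∑ Z ∈ Λ.powerset with x ∈ Z, (Z.card : ℂ)⁻¹ • φ Λ s Z) -
          condExp (ball gr Λ x r) (∑ Z ∈ Λ.powerset with x ∈ Z, (Z.card : ℂ)⁻¹ • φ Λ s Z)‖ ≤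
          ∑ y ∈ Λ with r < gr.dist x y, 4 * (M * decayF d ζ (gr.dist x y)) := by
        rw [map_sum, ← Finset.sum_sub_distrib]
        calc _ ≤ ∑ Z ∈ Λ.powerset with x ∈ Z,
                if Z ⊆ ball gr Λ x r then 0 else 4 * ‖(Φ s).localTerm Λ Z‖ := by
              refine norm_sum_le_of_le _ fun Z _ => ?_
              rw [map_smul, ← smul_sub, norm_smul]
              split_ifs with h
              · rw [((hφsupp Λ s Z).mono h).condExp_eq, sub_self, norm_zero, mul_zero]
              · calc _ ≤ 1 * (‖φ Λ s Z‖ + ‖φ Λ s Z‖) := by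
                      gcongr
                      · exact hcard Z
                      · refine (norm_sub_le _ _).trans ?_
                        gcongr
                        exact norm_condExp_le _
                  _ ≤ _ := by linarith [hφn Λ s Z]
          _ = ∑ Z ∈ (Λ.powerset.filter (x ∈ ·)).filter fun Z => ¬ Z ⊆ ball gr Λ x r,
                4 * ‖(Φ s).localTerm Λ Z‖ := by
              rw [Finset.sum_filter (fun Z => ¬ Z ⊆ ball gr Λ x r)]
              refine Finset.sum_congr rfl fun Z _ => ?_
              by_cases h : Z ⊆ ball gr Λ x r <;> simp [h]
          _ ≤ ∑ Z ∈ (Λ.filter fun y => r < gr.dist x y).biUnion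
                fun y => Λ.powerset.filter fun Z => x ∈ Z ∧ y ∈ Z,
                4 * ‖(Φ s).localTerm Λ Z‖ := by
              refine Finset.sum_le_sum_of_subset_of_nonneg (fun Z hZ => ?_)
                fun Z _ _ => by positivity
              obtain ⟨hZ1, hZ2⟩ := Finset.mem_filter.1 hZ
              obtain ⟨hZ3, hxZ⟩ := Finset.mem_filter.1 hZ1
              obtain ⟨y, hyZ, hy⟩ := Finset.not_subset.1 hZ2
              have hyΛ := Finset.mem_powerset.1 hZ3 hyZ
              have : r < gr.dist x y := by
                by_contra hle
                exact hy (mem_ball.2 ⟨hyΛ, not_lt.1 hle⟩)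
              exact Finset.mem_biUnion.2 ⟨y, Finset.mem_filter.2 ⟨hyΛ, this⟩,
                Finset.mem_filter.2 ⟨hZ3, hxZ, hyZ⟩⟩
          _ ≤ ∑ y ∈ Λ with r < gr.dist x y, ∑ Z ∈ Λ.powerset with x ∈ Z ∧ y ∈ Z,
                4 * ‖(Φ s).localTerm Λ Z‖ := sum_biUnion_le _ _ _ fun Z => by positivity
          _ ≤ _ := by
              refine Finset.sum_le_sum fun y _ => ?_
              rw [← Finset.mul_sum]
              gcongr
              exact hsum Λ s hs x y
      calc _ ≤ (1 + (r : ℝ)) ^ n * ∑ y ∈ Λ with r < gr.dist x y,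
              4 * (M * decayF d ζ (gr.dist x y)) := by gcongr
        _ ≤ ∑ y ∈ Λ with r < gr.dist x y,
              4 * (M * C) * ((1 + (gr.dist x y : ℝ)) ^ (d + 2))⁻¹ := by
            rw [Finset.mul_sum]
            refine Finset.sum_le_sum fun y hy => ?_
            set D : ℝ := ((gr.dist x y : ℕ) : ℝ) with hD
            have hrD : (r : ℝ) ≤ D := by
              rw [hD]
              exact_mod_cast (Finset.mem_filter.1 hy).2.le
            have hD0 : 0 ≤ D := Nat.cast_nonneg _
            have hζ0 := hζ.pos D hD0
            rw [← div_eq_mul_inv, le_div_iff₀ (by positivity), decayF]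
            calc (1 + (r : ℝ)) ^ n * (4 * (M * (ζ D * ((1 + D) ^ (d + 1))⁻¹))) * (1 + D) ^ (d + 2)
                ≤ (1 + D) ^ n * (4 * (M * (ζ D * ((1 + D) ^ (d + 1))⁻¹))) * (1 + D) ^ (d + 2) := by
                  gcongr
              _ = 4 * M * ((1 + D) ^ (n + 1) * ζ D) := by
                  rw [pow_succ _ (d + 1), pow_succ _ n]
                  field_simp
              _ ≤ 4 * M * C := by gcongr; exact hCζ D hD0
              _ = _ := by ring
        _ ≤ ∑ y ∈ Λ, 4 * (M * C) * ((1 + (gr.dist x y : ℝ)) ^ (d + 2))⁻¹ :=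
            Finset.sum_le_sum_of_subset_of_nonneg (Finset.filter_subset _ _)
              fun y _ _ => by positivity
        _ ≤ 4 * (M * C) * K := by
            rw [← Finset.mul_sum]
            gcongr
            exact hdist Λ x
        _ ≤ _ := by
            have : 0 < M * decayF d ζ 0 := by positivity
            linarith

/-- The dynamics of `H` preserves localization near a site, with constants that grow polynomially
in time, uniformly in the volume and in `s ∈ [0,1]`. -/
def HasLightCone (gr : SimpleGraph Γ) (H : Family q) : Prop :=
  ∀ n : ℕ, ∃ K : ℝ, 0 < K ∧ ∀ Λ, ∀ s ∈ Set.Icc (0 : ℝ) 1, ∀ x ∈ Λ, ∀ (t b : ℝ) (A : Obs q Λ),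
    IsLocalized gr n x b A → IsLocalized gr n x (K * b * (1 + |t|) ^ n) (evolve (H Λ s) t A)

/-- Half of the exponential decay `μ` of the interaction serves as the rate of the weight in the
Lieb–Robinson bound; the other half makes the sums over the sites converge. -/
lemma hasLightCone_of_mem_classLE (hconn : gr.Connected) (hd : HasDimension gr d) {H : Family q}
    (hH : H ∈ classLE gr d) : HasLightCone gr H := by
  obtain ⟨Φ, hΦ, hHΦ⟩ := hH
  simp only [classBE, Set.mem_iInter, Set.mem_iUnion] at hΦ
  obtain ⟨⟨μ, hμ⟩, hΦ⟩ := hΦ 0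
  obtain ⟨M, hM, hsum⟩ := exists_sum_norm_localTerm_le (isFastDecay_exp hμ) hΦ
  obtain ⟨K, hK, hdist⟩ := exists_sum_dist_le hd
  obtain ⟨L, hL, hLexp⟩ := exists_pow_mul_exp_neg_le 1 (c := μ / 2) (by positivity)
  intro n
  obtain ⟨K', hK', h⟩ := exists_isLocalized_evolve (q := q) hconn hd n (ν := μ / 2)
    (v := M * L * K) (by positivity) (by positivity)
  refine ⟨K', hK', fun Λ s hs x hx t b A hA => ?_⟩
  rw [hHΦ Λ s hs, Interaction.hamiltonian_eq]
  refine h Λ _ (fun Z => (Φ s).isSelfAdjoint_localTerm Z)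
    (fun Z => (Φ s).isSupported_localTerm Z) (fun y hy => ?_) x hx t b A hA
  calc ∑ Z ∈ Λ.powerset with y ∈ Z, ‖(Φ s).localTerm Λ Z‖ *
        ∑ z ∈ Z, Real.exp (μ / 2 * gr.dist y z)
      = ∑ Z ∈ Λ.powerset with y ∈ Z, ∑ z ∈ Λ,
          if z ∈ Z then ‖(Φ s).localTerm Λ Z‖ * Real.exp (μ / 2 * gr.dist y z) else 0 := by
        refine Finset.sum_congr rfl fun Z hZ => ?_
        have hZΛ := Finset.mem_powerset.1 (Finset.mem_filter.1 hZ).1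
        rw [← Finset.sum_filter, Finset.filter_mem_eq_inter, Finset.inter_eq_right.2 hZΛ,
          Finset.mul_sum]
    _ = ∑ z ∈ Λ, (∑ Z ∈ Λ.powerset with y ∈ Z ∧ z ∈ Z, ‖(Φ s).localTerm Λ Z‖) *
          Real.exp (μ / 2 * gr.dist y z) := by
        rw [Finset.sum_comm]
        refine Finset.sum_congr rfl fun z _ => ?_
        rw [← Finset.sum_filter, Finset.filter_filter, Finset.sum_mul]
    _ ≤ ∑ z ∈ Λ, M * L * ((1 + (gr.dist y z : ℝ)) ^ (d + 2))⁻¹ := by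
        refine Finset.sum_le_sum fun z _ => ?_
        have h1 := hsum Λ s hs y z
        set D : ℝ := ((gr.dist y z : ℕ) : ℝ) with hD
        have hD0 : 0 ≤ D := Nat.cast_nonneg _
        have h2 := hLexp D hD0
        rw [← div_eq_mul_inv, le_div_iff₀ (by positivity)]
        calc _ ≤ M * decayF d (fun r => Real.exp (-(μ * r))) D * Real.exp (μ / 2 * D) *
              (1 + D) ^ (d + 2) := by gcongr
          _ = M * ((1 + D) ^ 1 * (Real.exp (-(μ * D)) * Real.exp (μ / 2 * D))) := by
              rw [decayF, pow_succ _ (d + 1)]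
              field_simp
          _ = M * ((1 + D) ^ 1 * Real.exp (-(μ / 2 * D))) := by
              rw [← Real.exp_add]
              congr 3
              ring
          _ ≤ _ := by gcongr
    _ ≤ M * L * K := by
        rw [← Finset.mul_sum]
        gcongr
        exact hdist Λ y

end Anchored

/-! ### From sums of localized operators to interactions -/

section Anchored

variable {Γ : Type*} [DecidableEq Γ] {q : Γ → ℕ} {gr : SimpleGraph Γ} {d : ℕ}
  [∀ x, NeZero (q x)]

/-- The conditional expectations onto the balls around `x`, shifted such that `shell` is the sequence
of differences. -/
def ballExp (gr : SimpleGraph Γ) {Λ : Finset Γ} (x : Γ) (A : Obs q Λ) : ℕ → Obs q Λ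
  | 0 => 0
  | r + 1 => condExp (ball gr Λ x r) A

/-- The part of `A` that is supported in the ball of radius `r` around `x`, but not in the next
smaller one. -/
def shell (gr : SimpleGraph Γ) {Λ : Finset Γ} (x : Γ) (A : Obs q Λ) (r : ℕ) : Obs q Λ :=
  ballExp gr x A (r + 1) - ballExp gr x A r

variable {Λ : Finset Γ} {x : Γ} {A : Obs q Λ}

lemma isSelfAdjoint_ballExp (hA : IsSelfAdjoint A) (r : ℕ) :
    IsSelfAdjoint (ballExp gr x A r) := by
  cases r with
  | zero => exact .zero _
  | succ r => exact isSelfAdjoint_condExp hA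

lemma isSelfAdjoint_shell (hA : IsSelfAdjoint A) (r : ℕ) : IsSelfAdjoint (shell gr x A r) :=
  (isSelfAdjoint_ballExp hA _).sub (isSelfAdjoint_ballExp hA _)

lemma isSupported_shell (r : ℕ) : IsSupported (ball gr Λ x r) (shell gr x A r) := by
  refine (isSupported_condExp A).sub ?_
  cases r with
  | zero => exact ⟨fun _ _ _ => rfl, fun _ _ _ => rfl⟩
  | succ r =>
    refine (isSupported_condExp A).mono fun y hy => ?_
    rw [mem_ball] at hy ⊢
    exact ⟨hy.1, by omega⟩

lemma sum_shell (R : ℕ) (hR : ∀ y ∈ Λ, gr.dist x y ≤ R) :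
    ∑ r ∈ Finset.range (R + 1), shell gr x A r = A := by
  unfold shell
  rw [Finset.sum_range_sub]
  simp only [ballExp, sub_zero]
  exact condExp_eq_self (fun y hy => mem_ball.2 ⟨hy, hR y hy⟩) A

lemma IsLocalized.norm_shell_le {m : ℕ} {C : ℝ} (hA : IsLocalized gr m x C A) (r : ℕ) :
    (1 + (r : ℝ)) ^ m * ‖shell gr x A r‖ ≤ 2 * 2 ^ m * C := by
  have hC := hA.nonneg
  have h2 : (1 : ℝ) ≤ 2 ^ m := one_le_pow₀ (by norm_num)
  cases r with
  | zero =>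
    simp only [shell, ballExp, sub_zero, Nat.cast_zero, add_zero, one_pow, one_mul]
    have := (norm_condExp_le (X := ball gr Λ x 0) A).trans hA.norm_le
    nlinarith
  | succ r =>
    have hsplit : shell gr x A (r + 1) =
        (A - condExp (ball gr Λ x r) A) - (A - condExp (ball gr Λ x (r + 1)) A) := by
      simp only [shell, ballExp]
      abel
    have h3 : (1 + ((r + 1 : ℕ) : ℝ)) ^ m ≤ 2 ^ m * (1 + (r : ℝ)) ^ m := by
      rw [← mul_pow]
      gcongr
      push_cast
      linarith [Nat.cast_nonneg (α := ℝ) r]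
    have h4 := hA.tail_le r
    have h5 := hA.tail_le (r + 1)
    calc (1 + ((r + 1 : ℕ) : ℝ)) ^ m * ‖shell gr x A (r + 1)‖
        ≤ (1 + ((r + 1 : ℕ) : ℝ)) ^ m * (‖A - condExp (ball gr Λ x r) A‖ +
          ‖A - condExp (ball gr Λ x (r + 1)) A‖) := by
          gcongr
          rw [hsplit]
          exact norm_sub_le _ _
      _ ≤ 2 ^ m * (1 + (r : ℝ)) ^ m * ‖A - condExp (ball gr Λ x r) A‖ +
          (1 + ((r + 1 : ℕ) : ℝ)) ^ m * ‖A - condExp (ball gr Λ x (r + 1)) A‖ := by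
          rw [mul_add]; gcongr
      _ ≤ 2 ^ m * C + 1 * C := by rw [mul_assoc, one_mul]; gcongr
      _ ≤ 2 ^ m * C + 2 ^ m * C := by gcongr
      _ = _ := by ring

/-- A radius such that the balls around the sites of `Λ` contain `Λ`. -/
def volumeRadius (gr : SimpleGraph Γ) (Λ : Finset Γ) : ℕ :=
  (Λ ×ˢ Λ).sup fun p => gr.dist p.1 p.2

omit [DecidableEq Γ] in
lemma dist_le_volumeRadius {x y : Γ} (hx : x ∈ Λ) (hy : y ∈ Λ) :
    gr.dist x y ≤ volumeRadius gr Λ :=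
  Finset.le_sup (f := fun p : Γ × Γ => gr.dist p.1 p.2) (Finset.mk_mem_product hx hy)

open Classical in
/-- The interaction of a family `∑_x g_x + S` with scalar `S`: the term of `Z` collects the shells
of the `g_x` that belong to a ball equal to `Z`. -/
def shellTerm (gr : SimpleGraph Γ) (g : (Λ : Finset Γ) → ℝ → Γ → Obs q Λ) (S : Family q) (s : ℝ)
    (Λ Z : Finset Γ) : Obs q Z :=
  if s ∈ Set.Icc (0 : ℝ) 1 ∧ Z ⊆ Λ then
    (if Z = ∅ then reduce Z (S Λ s) else 0) +
      ∑ x ∈ Λ, ∑ r ∈ Finset.range (volumeRadius gr Λ + 1),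
        if ball gr Λ x r = Z then reduce Z (shell gr x (g Λ s x) r) else 0
  else 0

/-- A weighted sum over balls that contain two given sites decays with their distance. -/
lemma exists_sum_ball_le (hconn : gr.Connected) (hd : HasDimension gr d) (n : ℕ) {β : ℕ → ℝ}
    (hβ0 : ∀ r, 0 ≤ β r) (hβ : ∀ m : ℕ, ∃ C : ℝ, 0 ≤ C ∧ ∀ r : ℕ, (1 + (r : ℝ)) ^ m * β r ≤ C) :
    ∃ C : ℕ → ℝ, ∀ (Λ : Finset Γ) (u v : Γ) (R : ℕ) (p : ℕ),
      (1 + (gr.dist u v : ℝ)) ^ p * ∑ x ∈ Λ, ∑ r ∈ Finset.range R,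
        (if u ∈ ball gr Λ x r ∧ v ∈ ball gr Λ x r then
          ((ball gr Λ x r).card : ℝ) ^ n * β r else 0) ≤ C p := by
  obtain ⟨κ, hκ, hball⟩ := exists_card_ball_le hd
  obtain ⟨K, hK, hdist⟩ := exists_sum_dist_le hd
  obtain ⟨K₂, hK₂, hsq⟩ := exists_sum_inv_sq_le
  choose C hC0 hC using hβ
  refine ⟨fun p => 2 ^ p * κ ^ n * C (d * n + p + 2 + (d + 2)) * (K * K₂),
    fun Λ u v R p => ?_⟩
  set c := 2 ^ p * κ ^ n * C (d * n + p + 2 + (d + 2)) with hc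
  have hc0 : 0 ≤ c := by
    have := hC0 (d * n + p + 2 + (d + 2))
    positivity
  have hterm : ∀ x ∈ Λ, ∀ r ∈ Finset.range R, (1 + (gr.dist u v : ℝ)) ^ p *
      (if u ∈ ball gr Λ x r ∧ v ∈ ball gr Λ x r then
        ((ball gr Λ x r).card : ℝ) ^ n * β r else 0) ≤
      c * (((1 + (gr.dist u x : ℝ)) ^ (d + 2))⁻¹ * ((1 + (r : ℝ)) ^ 2)⁻¹) := by
    intro x _ r _
    split_ifs with h
    swap
    · rw [mul_zero]; positivity
    have hu := (mem_ball.1 h.1).2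
    have hv := (mem_ball.1 h.2).2
    have huv : (1 + (gr.dist u v : ℝ)) ≤ 2 * (1 + r) := by
      have h1 := hconn.dist_triangle (u := u) (v := x) (w := v)
      rw [SimpleGraph.dist_comm (u := u) (v := x)] at h1
      have h2 : 1 + gr.dist u v ≤ 2 * (1 + r) := by omega
      exact_mod_cast h2
    have hux : (1 + (gr.dist u x : ℝ)) ≤ 1 + r := by
      rw [SimpleGraph.dist_comm]
      have : 1 + gr.dist x u ≤ 1 + r := by omega
      exact_mod_cast this
    have hb := hβ0 r
    have hCr := hC (d * n + p + 2 + (d + 2)) r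
    rw [← mul_inv, ← div_eq_mul_inv, le_div_iff₀ (by positivity)]
    calc (1 + (gr.dist u v : ℝ)) ^ p * (((ball gr Λ x r).card : ℝ) ^ n * β r) *
          ((1 + (gr.dist u x : ℝ)) ^ (d + 2) * (1 + (r : ℝ)) ^ 2)
        ≤ (2 * (1 + (r : ℝ))) ^ p * ((κ * (1 + (r : ℝ)) ^ d) ^ n * β r) *
          ((1 + (r : ℝ)) ^ (d + 2) * (1 + (r : ℝ)) ^ 2) := by
          gcongr
          exact hball Λ x r
      _ = 2 ^ p * κ ^ n * ((1 + (r : ℝ)) ^ (d * n + p + 2 + (d + 2)) * β r) := by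
          rw [mul_pow, mul_pow, ← pow_mul]
          simp only [pow_add]
          ring
      _ ≤ c := by rw [hc]; gcongr
  calc _ = ∑ x ∈ Λ, ∑ r ∈ Finset.range R, (1 + (gr.dist u v : ℝ)) ^ p *
        (if u ∈ ball gr Λ x r ∧ v ∈ ball gr Λ x r then
          ((ball gr Λ x r).card : ℝ) ^ n * β r else 0) := by
        simp only [Finset.mul_sum]
    _ ≤ ∑ x ∈ Λ, ∑ r ∈ Finset.range R,
        c * (((1 + (gr.dist u x : ℝ)) ^ (d + 2))⁻¹ * ((1 + (r : ℝ)) ^ 2)⁻¹) :=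
        Finset.sum_le_sum fun x hx => Finset.sum_le_sum fun r hr => hterm x hx r hr
    _ = c * ((∑ x ∈ Λ, ((1 + (gr.dist u x : ℝ)) ^ (d + 2))⁻¹) *
        ∑ r ∈ Finset.range R, ((1 + (r : ℝ)) ^ 2)⁻¹) := by
        rw [Finset.sum_mul_sum, Finset.mul_sum]
        exact Finset.sum_congr rfl fun x _ => by rw [Finset.mul_sum]
    _ ≤ c * (K * K₂) := by
        gcongr
        · exact hdist Λ u
        · exact hsq _

/-- A sum over the sites of localized operators, plus scalars, belongs to `𝓛_{𝓢,∞}`. -/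
lemma mem_classLS_of_isAnchored (hconn : gr.Connected) (hd : HasDimension gr d)
    {T : (Λ : Finset Γ) → ℝ → ℝ → Obs q Λ} (hT : IsAnchored gr T) {F S : Family q}
    (hS : ∀ Λ, ∀ s ∈ Set.Icc (0 : ℝ) 1, IsSupported ∅ (S Λ s))
    (hSs : ∀ Λ, ∀ s ∈ Set.Icc (0 : ℝ) 1, IsSelfAdjoint (S Λ s))
    (hF : ∀ Λ, ∀ s ∈ Set.Icc (0 : ℝ) 1, F Λ s = T Λ s 0 + S Λ s) : F ∈ classLS gr d := by
  classical
  obtain ⟨g, hg⟩ := hT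
  -- One bound for the shells that decays faster than every power.
  have hshell : ∀ m : ℕ, ∃ C : ℝ, 0 ≤ C ∧ ∀ Λ, ∀ s ∈ Set.Icc (0 : ℝ) 1, ∀ x ∈ Λ, ∀ r : ℕ,
      (1 + (r : ℝ)) ^ m * ‖shell gr x (g Λ s 0 x) r‖ ≤ C := by
    intro m
    obtain ⟨C, m', hC, h⟩ := hg.localized m
    refine ⟨2 * 2 ^ m * C, by positivity, fun Λ s hs x hx r => ?_⟩
    simpa using (h Λ s hs 0 x hx).norm_shell_le r
  choose C hC0 hC using hshell
  set β : ℕ → ℝ := fun r => ⨅ m : ℕ, C m * ((1 + (r : ℝ)) ^ m)⁻¹ with hβ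
  have hβ0 : ∀ r, 0 ≤ β r := fun r => le_ciInf fun m => by
    have := hC0 m
    positivity
  have hβC : ∀ m : ℕ, ∀ r : ℕ, (1 + (r : ℝ)) ^ m * β r ≤ C m := fun m r => by
    have h1 : β r ≤ C m * ((1 + (r : ℝ)) ^ m)⁻¹ := ciInf_le ⟨0, by
      rintro _ ⟨m, rfl⟩
      have := hC0 m
      positivity⟩ m
    rwa [← div_eq_mul_inv, le_div_iff₀ (by positivity), mul_comm] at h1
  have hβs : ∀ Λ, ∀ s ∈ Set.Icc (0 : ℝ) 1, ∀ x ∈ Λ, ∀ r : ℕ,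
      ‖shell gr x (g Λ s 0 x) r‖ ≤ β r := fun Λ s hs x hx r => le_ciInf fun m => by
    rw [← div_eq_mul_inv, le_div_iff₀ (by positivity), mul_comm]
    exact hC m Λ s hs x hx r
  set Φ : ℝ → Interaction q := fun s =>
    { term := shellTerm gr (fun Λ s x => g Λ s 0 x) S s
      selfAdjoint := fun Λ Z => by
        unfold shellTerm
        split_ifs with h h1
        · subst h1
          refine (isSelfAdjoint_reduce (hSs Λ s h.1)).add (isSelfAdjoint_sum _ fun x hx =>
            isSelfAdjoint_sum _ fun r _ => ?_)
          split_ifs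
          · exact isSelfAdjoint_reduce (isSelfAdjoint_shell (hg.selfAdjoint Λ s h.1 0 x hx) r)
          · exact .zero _
        · refine (IsSelfAdjoint.zero _).add (isSelfAdjoint_sum _ fun x hx =>
            isSelfAdjoint_sum _ fun r _ => ?_)
          split_ifs
          · exact isSelfAdjoint_reduce (isSelfAdjoint_shell (hg.selfAdjoint Λ s h.1 0 x hx) r)
          · exact .zero _
        · exact .zero _
      eq_zero := fun Λ Z h => by
        unfold shellTerm
        rw [if_neg fun h' => h h'.2] } with hΦ
  refine ⟨Φ, ?_, ?_⟩
  · simp only [classBS, Set.mem_iInter, Set.mem_iUnion]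
    intro n
    obtain ⟨C', hC'⟩ := exists_sum_ball_le hconn hd n hβ0 fun m => ⟨C m, hC0 m, hβC m⟩
    obtain ⟨ζ, hζ, K, hK, hζK⟩ := exists_isFastDecay_le_decayF d C'
    refine ⟨⟨ζ, hζ⟩, ?_⟩
    change interactionNorm gr d ζ n Φ < ⊤
    refine lt_of_le_of_lt ?_ (ENNReal.ofReal_lt_top (r := K))
    refine iSup_le fun Λ => iSup_le fun u => iSup_le fun v => ?_
    set D := decayF d ζ (gr.dist u v) with hD
    have hDpos : 0 < D := decayF_pos hζ d (Nat.cast_nonneg _)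
    set b : Finset Γ → ℝ := fun Z => (Z.card : ℝ) ^ n *
      ∑ x ∈ Λ, ∑ r ∈ Finset.range (volumeRadius gr Λ + 1),
        if ball gr Λ x r = Z then β r else 0 with hb
    have hsum0 : ∀ Z, 0 ≤ ∑ x ∈ Λ, ∑ r ∈ Finset.range (volumeRadius gr Λ + 1),
        if ball gr Λ x r = Z then β r else 0 := fun Z =>
      Finset.sum_nonneg fun x _ => Finset.sum_nonneg fun r _ => by
        split_ifs
        · exact hβ0 r
        · exact le_rfl
    have hb0 : ∀ Z, 0 ≤ b Z := fun Z => mul_nonneg (by positivity) (hsum0 Z)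
    have hterm : ∀ Z ∈ Λ.powerset.filter fun Z => u ∈ Z ∧ v ∈ Z,
        (⨆ s ∈ Set.Icc (0 : ℝ) 1, (Z.card : ℝ≥0∞) ^ n * ‖(Φ s).term Λ Z‖ₑ / ENNReal.ofReal D) ≤
          ENNReal.ofReal (b Z / D) := by
      intro Z hZ
      obtain ⟨hZΛ, huZ, -⟩ := Finset.mem_filter.1 hZ
      have hZΛ := Finset.mem_powerset.1 hZΛ
      have hZne : Z ≠ ∅ := fun h => by simp [h] at huZ
      refine iSup₂_le fun s hs => ?_
      have h1 : ‖(Φ s).term Λ Z‖ ≤ ∑ x ∈ Λ, ∑ r ∈ Finset.range (volumeRadius gr Λ + 1),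
          if ball gr Λ x r = Z then β r else 0 := by
        change ‖shellTerm gr (fun Λ s x => g Λ s 0 x) S s Λ Z‖ ≤ _
        unfold shellTerm
        rw [if_pos ⟨hs, hZΛ⟩, if_neg hZne, zero_add]
        refine norm_sum_le_of_le _ fun x hx => norm_sum_le_of_le _ fun r _ => ?_
        split_ifs with h
        · subst h
          rw [norm_reduce hZΛ (isSupported_shell r)]
          exact hβs Λ s hs x hx r
        · rw [norm_zero]
      rw [ENNReal.ofReal_div_of_pos hDpos, hb, ENNReal.ofReal_mul (by positivity),
        ENNReal.ofReal_pow (by positivity), ENNReal.ofReal_natCast]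
      gcongr
      rw [← ofReal_norm]
      exact ENNReal.ofReal_le_ofReal h1
    have hsumb : ∑ Z ∈ Λ.powerset with u ∈ Z ∧ v ∈ Z, b Z ≤ K * D := by
      refine hζK _ _ (Nat.cast_nonneg _) (Finset.sum_nonneg fun Z _ => hb0 Z) fun p => ?_
      refine le_trans (le_of_eq ?_) (hC' Λ u v (volumeRadius gr Λ + 1) p)
      congr 1
      simp only [hb, Finset.mul_sum]
      rw [Finset.sum_comm]
      refine Finset.sum_congr rfl fun x _ => ?_
      rw [Finset.sum_comm]
      refine Finset.sum_congr rfl fun r _ => ?_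
      simp only [mul_ite, mul_zero]
      rw [Finset.sum_ite_eq]
      simp [ball_subset]
    calc _ ≤ ∑ Z ∈ Λ.powerset with u ∈ Z ∧ v ∈ Z, ENNReal.ofReal (b Z / D) :=
          Finset.sum_le_sum hterm
      _ = ENNReal.ofReal ((∑ Z ∈ Λ.powerset with u ∈ Z ∧ v ∈ Z, b Z) / D) := by
          rw [Finset.sum_div, ENNReal.ofReal_sum_of_nonneg fun Z _ =>
            div_nonneg (hb0 Z) hDpos.le]
      _ ≤ ENNReal.ofReal K := by
          refine ENNReal.ofReal_le_ofReal ?_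
          rwa [div_le_iff₀ hDpos]
  · intro Λ s hs
    rw [hF Λ s hs, hg.eq_sum Λ s hs 0, Interaction.hamiltonian_eq]
    have h1 : ∀ Z ∈ Λ.powerset, (Φ s).localTerm Λ Z = (if Z = ∅ then S Λ s else 0) +
        ∑ x ∈ Λ, ∑ r ∈ Finset.range (volumeRadius gr Λ + 1),
          if ball gr Λ x r = Z then shell gr x (g Λ s 0 x) r else 0 := by
      intro Z hZ
      have hZΛ := Finset.mem_powerset.1 hZ
      have h2 : ∀ B : Obs q Z, embed hZΛ B = embedHom hZΛ B := fun _ => rfl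
      rw [Interaction.localTerm, dif_pos hZΛ]
      change embed hZΛ (shellTerm gr (fun Λ s x => g Λ s 0 x) S s Λ Z) = _
      unfold shellTerm
      rw [if_pos ⟨hs, hZΛ⟩, h2, map_add, map_sum]
      congr 1
      · split_ifs with h
        · subst h
          rw [← h2, embed_reduce hZΛ (hS Λ s hs)]
        · exact map_zero _
      · refine Finset.sum_congr rfl fun x _ => ?_
        rw [map_sum]
        refine Finset.sum_congr rfl fun r _ => ?_
        split_ifs with h
        · subst h
          rw [← h2, embed_reduce hZΛ (isSupported_shell r)]
        · exact map_zero _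
    rw [Finset.sum_congr rfl h1, Finset.sum_add_distrib, Finset.sum_ite_eq',
      if_pos (Finset.empty_mem_powerset Λ), add_comm, Finset.sum_comm]
    congr 1
    refine Finset.sum_congr rfl fun x hx => ?_
    rw [Finset.sum_comm]
    have h2 : ∀ r ∈ Finset.range (volumeRadius gr Λ + 1), (∑ Z ∈ Λ.powerset,
        if ball gr Λ x r = Z then shell gr x (g Λ s 0 x) r else 0) =
        shell gr x (g Λ s 0 x) r := fun r _ => by
      rw [Finset.sum_ite_eq, if_pos (Finset.mem_powerset.2 ball_subset)]
    rw [Finset.sum_congr rfl h2, sum_shell _ fun y hy => dist_le_volumeRadius hx hy]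

end Anchored

/-! ### Dependence of the inhomogeneous Heisenberg equation on a parameter -/

section Duhamel

open Filter Topology

variable {𝔸 : Type*} [CStarAlgebra 𝔸]

/-- The solution of `∂_t X = i [H, X] + F` with `X(0) = g`, by variation of constants. -/
def duhamel (H g : 𝔸) (F : ℝ → 𝔸) (t : ℝ) : 𝔸 :=
  evolve H t (g + ∫ u in (0 : ℝ)..t, evolve H (-u) (F u))

variable {H H₀ g : 𝔸} {F : ℝ → 𝔸}

lemma evolve_lie_self (H A : 𝔸) (t : ℝ) : evolve H t ⁅H, A⁆ = ⁅H, evolve H t A⁆ := by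
  have h1 := (commute_propagator H t).eq
  have h2 := (commute_propagator H (-t)).eq
  simp only [evolve, Ring.lie_def, mul_sub, sub_mul]
  congr 1
  · rw [← mul_assoc, h1]; simp only [mul_assoc]
  · simp only [mul_assoc]; rw [h2]

lemma continuous_evolve_neg (H : 𝔸) (hF : Continuous F) :
    Continuous fun u => evolve H (-u) (F u) :=
  continuous_evolve_comp H continuous_neg hF

lemma duhamel_zero_right (H g : 𝔸) (t : ℝ) : duhamel H g (fun _ => 0) t = evolve H t g := by
  simp [duhamel, evolve]

lemma duhamel_zero (H g : 𝔸) (F : ℝ → 𝔸) : duhamel H g F 0 = g := by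
  simp [duhamel, evolve_zero]

lemma hasDerivAt_duhamel (hF : Continuous F) (t : ℝ) :
    HasDerivAt (duhamel H g F) (Complex.I • ⁅H, duhamel H g F t⁆ + F t) t := by
  have h1 : HasDerivAt (fun t => g + ∫ u in (0 : ℝ)..t, evolve H (-u) (F u))
      (evolve H (-t) (F t)) t :=
    ((continuous_evolve_neg H hF).integral_hasStrictDerivAt 0 t).hasDerivAt.const_add g
  refine (hasDerivAt_evolve_comp H h1).congr_deriv ?_
  rw [evolve_add_right, evolve_smul, evolve_lie_self, evolve_evolve, add_neg_cancel, evolve_zero]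
  rfl

lemma continuous_duhamel (hF : Continuous F) : Continuous (duhamel H g F) :=
  continuous_iff_continuousAt.2 fun t => (hasDerivAt_duhamel hF t).continuousAt

lemma continuous_lie {f₁ f₂ : ℝ → 𝔸} (h₁ : Continuous f₁) (h₂ : Continuous f₂) :
    Continuous fun t => ⁅f₁ t, f₂ t⁆ := by
  simp only [Ring.lie_def]
  exact (h₁.mul h₂).sub (h₂.mul h₁)

/-- The interaction picture with respect to a second Hamiltonian `H₀`. -/
lemma evolve_neg_duhamel (H₀ : 𝔸) (hF : Continuous F) (t : ℝ) :
    evolve H₀ (-t) (duhamel H g F t) =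
      g + ∫ u in (0 : ℝ)..t, evolve H₀ (-u) (Complex.I • ⁅H - H₀, duhamel H g F u⁆ + F u) := by
  have hX := continuous_duhamel (H := H) (g := g) hF
  have hc : Continuous fun u => evolve H₀ (-u) (Complex.I • ⁅H - H₀, duhamel H g F u⁆ + F u) :=
    continuous_evolve_neg H₀ (((continuous_lie continuous_const hX).const_smul _).add hF)
  have hd : ∀ u, HasDerivAt (fun u => evolve H₀ (-u) (duhamel H g F u))
      (evolve H₀ (-u) (Complex.I • ⁅H - H₀, duhamel H g F u⁆ + F u)) u := fun u => by
    refine (hasDerivAt_evolve_neg_comp H₀ (hasDerivAt_duhamel hF u)).congr_deriv ?_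
    congr 1
    simp only [Ring.lie_def, sub_mul, mul_sub, smul_sub]
    abel
  rw [intervalIntegral.integral_eq_sub_of_hasDerivAt (fun u _ => hd u)
    (hc.intervalIntegrable _ _)]
  simp [duhamel_zero, evolve_zero]

lemma norm_slope_le {E : Type*} [NormedAddCommGroup E] [NormedSpace ℝ E] {f f' : ℝ → E}
    {C : ℝ} (hf : ∀ s ∈ Set.Icc (0 : ℝ) 1, HasDerivWithinAt f (f' s) (Set.Icc 0 1) s)
    (hC : ∀ s ∈ Set.Icc (0 : ℝ) 1, ‖f' s‖ ≤ C) {s s₀ : ℝ} (hs : s ∈ Set.Icc (0 : ℝ) 1)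
    (hs₀ : s₀ ∈ Set.Icc (0 : ℝ) 1) : ‖slope f s₀ s‖ ≤ C := by
  have hC0 : 0 ≤ C := (norm_nonneg _).trans (hC s hs)
  have h := Convex.norm_image_sub_le_of_norm_hasDerivWithin_le hf hC (convex_Icc 0 1) hs₀ hs
  rw [slope_def_module, norm_smul, norm_inv]
  rcases eq_or_ne s s₀ with rfl | hne
  · simpa using hC0
  · rw [inv_mul_le_iff₀ (norm_pos_iff.2 (sub_ne_zero.2 hne)), mul_comm]
    exact h

lemma evolve_real_smul (H : 𝔸) (t c : ℝ) (A : 𝔸) : evolve H t (c • A) = c • evolve H t A := by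
  simp [evolve]

/-- The difference quotient of the solution with respect to the parameter, in the interaction
picture. -/
lemma evolve_neg_slope_duhamel {H g : ℝ → 𝔸} {F : ℝ → ℝ → 𝔸} {s s₀ : ℝ}
    (hF : Continuous (F s)) (hF₀ : Continuous (F s₀)) (t : ℝ) :
    evolve (H s₀) (-t) (slope (fun s => duhamel (H s) (g s) (F s) t) s₀ s) =
      slope g s₀ s + ∫ u in (0 : ℝ)..t, evolve (H s₀) (-u)
        (Complex.I • ⁅slope H s₀ s, duhamel (H s) (g s) (F s) u⁆ +
          slope (fun s => F s u) s₀ s) := by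
  have hX := continuous_duhamel (H := H s) (g := g s) hF
  have hc1 : Continuous fun u => evolve (H s₀) (-u)
      (Complex.I • ⁅H s - H s₀, duhamel (H s) (g s) (F s) u⁆ + F s u) :=
    continuous_evolve_neg _ (((continuous_lie continuous_const hX).const_smul _).add hF)
  have hc0 : Continuous fun u => evolve (H s₀) (-u) (F s₀ u) := continuous_evolve_neg _ hF₀
  have h1 := evolve_neg_duhamel (H := H s) (g := g s) (H s₀) hF t
  have h0 := evolve_neg_duhamel (H := H s₀) (g := g s₀) (H s₀) hF₀ t
  simp only [sub_self, Ring.lie_def, zero_mul, mul_zero, smul_zero, zero_add] at h0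
  simp only [slope_def_module]
  rw [evolve_real_smul, evolve_sub_right, h1, h0, add_sub_add_comm, smul_add,
    ← intervalIntegral.integral_sub (hc1.intervalIntegrable _ _) (hc0.intervalIntegrable _ _),
    ← intervalIntegral.integral_smul]
  congr 1
  refine intervalIntegral.integral_congr fun u _ => ?_
  simp only [← evolve_sub_right, ← evolve_real_smul]
  congr 1
  have h2 : Complex.I • ⁅(s - s₀)⁻¹ • (H s - H s₀), duhamel (H s) (g s) (F s) u⁆ =
      (s - s₀)⁻¹ • (Complex.I • ⁅H s - H s₀, duhamel (H s) (g s) (F s) u⁆) := by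
    rw [Ring.lie_def, Ring.lie_def, smul_mul_assoc, mul_smul_comm, ← smul_sub, smul_comm]
  rw [h2, add_sub_assoc, smul_add]

/-- Derivative of the solution of the inhomogeneous Heisenberg equation with respect to a parameter:
it solves the equation with the differentiated data and the additional source `i [H', X]`. -/
lemma hasDerivWithinAt_duhamel {H H' g g' : ℝ → 𝔸} {F F' : ℝ → ℝ → 𝔸}
    (hsa : ∀ s ∈ Set.Icc (0 : ℝ) 1, IsSelfAdjoint (H s))
    (hH : ∀ s ∈ Set.Icc (0 : ℝ) 1, HasDerivWithinAt H (H' s) (Set.Icc 0 1) s)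
    (hg : ∀ s ∈ Set.Icc (0 : ℝ) 1, HasDerivWithinAt g (g' s) (Set.Icc 0 1) s)
    (hF : ∀ s ∈ Set.Icc (0 : ℝ) 1, ∀ u,
      HasDerivWithinAt (fun s => F s u) (F' s u) (Set.Icc 0 1) s)
    (hFc : ∀ s ∈ Set.Icc (0 : ℝ) 1, Continuous (F s))
    (hH'b : ∃ C, ∀ s ∈ Set.Icc (0 : ℝ) 1, ‖H' s‖ ≤ C)
    (hg'b : ∃ C, ∀ s ∈ Set.Icc (0 : ℝ) 1, ‖g' s‖ ≤ C)
    (hF'b : ∀ T, ∃ C, ∀ s ∈ Set.Icc (0 : ℝ) 1, ∀ u, |u| ≤ T → ‖F' s u‖ ≤ C)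
    (hXb : ∀ T, ∃ C, ∀ s ∈ Set.Icc (0 : ℝ) 1, ∀ u, |u| ≤ T →
      ‖duhamel (H s) (g s) (F s) u‖ ≤ C)
    {s₀ : ℝ} (hs₀ : s₀ ∈ Set.Icc (0 : ℝ) 1) (t : ℝ) :
    HasDerivWithinAt (fun s => duhamel (H s) (g s) (F s) t)
      (duhamel (H s₀) (g' s₀)
        (fun u => F' s₀ u + Complex.I • ⁅H' s₀, duhamel (H s₀) (g s₀) (F s₀) u⁆) t)
      (Set.Icc 0 1) s₀ := by
  obtain ⟨CH, hCH⟩ := hH'b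
  obtain ⟨Cg, hCg⟩ := hg'b
  obtain ⟨CF, hCF⟩ := hF'b |t|
  obtain ⟨CX, hCX⟩ := hXb |t|
  have hCH0 : 0 ≤ CH := (norm_nonneg _).trans (hCH s₀ hs₀)
  have hsa₀ := hsa s₀ hs₀
  have hut : ∀ u ∈ Set.uIoc 0 t, |u| ≤ |t| := fun u hu => by
    have h := Set.abs_sub_left_of_mem_uIcc (Set.uIoc_subset_uIcc hu)
    simpa using h
  -- The integrand of the difference quotient is bounded.
  have hib : ∀ s ∈ Set.Icc (0 : ℝ) 1, ∀ u, |u| ≤ |t| → ‖evolve (H s₀) (-u)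
      (Complex.I • ⁅slope H s₀ s, duhamel (H s) (g s) (F s) u⁆ + slope (fun s => F s u) s₀ s)‖ ≤
      2 * CH * CX + CF := by
    intro s hs u hu
    rw [norm_evolve hsa₀]
    refine (norm_add_le _ _).trans (add_le_add ?_ ?_)
    · rw [norm_smul, Complex.norm_I, one_mul]
      refine (norm_lie_le _ _).trans ?_
      gcongr
      · exact norm_slope_le hH hCH hs hs₀
      · exact hCX s hs u hu
    · exact norm_slope_le (fun s hs => hF s hs u) (fun s hs => hCF s hs u hu) hs hs₀
  -- Hence the solution is Lipschitz in the parameter.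
  have hlip : ∀ u, |u| ≤ |t| → ∀ s ∈ Set.Icc (0 : ℝ) 1,
      ‖slope (fun s => duhamel (H s) (g s) (F s) u) s₀ s‖ ≤ Cg + (2 * CH * CX + CF) * |u| := by
    intro u hu s hs
    rw [← norm_evolve hsa₀ (-u), evolve_neg_slope_duhamel (hFc s hs) (hFc s₀ hs₀)]
    refine (norm_add_le _ _).trans (add_le_add (norm_slope_le hg hCg hs hs₀) ?_)
    have := intervalIntegral.norm_integral_le_of_norm_le_const (a := (0 : ℝ)) (b := u)
      fun w hw => hib s hs w ((by
        have h := Set.abs_sub_left_of_mem_uIcc (Set.uIoc_subset_uIcc hw)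
        simpa using h : |w| ≤ |u|).trans hu)
    simpa using this
  have hcont : ∀ u, |u| ≤ |t| → Tendsto (fun s => duhamel (H s) (g s) (F s) u)
      (𝓝[Set.Icc 0 1 \ {s₀}] s₀) (𝓝 (duhamel (H s₀) (g s₀) (F s₀) u)) := by
    intro u hu
    rw [tendsto_iff_norm_sub_tendsto_zero]
    have h1 : Tendsto (fun s : ℝ => |s - s₀| * (Cg + (2 * CH * CX + CF) * |u|))
        (𝓝[Set.Icc 0 1 \ {s₀}] s₀) (𝓝 0) := by
      have : Tendsto (fun s : ℝ => |s - s₀| * (Cg + (2 * CH * CX + CF) * |u|)) (𝓝 s₀)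
          (𝓝 (|s₀ - s₀| * (Cg + (2 * CH * CX + CF) * |u|))) :=
        Continuous.tendsto (by fun_prop) s₀
      simp only [sub_self, abs_zero, zero_mul] at this
      exact this.mono_left nhdsWithin_le_nhds
    refine squeeze_zero' (Eventually.of_forall fun s => norm_nonneg _) ?_ h1
    filter_upwards [self_mem_nhdsWithin] with s hs
    have h2 := hlip u hu s hs.1
    have hne : s - s₀ ≠ 0 := sub_ne_zero.2 fun h => hs.2 h
    rw [slope_def_module, norm_smul, norm_inv, Real.norm_eq_abs,
      inv_mul_le_iff₀ (abs_pos.2 hne)] at h2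
    exact h2
  rw [hasDerivWithinAt_iff_tendsto_slope]
  have hgt := hasDerivWithinAt_iff_tendsto_slope.1 (hg s₀ hs₀)
  have hHt := hasDerivWithinAt_iff_tendsto_slope.1 (hH s₀ hs₀)
  have hint : Tendsto (fun s => ∫ u in (0 : ℝ)..t, evolve (H s₀) (-u)
      (Complex.I • ⁅slope H s₀ s, duhamel (H s) (g s) (F s) u⁆ + slope (fun s => F s u) s₀ s))
      (𝓝[Set.Icc 0 1 \ {s₀}] s₀) (𝓝 (∫ u in (0 : ℝ)..t, evolve (H s₀) (-u)
        (F' s₀ u + Complex.I • ⁅H' s₀, duhamel (H s₀) (g s₀) (F s₀) u⁆))) := by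
    refine intervalIntegral.tendsto_integral_filter_of_dominated_convergence
      (fun _ => 2 * CH * CX + CF) ?_ ?_ intervalIntegrable_const ?_
    · filter_upwards [self_mem_nhdsWithin] with s hs
      have hX := continuous_duhamel (H := H s) (g := g s) (hFc s hs.1)
      refine Continuous.aestronglyMeasurable (continuous_evolve_neg _
        (((continuous_lie continuous_const hX).const_smul _).add ?_))
      simp only [slope_def_module]
      exact ((hFc s hs.1).sub (hFc s₀ hs₀)).const_smul _
    · filter_upwards [self_mem_nhdsWithin] with s hs
      exact Eventually.of_forall fun u hu => hib s hs.1 u (hut u hu)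
    · refine Eventually.of_forall fun u hu => ?_
      have hFt := hasDerivWithinAt_iff_tendsto_slope.1 (hF s₀ hs₀ u)
      have hXt := hcont u (hut u hu)
      have h1 : Tendsto (fun s => Complex.I • ⁅slope H s₀ s, duhamel (H s) (g s) (F s) u⁆ +
          slope (fun s => F s u) s₀ s) (𝓝[Set.Icc 0 1 \ {s₀}] s₀)
          (𝓝 (Complex.I • ⁅H' s₀, duhamel (H s₀) (g s₀) (F s₀) u⁆ + F' s₀ u)) := by
        simp only [Ring.lie_def]
        exact (((hHt.mul hXt).sub (hXt.mul hHt)).const_smul _).add hFt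
      rw [add_comm] at h1
      unfold evolve
      exact (h1.const_mul _).mul_const _
  have hlim := (((hgt.add hint).const_mul (propagator (H s₀) t)).mul_const
    (propagator (H s₀) (-t)))
  refine (hlim.congr' ?_)
  filter_upwards [self_mem_nhdsWithin] with s hs
  rw [← evolve_neg_slope_duhamel (hFc s hs.1) (hFc s₀ hs₀)]
  change evolve (H s₀) t _ = _
  rw [evolve_evolve, add_neg_cancel, evolve_zero]

end Duhamel

/-! ### Integration against the weight -/

section Weight

open Filter Topology MeasureTheory

lemma IsWeight.integrable_mul_pow {γ : ℝ} {W : ℝ → ℝ} (hW : IsWeight γ W) (m : ℕ) :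
    Integrable fun t => |W t| * (1 + |t|) ^ m := by
  obtain ⟨C, hC⟩ := hW.decay (m + 2)
  have hC0 : 0 ≤ C := le_trans (by positivity) (hC 2 (by norm_num))
  have hdom : Integrable fun t : ℝ => 2 ^ m * |W t| + 2 ^ (m + 1) * C * (1 + t ^ 2)⁻¹ :=
    (hW.integrable.abs.const_mul _).add (integrable_inv_one_add_sq.const_mul _)
  refine hdom.mono' ?_ (Eventually.of_forall fun t => ?_)
  · exact (hW.integrable.abs.aestronglyMeasurable).mul
      (Continuous.aestronglyMeasurable (by fun_prop))
  rw [Real.norm_of_nonneg (by positivity)]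
  rcases le_or_gt |t| 1 with h | h
  · have h1 : (1 + |t|) ^ m ≤ 2 ^ m := by gcongr; linarith
    have h2 : 0 ≤ 2 ^ (m + 1) * C * (1 + t ^ 2)⁻¹ := by positivity
    nlinarith [abs_nonneg (W t)]
  · have h1 : (1 + |t|) ^ m ≤ 2 ^ m * |t| ^ m := by
      rw [← mul_pow]; gcongr; linarith
    have h2 : |W t| * (1 + |t|) ^ m ≤ 2 ^ (m + 1) * C * (1 + t ^ 2)⁻¹ := by
      rw [← div_eq_mul_inv, le_div_iff₀ (by positivity)]
      have h3 : 1 + t ^ 2 ≤ 2 * |t| ^ 2 := by rw [sq_abs]; nlinarith [sq_abs t]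
      calc |W t| * (1 + |t|) ^ m * (1 + t ^ 2)
          ≤ |W t| * (2 ^ m * |t| ^ m) * (2 * |t| ^ 2) := by gcongr
        _ = 2 ^ (m + 1) * (|t| ^ (m + 2) * |W t|) := by ring
        _ ≤ _ := by gcongr; exact hC t h
    have : 0 ≤ 2 ^ m * |W t| := by positivity
    linarith

variable {E : Type*} [CStarAlgebra E]

lemma IsWeight.integrable_smul {γ : ℝ} {W : ℝ → ℝ} (hW : IsWeight γ W) {f : ℝ → E}
    (hf : Continuous f) {C : ℝ} {m : ℕ} (hC : ∀ t, ‖f t‖ ≤ C * (1 + |t|) ^ m) :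
    Integrable fun t => (W t : ℂ) • f t := by
  refine ((hW.integrable_mul_pow m).const_mul C).mono' ?_ (Eventually.of_forall fun t => ?_)
  · exact (Complex.continuous_ofReal.comp_aestronglyMeasurable
      hW.integrable.aestronglyMeasurable).smul hf.aestronglyMeasurable
  · rw [norm_smul, Complex.norm_real, Real.norm_eq_abs]
    calc |W t| * ‖f t‖ ≤ |W t| * (C * (1 + |t|) ^ m) := by gcongr; exact hC t
      _ = _ := by ring

/-- Differentiation under the integral against the weight, one-sided at the end points. -/
lemma IsWeight.hasDerivWithinAt_integral {γ : ℝ} {W : ℝ → ℝ} (hW : IsWeight γ W)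
    {f f' : ℝ → ℝ → E} {C C' : ℝ} {m m' : ℕ}
    (hfc : ∀ s ∈ Set.Icc (0 : ℝ) 1, Continuous (f s))
    (hf : ∀ s ∈ Set.Icc (0 : ℝ) 1, ∀ t,
      HasDerivWithinAt (fun s => f s t) (f' s t) (Set.Icc 0 1) s)
    (hC : ∀ s ∈ Set.Icc (0 : ℝ) 1, ∀ t, ‖f s t‖ ≤ C * (1 + |t|) ^ m)
    (hC' : ∀ s ∈ Set.Icc (0 : ℝ) 1, ∀ t, ‖f' s t‖ ≤ C' * (1 + |t|) ^ m')
    {s₀ : ℝ} (hs₀ : s₀ ∈ Set.Icc (0 : ℝ) 1) :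
    HasDerivWithinAt (fun s => ∫ t, (W t : ℂ) • f s t) (∫ t, (W t : ℂ) • f' s₀ t)
      (Set.Icc 0 1) s₀ := by
  rw [hasDerivWithinAt_iff_tendsto_slope]
  have hlim : Tendsto (fun s => ∫ t, (W t : ℂ) • slope (fun s => f s t) s₀ s)
      (𝓝[Set.Icc 0 1 \ {s₀}] s₀) (𝓝 (∫ t, (W t : ℂ) • f' s₀ t)) := by
    refine tendsto_integral_filter_of_dominated_convergence
      (fun t => C' * (|W t| * (1 + |t|) ^ m')) ?_ ?_
      ((hW.integrable_mul_pow m').const_mul C') ?_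
    · filter_upwards [self_mem_nhdsWithin] with s hs
      refine (Complex.continuous_ofReal.comp_aestronglyMeasurable
        hW.integrable.aestronglyMeasurable).smul (Continuous.aestronglyMeasurable ?_)
      simp only [slope_def_module]
      exact ((hfc s hs.1).sub (hfc s₀ hs₀)).const_smul _
    · filter_upwards [self_mem_nhdsWithin] with s hs
      refine Eventually.of_forall fun t => ?_
      rw [norm_smul, Complex.norm_real, Real.norm_eq_abs]
      calc |W t| * ‖slope (fun s => f s t) s₀ s‖ ≤ |W t| * (C' * (1 + |t|) ^ m') := by
            gcongr
            exact norm_slope_le (fun s hs => hf s hs t) (fun s hs => hC' s hs t) hs.1 hs₀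
        _ = _ := by ring
    · exact Eventually.of_forall fun t =>
        (hasDerivWithinAt_iff_tendsto_slope.1 (hf s₀ hs₀ t)).const_smul _
  refine hlim.congr' ?_
  filter_upwards [self_mem_nhdsWithin] with s hs
  simp only [slope_def_module]
  rw [← integral_sub (hW.integrable_smul (hfc s hs.1) (hC s hs.1))
    (hW.integrable_smul (hfc s₀ hs₀) (hC s₀ hs₀)), ← integral_smul]
  refine integral_congr_ae (Eventually.of_forall fun t => ?_)
  simp only [smul_sub, smul_comm ((s - s₀)⁻¹) ((W t : ℂ))]

end Weight

/-! ### Operations on sums of localized operators -/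

section Closure

variable {Γ : Type*} [DecidableEq Γ] {q : Γ → ℕ} {gr : SimpleGraph Γ} {d : ℕ}
  [∀ x, NeZero (q x)] {T T₁ T₂ : (Λ : Finset Γ) → ℝ → ℝ → Obs q Λ}

lemma isSelfAdjoint_I_smul_lie {𝔸 : Type*} [CStarAlgebra 𝔸] {A B : 𝔸} (hA : IsSelfAdjoint A)
    (hB : IsSelfAdjoint B) : IsSelfAdjoint (Complex.I • ⁅A, B⁆) := by
  rw [IsSelfAdjoint, star_smul, Ring.lie_def, star_sub, star_mul, star_mul, hA.star_eq, hB.star_eq,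
    Complex.star_def, Complex.conj_I, neg_smul, ← smul_neg, neg_sub]

lemma continuous_I_smul_lie {𝔸 : Type*} [CStarAlgebra 𝔸] {f₁ f₂ : ℝ → 𝔸} (h₁ : Continuous f₁)
    (h₂ : Continuous f₂) : Continuous fun t => Complex.I • ⁅f₁ t, f₂ t⁆ :=
  (continuous_lie h₁ h₂).const_smul Complex.I

lemma lie_sum_sum {𝔸 : Type*} [Ring 𝔸] {ι κ : Type*} (s : Finset ι) (t : Finset κ) (f : ι → 𝔸)
    (g : κ → 𝔸) : ⁅∑ i ∈ s, f i, ∑ j ∈ t, g j⁆ = ∑ j ∈ t, ∑ i ∈ s, ⁅f i, g j⁆ := by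
  simp only [Ring.lie_def, Finset.sum_sub_distrib, Finset.sum_mul_sum]
  rw [Finset.sum_comm]

namespace IsAnchored

lemma exists_norm_le (hT : IsAnchored gr T) (Λ : Finset Γ) : ∃ (C : ℝ) (m : ℕ), 0 ≤ C ∧
    ∀ s ∈ Set.Icc (0 : ℝ) 1, ∀ t, ‖T Λ s t‖ ≤ C * (1 + |t|) ^ m := by
  obtain ⟨g, hg⟩ := hT
  obtain ⟨C, m, hC, h⟩ := hg.localized 0
  refine ⟨Λ.card * C, m, by positivity, fun s hs t => ?_⟩
  rw [hg.eq_sum Λ s hs t]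
  refine (norm_sum_le_of_le _ fun x hx => (h Λ s hs t x hx).norm_le).trans (le_of_eq ?_)
  rw [Finset.sum_const, nsmul_eq_mul, mul_assoc]

lemma continuous (hT : IsAnchored gr T) (Λ : Finset Γ) {s : ℝ} (hs : s ∈ Set.Icc (0 : ℝ) 1) :
    Continuous (T Λ s) := by
  obtain ⟨g, hg⟩ := hT
  rw [funext (hg.eq_sum Λ s hs)]
  exact continuous_finsetSum _ fun x hx => hg.continuous Λ s hs x hx

lemma freeze (hT : IsAnchored gr T) : IsAnchored gr fun Λ s _ => T Λ s 0 := by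
  obtain ⟨g, hg⟩ := hT
  refine ⟨fun Λ s _ x => g Λ s 0 x, fun Λ s hs t => hg.eq_sum Λ s hs 0,
    fun Λ s hs t x hx => hg.selfAdjoint Λ s hs 0 x hx, fun Λ s hs x hx => continuous_const,
    fun n => ?_⟩
  obtain ⟨C, m, hC, h⟩ := hg.localized n
  refine ⟨C, 0, hC, fun Λ s hs t x hx => ?_⟩
  simpa using h Λ s hs 0 x hx

lemma zero : IsAnchored (q := q) gr fun _ _ _ => 0 :=
  ⟨fun _ _ _ _ => 0, fun Λ s hs t => by simp, fun Λ s hs t x hx => .zero _,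
    fun Λ s hs x hx => continuous_const, fun n => ⟨0, 0, le_rfl, fun Λ s hs t x hx =>
      ⟨by simp, fun r => by simp⟩⟩⟩

lemma add (h₁ : IsAnchored gr T₁) (h₂ : IsAnchored gr T₂) :
    IsAnchored gr fun Λ s t => T₁ Λ s t + T₂ Λ s t := by
  obtain ⟨g₁, hg₁⟩ := h₁
  obtain ⟨g₂, hg₂⟩ := h₂
  refine ⟨fun Λ s t x => g₁ Λ s t x + g₂ Λ s t x, fun Λ s hs t => ?_,
    fun Λ s hs t x hx => (hg₁.selfAdjoint Λ s hs t x hx).add (hg₂.selfAdjoint Λ s hs t x hx),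
    fun Λ s hs x hx => (hg₁.continuous Λ s hs x hx).add (hg₂.continuous Λ s hs x hx),
    fun n => ?_⟩
  · rw [hg₁.eq_sum Λ s hs t, hg₂.eq_sum Λ s hs t, Finset.sum_add_distrib]
  · obtain ⟨C₁, m₁, hC₁, h₁⟩ := hg₁.localized n
    obtain ⟨C₂, m₂, hC₂, h₂⟩ := hg₂.localized n
    refine ⟨C₁ + C₂, m₁ + m₂, by positivity, fun Λ s hs t x hx =>
      ((h₁ Λ s hs t x hx).add (h₂ Λ s hs t x hx)).mono ?_⟩
    have ht : 1 ≤ 1 + |t| := by linarith [abs_nonneg t]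
    rw [add_mul]
    gcongr
    · omega
    · omega

lemma lie (hconn : gr.Connected) (hd : HasDimension gr d) (h₁ : IsAnchored gr T₁)
    (h₂ : IsAnchored gr T₂) :
    IsAnchored gr fun Λ s t => Complex.I • ⁅T₁ Λ s t, T₂ Λ s t⁆ := by
  obtain ⟨g₁, hg₁⟩ := h₁
  obtain ⟨g₂, hg₂⟩ := h₂
  refine ⟨fun Λ s t x => ∑ y ∈ Λ, Complex.I • ⁅g₁ Λ s t y, g₂ Λ s t x⁆, fun Λ s hs t => ?_,
    fun Λ s hs t x hx => isSelfAdjoint_sum _ fun y hy => isSelfAdjoint_I_smul_lie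
      (hg₁.selfAdjoint Λ s hs t y hy) (hg₂.selfAdjoint Λ s hs t x hx),
    fun Λ s hs x hx => continuous_finsetSum _ fun y hy =>
      continuous_I_smul_lie (hg₁.continuous Λ s hs y hy) (hg₂.continuous Λ s hs x hx),
    fun n => ?_⟩
  · rw [hg₁.eq_sum Λ s hs t, hg₂.eq_sum Λ s hs t, lie_sum_sum, Finset.smul_sum]
    simp only [Finset.smul_sum]
  · obtain ⟨C₁, m₁, hC₁, h₁⟩ := hg₁.localized (n + (d + 2))
    obtain ⟨C₂, m₂, hC₂, h₂⟩ := hg₂.localized (n + (d + 2))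
    obtain ⟨K, hK, h⟩ := exists_isLocalized_sum_lie (q := q) hconn hd n
    refine ⟨K * C₁ * C₂, m₁ + m₂, by positivity, fun Λ s hs t x hx => ?_⟩
    have := (h Λ x _ _ _ _ (by positivity) (fun y hy => h₁ Λ s hs t y hy)
      (h₂ Λ s hs t x hx)).smul Complex.I
    rw [Finset.smul_sum] at this
    refine this.mono (le_of_eq ?_)
    rw [Complex.norm_I, pow_add]
    ring

/-- Solutions of the inhomogeneous Heisenberg equation with localized data. -/
lemma duhamel {H : Family q} (hH : HasLightCone gr H)
    (hsa : ∀ Λ, ∀ s ∈ Set.Icc (0 : ℝ) 1, IsSelfAdjoint (H Λ s)) (h₁ : IsAnchored gr T₁)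
    (h₂ : IsAnchored gr T₂) :
    IsAnchored gr fun Λ s t => duhamel (H Λ s) (T₁ Λ s 0) (T₂ Λ s) t := by
  obtain ⟨g₁, hg₁⟩ := h₁
  obtain ⟨g₂, hg₂⟩ := h₂
  have hint : ∀ Λ, ∀ s ∈ Set.Icc (0 : ℝ) 1, ∀ x ∈ Λ,
      Continuous fun u => evolve (H Λ s) (-u) (g₂ Λ s u x) := fun Λ s hs x hx =>
    continuous_evolve_neg _ (hg₂.continuous Λ s hs x hx)
  refine ⟨fun Λ s t x => SpinSystem.duhamel (H Λ s) (g₁ Λ s 0 x) (fun u => g₂ Λ s u x) t,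
    fun Λ s hs t => ?_, fun Λ s hs t x hx => ?_, fun Λ s hs x hx =>
      continuous_duhamel (hg₂.continuous Λ s hs x hx), fun n => ?_⟩
  · simp only [SpinSystem.duhamel]
    have h1 := intervalIntegral.integral_finsetSum (μ := MeasureTheory.volume) (s := Λ)
      (f := fun x u => evolve (H Λ s) (-u) (g₂ Λ s u x)) (a := 0) (b := t)
      fun x hx => (hint Λ s hs x hx).intervalIntegrable _ _
    rw [← evolve_sum, Finset.sum_add_distrib, ← h1, hg₁.eq_sum Λ s hs 0]
    simp only [← evolve_sum, ← hg₂.eq_sum Λ s hs]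
  · refine isSelfAdjoint_evolve (hsa Λ s hs) ((hg₁.selfAdjoint Λ s hs 0 x hx).add ?_) t
    have h1 : ∀ u, IsSelfAdjoint (evolve (H Λ s) (-u) (g₂ Λ s u x)) := fun u =>
      isSelfAdjoint_evolve (hsa Λ s hs) (hg₂.selfAdjoint Λ s hs u x hx) _
    have hi : IntervalIntegrable (fun u => evolve (H Λ s) (-u) (g₂ Λ s u x))
        MeasureTheory.volume 0 t := (hint Λ s hs x hx).intervalIntegrable 0 t
    have h2 := ContinuousLinearMap.intervalIntegral_comp_comm
      (starL' ℝ : Obs q Λ ≃L[ℝ] Obs q Λ).toContinuousLinearMap hi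
    simp only [ContinuousLinearEquiv.coe_coe, starL'_apply, (h1 _).star_eq] at h2
    exact h2.symm
  · obtain ⟨C₁, m₁, hC₁, h₁⟩ := hg₁.localized n
    obtain ⟨C₂, m₂, hC₂, h₂⟩ := hg₂.localized n
    obtain ⟨K, hK, h⟩ := hH n
    refine ⟨K * (C₁ + K * C₂), n + (m₂ + n + 1), by positivity, fun Λ s hs t x hx => ?_⟩
    have ht : 1 ≤ 1 + |t| := by linarith [abs_nonneg t]
    have e1 : IsLocalized gr n x C₁ (g₁ Λ s 0 x) := by simpa using h₁ Λ s hs 0 x hx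
    have e2 : ∀ u ∈ Set.uIoc (0 : ℝ) t, IsLocalized gr n x (K * C₂ * (1 + |t|) ^ (m₂ + n))
        (evolve (H Λ s) (-u) (g₂ Λ s u x)) := fun u hu => by
      have hu' : |u| ≤ |t| := by
        simpa using Set.abs_sub_left_of_mem_uIcc (Set.uIoc_subset_uIcc hu)
      refine (h Λ s hs x hx (-u) _ _ (h₂ Λ s hs u x hx)).mono ?_
      rw [abs_neg, pow_add, ← mul_assoc, ← mul_assoc]
      gcongr
    have e3 := IsLocalized.intervalIntegral (hint Λ s hs x hx) e2
    refine (h Λ s hs x hx t _ _ (e1.add e3)).mono ?_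
    have e4 : C₁ + K * C₂ * (1 + |t|) ^ (m₂ + n) * |t| ≤
        (C₁ + K * C₂) * (1 + |t|) ^ (m₂ + n + 1) := by
      rw [add_mul, pow_succ _ (m₂ + n), ← mul_assoc (K * C₂)]
      refine add_le_add (le_mul_of_one_le_right hC₁ ?_) ?_
      · rw [← pow_succ]
        exact one_le_pow₀ ht
      · gcongr
        linarith
    calc K * (C₁ + K * C₂ * (1 + |t|) ^ (m₂ + n) * |t|) * (1 + |t|) ^ n
        ≤ K * ((C₁ + K * C₂) * (1 + |t|) ^ (m₂ + n + 1)) * (1 + |t|) ^ n := by gcongr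
      _ = K * (C₁ + K * C₂) * (1 + |t|) ^ (n + (m₂ + n + 1)) := by rw [pow_add _ n]; ring

lemma integral {γ : ℝ} {W : ℝ → ℝ} (hW : IsWeight γ W) (hT : IsAnchored gr T) :
    IsAnchored gr fun Λ s _ => ∫ t, (W t : ℂ) • T Λ s t := by
  obtain ⟨g, hg⟩ := hT
  have hint : ∀ Λ, ∀ s ∈ Set.Icc (0 : ℝ) 1, ∀ x ∈ Λ,
      MeasureTheory.Integrable fun t => (W t : ℂ) • g Λ s t x := fun Λ s hs x hx => by
    obtain ⟨C, m, hC, h⟩ := hg.localized 0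
    exact hW.integrable_smul (hg.continuous Λ s hs x hx) fun t => (h Λ s hs t x hx).norm_le
  refine ⟨fun Λ s _ x => ∫ t, (W t : ℂ) • g Λ s t x, fun Λ s hs _ => ?_,
    fun Λ s hs _ x hx => ?_, fun Λ s hs x hx => continuous_const, fun n => ?_⟩
  · rw [← MeasureTheory.integral_finsetSum _ fun x hx => hint Λ s hs x hx]
    simp only [hg.eq_sum Λ s hs, Finset.smul_sum]
  · have h1 : ∀ t, IsSelfAdjoint ((W t : ℂ) • g Λ s t x) := fun t =>
      IsSelfAdjoint.smul (Complex.conj_ofReal _) (hg.selfAdjoint Λ s hs t x hx)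
    have h2 := ContinuousLinearMap.integral_comp_comm
      (starL' ℝ : Obs q Λ ≃L[ℝ] Obs q Λ).toContinuousLinearMap (hint Λ s hs x hx)
    simp only [ContinuousLinearEquiv.coe_coe, starL'_apply, (h1 _).star_eq] at h2
    exact h2.symm
  · obtain ⟨C, m, hC, h⟩ := hg.localized n
    refine ⟨∫ t, C * (|W t| * (1 + |t|) ^ m), 0, MeasureTheory.integral_nonneg fun t => by
      positivity, fun Λ s hs _ x hx => ?_⟩
    rw [pow_zero, mul_one]
    refine IsLocalized.integral (hint Λ s hs x hx) ((hW.integrable_mul_pow m).const_mul C)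
      fun t => ((h Λ s hs t x hx).smul (W t : ℂ)).mono (le_of_eq ?_)
    rw [Complex.norm_real, Real.norm_eq_abs]
    ring

end IsAnchored

/-- Sums of localized operators that are `k` times differentiable in `s ∈ [0,1]`, with derivatives
that are again sums of localized operators. -/
def IsSmoothAnchored (gr : SimpleGraph Γ) :
    ℕ → ((Λ : Finset Γ) → ℝ → ℝ → Obs q Λ) → Prop
  | 0, T => IsAnchored gr T
  | k + 1, T => IsAnchored gr T ∧ ∃ T' : (Λ : Finset Γ) → ℝ → ℝ → Obs q Λ,
      (∀ Λ, ∀ s ∈ Set.Icc (0 : ℝ) 1, ∀ t,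
        HasDerivWithinAt (fun s => T Λ s t) (T' Λ s t) (Set.Icc 0 1) s) ∧
      IsSmoothAnchored gr k T'

namespace IsSmoothAnchored

variable {k : ℕ}

lemma isAnchored (h : IsSmoothAnchored gr k T) : IsAnchored gr T := by
  cases k with
  | zero => exact h
  | succ k => exact h.1

lemma pred (h : IsSmoothAnchored gr (k + 1) T) : IsSmoothAnchored gr k T := by
  induction k generalizing T with
  | zero => exact h.1
  | succ k ih =>
    obtain ⟨h0, T', hT', h1⟩ := h
    exact ⟨h0, T', hT', ih h1⟩

lemma freeze (h : IsSmoothAnchored gr k T) :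
    IsSmoothAnchored gr k fun Λ s _ => T Λ s 0 := by
  induction k generalizing T with
  | zero => exact IsAnchored.freeze h
  | succ k ih =>
    obtain ⟨h0, T', hT', h1⟩ := h
    exact ⟨h0.freeze, fun Λ s _ => T' Λ s 0, fun Λ s hs _ => hT' Λ s hs 0, ih h1⟩

lemma zero (k : ℕ) : IsSmoothAnchored (q := q) gr k fun _ _ _ => 0 := by
  induction k with
  | zero => exact IsAnchored.zero
  | succ k ih =>
    exact ⟨IsAnchored.zero, fun _ _ _ => 0, fun Λ s _ _ => hasDerivWithinAt_const _ _ _, ih⟩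

lemma add (h₁ : IsSmoothAnchored gr k T₁) (h₂ : IsSmoothAnchored gr k T₂) :
    IsSmoothAnchored gr k fun Λ s t => T₁ Λ s t + T₂ Λ s t := by
  induction k generalizing T₁ T₂ with
  | zero => exact IsAnchored.add h₁ h₂
  | succ k ih =>
    obtain ⟨a₁, T₁', hT₁, b₁⟩ := h₁
    obtain ⟨a₂, T₂', hT₂, b₂⟩ := h₂
    exact ⟨a₁.add a₂, _, fun Λ s hs t => (hT₁ Λ s hs t).add (hT₂ Λ s hs t), ih b₁ b₂⟩

lemma lie (hconn : gr.Connected) (hd : HasDimension gr d) (h₁ : IsSmoothAnchored gr k T₁)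
    (h₂ : IsSmoothAnchored gr k T₂) :
    IsSmoothAnchored gr k fun Λ s t => Complex.I • ⁅T₁ Λ s t, T₂ Λ s t⁆ := by
  induction k generalizing T₁ T₂ with
  | zero => exact IsAnchored.lie hconn hd h₁ h₂
  | succ k ih =>
    have p₁ := h₁.pred
    have p₂ := h₂.pred
    obtain ⟨a₁, T₁', hT₁, b₁⟩ := h₁
    obtain ⟨a₂, T₂', hT₂, b₂⟩ := h₂
    refine ⟨a₁.lie hconn hd a₂, _, fun Λ s hs t => ?_, (ih b₁ p₂).add (ih p₁ b₂)⟩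
    have h := ((hT₁ Λ s hs t).mul (hT₂ Λ s hs t)).sub ((hT₂ Λ s hs t).mul (hT₁ Λ s hs t))
    simp only [Ring.lie_def]
    refine (h.const_smul Complex.I).congr_deriv ?_
    rw [← smul_add]
    congr 1
    abel

/-- The derivative of a solution of the inhomogeneous Heisenberg equation with respect to `s` is
again such a solution, so induction on the number of derivatives applies. -/
lemma duhamel (hconn : gr.Connected) (hd : HasDimension gr d) {H : Family q}
    (hH : HasLightCone gr H) (hsa : ∀ Λ, ∀ s ∈ Set.Icc (0 : ℝ) 1, IsSelfAdjoint (H Λ s))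
    (hHk : IsSmoothAnchored gr k fun Λ s _ => H Λ s) (h₁ : IsSmoothAnchored gr k T₁)
    (h₂ : IsSmoothAnchored gr k T₂) :
    IsSmoothAnchored gr k fun Λ s t => duhamel (H Λ s) (T₁ Λ s 0) (T₂ Λ s) t := by
  induction k generalizing T₁ T₂ with
  | zero => exact IsAnchored.duhamel hH hsa h₁ h₂
  | succ k ih =>
    have hX := ih hHk.pred h₁.pred h₂.pred
    have hpred := hHk.pred
    obtain ⟨aH, H', hH', bH⟩ := hHk
    obtain ⟨a₁, T₁', hT₁, b₁⟩ := h₁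
    obtain ⟨a₂, T₂', hT₂, b₂⟩ := h₂
    refine ⟨a₁.duhamel hH hsa a₂, _, fun Λ s hs t => ?_,
      ih hpred b₁ (b₂.add (bH.freeze.lie hconn hd hX))⟩
    have hbound : ∀ {T : (Λ : Finset Γ) → ℝ → ℝ → Obs q Λ}, IsAnchored gr T →
        ∀ S, ∃ C, ∀ s ∈ Set.Icc (0 : ℝ) 1, ∀ u, |u| ≤ S → ‖T Λ s u‖ ≤ C := by
      intro T hT S
      obtain ⟨C, m, hC, h⟩ := hT.exists_norm_le Λ
      refine ⟨C * (1 + S) ^ m, fun s hs u hu => (h s hs u).trans ?_⟩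
      gcongr
    have hbound0 : ∀ {T : (Λ : Finset Γ) → ℝ → ℝ → Obs q Λ}, IsAnchored gr T →
        ∃ C, ∀ s ∈ Set.Icc (0 : ℝ) 1, ‖T Λ s 0‖ ≤ C := by
      intro T hT
      obtain ⟨C, h⟩ := hbound hT 0
      exact ⟨C, fun s hs => h s hs 0 (by simp)⟩
    have hXb := hbound hX.isAnchored
    exact hasDerivWithinAt_duhamel (H := H Λ) (H' := fun s => H' Λ s 0) (g := fun s => T₁ Λ s 0)
      (g' := fun s => T₁' Λ s 0) (F := T₂ Λ) (F' := T₂' Λ) (hsa Λ) (fun s hs => hH' Λ s hs 0)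
      (fun s hs => hT₁ Λ s hs 0) (hT₂ Λ) (fun s hs => a₂.continuous Λ hs)
      (hbound0 bH.isAnchored) (hbound0 b₁.isAnchored) (hbound b₂.isAnchored)
      hXb hs t

lemma integral {γ : ℝ} {W : ℝ → ℝ} (hW : IsWeight γ W) (hT : IsSmoothAnchored gr k T) :
    IsSmoothAnchored gr k fun Λ s _ => ∫ t, (W t : ℂ) • T Λ s t := by
  induction k generalizing T with
  | zero => exact IsAnchored.integral hW hT
  | succ k ih =>
    obtain ⟨a, T', hT', b⟩ := hT
    refine ⟨a.integral hW, _, fun Λ s hs _ => ?_, ih b⟩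
    obtain ⟨C, m, -, hC⟩ := a.exists_norm_le Λ
    obtain ⟨C', m', -, hC'⟩ := b.isAnchored.exists_norm_le Λ
    have h1 : ∀ s ∈ Set.Icc (0:ℝ) 1, Continuous (T Λ s) := fun s hs => a.continuous Λ hs
    have h := hW.hasDerivWithinAt_integral (E := Obs q Λ) (f := T Λ) (f' := T' Λ)
      h1 (hT' Λ) hC hC' hs
    exact h

end IsSmoothAnchored

/-! ### Time derivatives of families of operators -/

omit [∀ x, NeZero (q x)] in
lemma hasDerivWithinAt_timeDeriv {k j : ℕ} {G : Family q} (hG : IsTimesDiff k G) (hj : j < k)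
    (Λ : Finset Γ) {s : ℝ} (hs : s ∈ Set.Icc (0 : ℝ) 1) :
    HasDerivWithinAt (timeDeriv j G Λ) (timeDeriv (j + 1) G Λ s) (Set.Icc 0 1) s := by
  have h := (hG Λ j hj s hs).hasDerivWithinAt
  have h2 : timeDeriv (j + 1) G Λ s = derivWithin (timeDeriv j G Λ) (Set.Icc 0 1) s := by
    simp only [timeDeriv]
    rw [iteratedDerivWithin_succ]
    rfl
  rwa [h2]

lemma hasDerivWithinAt_condExp {Λ X : Finset Γ} {f : ℝ → Obs q Λ} {f' : Obs q Λ} {s : ℝ}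
    {I : Set ℝ} (hf : HasDerivWithinAt f f' I s) :
    HasDerivWithinAt (fun s => condExp X (f s)) (condExp X f') I s :=
  ((condExp X).restrictScalars ℝ).hasFDerivAt.comp_hasDerivWithinAt s hf

lemma isSmoothAnchored_of_timeDeriv (hd : HasDimension gr d) {k : ℕ} {G : Family q}
    (hG : IsTimesDiff k G) (hGk : ∀ j ≤ k, timeDeriv j G ∈ classLS gr d) {j i : ℕ}
    (hij : j + i = k) : IsSmoothAnchored gr i
      fun Λ s _ => timeDeriv j G Λ s - condExp ∅ (timeDeriv j G Λ s) := by
  induction i generalizing j with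
  | zero => exact isAnchored_of_mem_classLS hd (hGk j (by omega))
  | succ i ih =>
    refine ⟨isAnchored_of_mem_classLS hd (hGk j (by omega)), _, fun Λ s hs _ => ?_,
      ih (j := j + 1) (by omega)⟩
    have h := hasDerivWithinAt_timeDeriv hG (by omega : j < k) Λ hs
    exact h.sub (hasDerivWithinAt_condExp h)

omit [∀ x, NeZero (q x)] in
lemma timeDeriv_zero (G : Family q) : timeDeriv 0 G = G := by
  funext Λ s
  simp [timeDeriv]

lemma isSelfAdjoint_of_isLocalHamiltonian {G : Family q} (hG : IsLocalHamiltonian G)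
    (Λ : Finset Γ) {s : ℝ} (hs : s ∈ Set.Icc (0 : ℝ) 1) : IsSelfAdjoint (G Λ s) := by
  obtain ⟨Φ, h⟩ := hG
  rw [h Λ s hs, Interaction.hamiltonian_eq]
  exact isSelfAdjoint_sum _ fun Z _ => (Φ s).isSelfAdjoint_localTerm Z

lemma isSelfAdjoint_of_mem_classLS {G : Family q} (hG : G ∈ classLS gr d) (Λ : Finset Γ) {s : ℝ}
    (hs : s ∈ Set.Icc (0 : ℝ) 1) : IsSelfAdjoint (G Λ s) :=
  isSelfAdjoint_of_isLocalHamiltonian (hG.imp fun _ h => h.2) Λ hs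

/-- If `F = T + c tr(G)` with smooth `T`, then the time derivatives of `F` exist and belong to
`𝓛_{𝓢,∞}`. -/
lemma timeDeriv_mem_classLS (hconn : gr.Connected) (hd : HasDimension gr d) {k : ℕ} {F G : Family q}
    (hG : IsTimesDiff k G) (hGk : ∀ j ≤ k, timeDeriv j G ∈ classLS gr d) (c : ℝ) {i j : ℕ}
    (hij : j + i = k) (hT : IsSmoothAnchored gr i T)
    (hF : ∀ Λ, ∀ s ∈ Set.Icc (0 : ℝ) 1,
      timeDeriv j F Λ s = T Λ s 0 + (c : ℂ) • condExp ∅ (timeDeriv j G Λ s)) :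
    (∀ l, j ≤ l → l < k → ∀ Λ, DifferentiableOn ℝ (timeDeriv l F Λ) (Set.Icc 0 1)) ∧
      ∀ l, j ≤ l → l ≤ k → timeDeriv l F ∈ classLS gr d := by
  induction i generalizing j T with
  | zero =>
    refine ⟨fun l h1 h2 => by omega, fun l h1 h2 => ?_⟩
    obtain rfl : l = j := by omega
    exact mem_classLS_of_isAnchored hconn hd hT.isAnchored
      (fun Λ s hs => (isSupported_condExp _).smul _)
      (fun Λ s hs => IsSelfAdjoint.smul (Complex.conj_ofReal _)
        (isSelfAdjoint_condExp (isSelfAdjoint_of_mem_classLS (hGk _ (by omega)) Λ hs))) hF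
  | succ i ih =>
    have hmem : timeDeriv j F ∈ classLS gr d :=
      mem_classLS_of_isAnchored hconn hd hT.isAnchored
        (fun Λ s hs => (isSupported_condExp _).smul _)
        (fun Λ s hs => IsSelfAdjoint.smul (Complex.conj_ofReal _)
          (isSelfAdjoint_condExp (isSelfAdjoint_of_mem_classLS (hGk _ (by omega)) Λ hs))) hF
    obtain ⟨a, T', hT', b⟩ := hT
    have hder : ∀ Λ, ∀ s ∈ Set.Icc (0 : ℝ) 1, HasDerivWithinAt (timeDeriv j F Λ)
        (T' Λ s 0 + (c : ℂ) • condExp ∅ (timeDeriv (j + 1) G Λ s)) (Set.Icc 0 1) s := by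
      intro Λ s hs
      refine HasDerivWithinAt.congr_of_mem ?_ (hF Λ) hs
      exact (hT' Λ s hs 0).add ((hasDerivWithinAt_condExp
        (hasDerivWithinAt_timeDeriv hG (by omega) Λ hs)).const_smul (c : ℂ))
    obtain ⟨h1, h2⟩ := ih (j := j + 1) (by omega) b fun Λ s hs => by
      rw [← (hder Λ s hs).derivWithin (uniqueDiffOn_Icc_zero_one s hs)]
      simp only [timeDeriv]
      rw [iteratedDerivWithin_succ]
      rfl
    refine ⟨fun l hl hlk => ?_, fun l hl hlk => ?_⟩
    · rcases hl.eq_or_lt with rfl | hl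
      · exact fun Λ s hs => (hder Λ s hs).differentiableWithinAt
      · exact h1 l hl hlk
    · rcases hl.eq_or_lt with rfl | hl
      · exact hmem
      · exact h2 l hl hlk

lemma condExp_empty_eq_smul_one {Λ : Finset Γ} (A : Obs q Λ) :
    ∃ c : ℂ, condExp ∅ A = c • 1 :=
  ⟨_, (isSupported_condExp A).eq_smul_one⟩

lemma evolve_sub_condExp {Λ : Finset Γ} (H : Obs q Λ) (t : ℝ) (A : Obs q Λ) :
    evolve (H - condExp ∅ H) t A = evolve H t A := by
  obtain ⟨c, hc⟩ := condExp_empty_eq_smul_one H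
  rw [hc, sub_eq_add_neg, ← neg_smul, evolve_add_smul_one]

/-- The map `𝓘` preserves differentiability in `s` with derivatives in `𝓛_{𝓢,∞}`. -/
theorem timeDeriv_mapIFamily_mem_classLS (hconn : gr.Connected) (hd : HasDimension gr d)
    {γ : ℝ} {W : ℝ → ℝ} (hW : IsWeight γ W) {k : ℕ} {H G : Family q}
    (hH : IsTimesDiff k H) (hG : IsTimesDiff k G)
    (hHk : ∀ j ≤ k, timeDeriv j H ∈ classLE gr d)
    (hGk : ∀ j ≤ k, timeDeriv j G ∈ classLS gr d) :
    IsTimesDiff k (mapIFamily W H G) ∧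
      ∀ j ≤ k, timeDeriv j (mapIFamily W H G) ∈ classLS gr d := by
  set H₀ : Family q := fun Λ s => H Λ s - condExp ∅ (H Λ s) with hH₀
  set G₀ : Family q := fun Λ s => G Λ s - condExp ∅ (G Λ s) with hG₀
  have hHE : H ∈ classLE gr d := by simpa [timeDeriv_zero] using hHk 0 (Nat.zero_le k)
  have hsa : ∀ Λ, ∀ s ∈ Set.Icc (0 : ℝ) 1, IsSelfAdjoint (H₀ Λ s) := fun Λ s hs => by
    have := isSelfAdjoint_of_mem_classLS (classLE_subset_classLS hHE) Λ hs
    exact this.sub (isSelfAdjoint_condExp this)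
  have hcone : HasLightCone gr H₀ := by
    intro n
    obtain ⟨K, hK, h⟩ := hasLightCone_of_mem_classLE hconn hd hHE n
    refine ⟨K, hK, fun Λ s hs x hx t b A hA => ?_⟩
    rw [hH₀, evolve_sub_condExp]
    exact h Λ s hs x hx t b A hA
  have hHs : IsSmoothAnchored gr k fun Λ s _ => H₀ Λ s := by
    simpa only [timeDeriv_zero] using isSmoothAnchored_of_timeDeriv hd hH
      (fun j hj => classLE_subset_classLS (hHk j hj)) (zero_add k)
  have hGs : IsSmoothAnchored gr k fun Λ s _ => G₀ Λ s := by
    simpa only [timeDeriv_zero] using isSmoothAnchored_of_timeDeriv hd hG hGk (zero_add k)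
  have hX := (hHs.duhamel hconn hd hcone hsa hGs (IsSmoothAnchored.zero k)).integral hW
  have hF : ∀ Λ, ∀ s ∈ Set.Icc (0 : ℝ) 1, timeDeriv 0 (mapIFamily W H G) Λ s =
      (∫ t, (W t : ℂ) • duhamel (H₀ Λ s) (G₀ Λ s) (fun _ => 0) t) +
        ((∫ t, W t : ℝ) : ℂ) • condExp ∅ (timeDeriv 0 G Λ s) := by
    intro Λ s hs
    simp only [timeDeriv_zero]
    have hcont : Continuous fun t => evolve (H₀ Λ s) t (G₀ Λ s) :=
      continuous_evolve_comp _ continuous_id continuous_const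
    have h1 : ∀ t, dynamics (H Λ s) t (G Λ s) =
        evolve (H₀ Λ s) t (G₀ Λ s) + condExp ∅ (G Λ s) := by
      intro t
      obtain ⟨c, hc⟩ := condExp_empty_eq_smul_one (G Λ s)
      have h2 : dynamics (H Λ s) t (G Λ s) = evolve (H Λ s) t (G Λ s) := by
        simp [dynamics, evolve, propagator]
      have h3 : evolve (H Λ s) t (condExp ∅ (G Λ s)) = condExp ∅ (G Λ s) := by
        rw [hc, evolve_smul, evolve_one]
      rw [h2, hH₀, evolve_sub_condExp, hG₀, evolve_sub_right, h3, sub_add_cancel]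
    have hi1 : MeasureTheory.Integrable fun t => (W t : ℂ) • evolve (H₀ Λ s) t (G₀ Λ s) :=
      hW.integrable_smul hcont (C := ‖G₀ Λ s‖) (m := 0) fun t => by
        rw [norm_evolve (hsa Λ s hs), pow_zero, mul_one]
    have hi2 : MeasureTheory.Integrable fun t => (W t : ℂ) • condExp ∅ (G Λ s) :=
      hW.integrable.ofReal.smul_const _
    simp only [mapIFamily, mapI, h1, smul_add, duhamel_zero_right]
    rw [MeasureTheory.integral_add hi1 hi2, integral_smul_const, integral_complex_ofReal]
  obtain ⟨h1, h2⟩ := timeDeriv_mem_classLS hconn hd hG hGk _ (zero_add k) hX hF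
  exact ⟨fun Λ j hj => h1 j (Nat.zero_le j) hj Λ, fun j hj => h2 j (Nat.zero_le j) hj⟩

end Closure

/-! ### Matrix elements in an eigenbasis of the Hamiltonian -/

section Eigenbasis

open Matrix

variable {Γ : Type*} [DecidableEq Γ] {q : Γ → ℕ} {Λ : Finset Γ} {H : Obs q Λ}

/-- The matrix of an observable in the chosen orthonormal eigenbasis of the Hermitian `H`. -/
def eigenMatrix (hH : H.IsHermitian) : Obs q Λ ≃⋆ₐ[ℂ] Obs q Λ :=
  Unitary.conjStarAlgAut ℂ (Obs q Λ) (star hH.eigenvectorUnitary)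

lemma eigenMatrix_apply (hH : H.IsHermitian) (A : Obs q Λ) : eigenMatrix hH A =
    (star hH.eigenvectorUnitary : Obs q Λ) * A * (hH.eigenvectorUnitary : Obs q Λ) := by
  simp [eigenMatrix, Unitary.conjStarAlgAut_apply]

lemma eigenMatrix_self (hH : H.IsHermitian) :
    eigenMatrix hH H = diagonal fun j => (hH.eigenvalues j : ℂ) :=
  hH.conjStarAlgAut_star_eigenvectorUnitary

lemma eigenMatrix_spectralProj (hH : H.IsHermitian) (S : Set ℝ) :
    eigenMatrix hH (spectralProj H S) =
      diagonal fun j => ((S.indicator 1 (hH.eigenvalues j) : ℝ) : ℂ) := by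
  have h : (star hH.eigenvectorUnitary : Obs q Λ) * hH.eigenvectorUnitary = 1 :=
    Unitary.coe_star_mul_self _
  rw [spectralProj, hH.cfc_eq, Matrix.IsHermitian.cfc, eigenMatrix_apply,
    Unitary.conjStarAlgAut_apply]
  simp only [← mul_assoc, h, one_mul]
  rw [mul_assoc, h, mul_one]
  rfl

lemma eigenMatrix_exp (hH : H.IsHermitian) (z : ℂ) :
    eigenMatrix hH (NormedSpace.exp (z • H)) =
      diagonal fun j => Complex.exp (z * hH.eigenvalues j) := by
  have h := Matrix.exp_units_conj (Unitary.toUnits (star hH.eigenvectorUnitary)) (z • H)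
  have h2 : eigenMatrix hH (NormedSpace.exp (z • H)) =
      NormedSpace.exp (eigenMatrix hH (z • H)) := by
    rw [eigenMatrix_apply, eigenMatrix_apply]
    simpa [Unitary.toUnits] using h.symm
  rw [h2, map_smul, eigenMatrix_self, ← diagonal_smul, Matrix.exp_diagonal]
  congr 1
  funext j
  simp [NormedSpace.exp, Complex.exp_eq_exp_ℂ]

lemma eigenMatrix_dynamics_apply (hH : H.IsHermitian) (t : ℝ) (A : Obs q Λ) (j k : Config q Λ) :
    eigenMatrix hH (dynamics H t A) j k =
      Complex.exp (Complex.I * t * (hH.eigenvalues j - hH.eigenvalues k)) *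
        eigenMatrix hH A j k := by
  rw [dynamics, map_mul, map_mul, eigenMatrix_exp, eigenMatrix_exp, mul_diagonal, diagonal_mul,
    mul_right_comm, ← Complex.exp_add]
  congr 2
  ring

lemma IsWeight.integrable_smul_dynamics {γ : ℝ} {W : ℝ → ℝ} (hW : IsWeight γ W)
    (hH : H.IsHermitian) (A : Obs q Λ) :
    MeasureTheory.Integrable fun t => (W t : ℂ) • dynamics H t A := by
  have h : ∀ t, dynamics H t A = evolve H t A := fun t => by simp [dynamics, evolve, propagator]
  simp only [h]
  refine hW.integrable_smul (continuous_evolve_comp H continuous_id continuous_const) (C := ‖A‖)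
    (m := 0) fun t => ?_
  rw [norm_evolve (show IsSelfAdjoint H from hH), pow_zero, mul_one]

lemma eigenMatrix_mapI_apply {γ : ℝ} {W : ℝ → ℝ} (hW : IsWeight γ W) (hH : H.IsHermitian)
    (A : Obs q Λ) (j k : Config q Λ) :
    eigenMatrix hH (mapI W H A) j k =
      (∫ t : ℝ, (W t : ℂ) *
        Complex.exp (-(Complex.I * t * ((hH.eigenvalues k - hH.eigenvalues j : ℝ) : ℂ)))) *
        eigenMatrix hH A j k := by
  let entry : Obs q Λ →L[ℂ] ℂ := LinearMap.toContinuousLinearMap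
    ((Matrix.entryLinearMap ℂ ℂ j k).comp (eigenMatrix hH).toAlgEquiv.toLinearMap)
  have hentry : ∀ B, entry B = eigenMatrix hH B j k := fun B => rfl
  rw [← hentry (mapI W H A), mapI,
    ← entry.integral_comp_comm (hW.integrable_smul_dynamics hH A),
    ← MeasureTheory.integral_mul_const]
  refine MeasureTheory.integral_congr_ae (Filter.Eventually.of_forall fun t => ?_)
  simp only [map_smul, hentry, Matrix.smul_apply, eigenMatrix_dynamics_apply, smul_eq_mul, ← mul_assoc]
  congr 3
  push_cast
  ring

/-- Off the diagonal blocks, `𝓘` inverts the commutator with the Hamiltonian. -/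
lemma sub_mul_eigenMatrix_mapI_apply {γ : ℝ} {W : ℝ → ℝ} (hW : IsWeight γ W) (hγ : 0 < γ)
    (hH : H.IsHermitian) (A : Obs q Λ) {j k : Config q Λ}
    (hjk : γ ≤ |hH.eigenvalues j - hH.eigenvalues k|) :
    ((hH.eigenvalues j : ℂ) - hH.eigenvalues k) * eigenMatrix hH (mapI W H A) j k =
      Complex.I * eigenMatrix hH A j k := by
  rw [abs_sub_comm] at hjk
  have hf := hW.fourier _ hjk
  have hne : hH.eigenvalues k - hH.eigenvalues j ≠ 0 := abs_pos.1 (hγ.trans_le hjk)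
  have h2 : (Real.sqrt (2 * Real.pi) : ℂ) ≠ 0 := by
    exact_mod_cast (Real.sqrt_pos.2 (by positivity)).ne'
  rw [fourierHat, inv_mul_eq_iff_eq_mul₀ h2] at hf
  rw [eigenMatrix_mapI_apply hW hH, hf]
  have h3 : ((hH.eigenvalues k - hH.eigenvalues j : ℝ) : ℂ) ≠ 0 := by exact_mod_cast hne
  have h4 : ((hH.eigenvalues j : ℂ) - hH.eigenvalues k) =
    -((hH.eigenvalues k - hH.eigenvalues j : ℝ) : ℂ) := by push_cast; ring
  rw [h4]
  field_simp

end Eigenbasis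

/-! ### Commutator identities under the gap assumption -/

section GapConsequences

variable {Γ : Type*} [DecidableEq Γ] {q : Γ → ℕ} {H : Family q} {γ : ℝ}
  {S₁ S₂ : Finset Γ → ℝ → Set ℝ} {Λ : Finset Γ} {s : ℝ}

lemma IsGapped.le_abs_sub (hgap : IsGapped γ H S₁ S₂) (hs : s ∈ Set.Icc (0 : ℝ) 1) {a b : ℝ}
    (ha : a ∈ spectrum ℝ (H Λ s)) (hb : b ∈ spectrum ℝ (H Λ s))
    (hab : (S₁ Λ s).indicator (1 : ℝ → ℝ) a ≠ (S₁ Λ s).indicator 1 b) : γ ≤ |a - b| := by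
  rw [hgap.spectrum_eq Λ s hs] at ha hb
  by_cases h1 : a ∈ S₁ Λ s <;> by_cases h2 : b ∈ S₁ Λ s
  · simp [h1, h2] at hab
  · exact hgap.gap Λ s hs a h1 b (hb.resolve_left h2)
  · rw [abs_sub_comm]
    exact hgap.gap Λ s hs b h2 a (ha.resolve_left h1)
  · simp [h1, h2] at hab

lemma IsGapped.eq_neg_I_smul_lie_mapI (hgap : IsGapped γ H S₁ S₂) (hγ : 0 < γ) {W : ℝ → ℝ}
    (hW : IsWeight γ W) (hs : s ∈ Set.Icc (0 : ℝ) 1) (hH : (H Λ s).IsHermitian) {A P : Obs q Λ}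
    (hP : P = spectralProj (H Λ s) (S₁ Λ s)) (hA : A = P * A * (1 - P) + (1 - P) * A * P) :
    A = -Complex.I • ⁅H Λ s, mapI W (H Λ s) A⁆ := by
  apply EquivLike.injective (eigenMatrix hH)
  have hA' := congrArg (eigenMatrix hH) hA
  ext j k
  have hA'' := congrFun (congrFun hA' j) k
  simp only [map_add, map_mul, map_sub, hP, eigenMatrix_spectralProj, Ring.lie_def,
    map_smul, eigenMatrix_self, mul_sub, sub_mul, mul_one, one_mul, Matrix.smul_apply,
    Matrix.sub_apply, Matrix.add_apply, Matrix.diagonal_mul, Matrix.mul_diagonal,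
    smul_eq_mul] at hA'' ⊢
  set p := (S₁ Λ s).indicator (1 : ℝ → ℝ) with hp
  by_cases hjk : p (hH.eigenvalues j) = p (hH.eigenvalues k)
  · have h0 : eigenMatrix hH A j k = 0 := by
      rw [hA'', hjk]
      rcases Set.indicator_eq_zero_or_self (S₁ Λ s) (1 : ℝ → ℝ) (hH.eigenvalues k) with h | h <;>
        rw [hp, h] <;> simp
    simp [eigenMatrix_mapI_apply hW hH, h0]
  · have h := sub_mul_eigenMatrix_mapI_apply hW hγ hH A (hgap.le_abs_sub hs
      (hH.eigenvalues_mem_spectrum_real j) (hH.eigenvalues_mem_spectrum_real k) hjk)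
    linear_combination Complex.I * h + eigenMatrix hH A j k * Complex.I_mul_I

lemma IsGapped.lie_sub_I_smul_lie_lie_mapI (hgap : IsGapped γ H S₁ S₂) (hγ : 0 < γ) {W : ℝ → ℝ}
    (hW : IsWeight γ W) (hs : s ∈ Set.Icc (0 : ℝ) 1) (hH : (H Λ s).IsHermitian) {L P : Obs q Λ}
    (hP : P = spectralProj (H Λ s) (S₁ Λ s)) :
    ⁅L, P⁆ - Complex.I • ⁅⁅mapI W (H Λ s) L, H Λ s⁆, P⁆ = 0 := by
  apply EquivLike.injective (eigenMatrix hH)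
  ext j k
  simp only [map_mul, map_sub, map_zero, hP, eigenMatrix_spectralProj, Ring.lie_def, map_smul,
    eigenMatrix_self, mul_sub, sub_mul, Matrix.smul_apply, Matrix.sub_apply, ← mul_assoc,
    Matrix.diagonal_mul_diagonal, Matrix.diagonal_mul, Matrix.mul_diagonal, smul_eq_mul, Matrix.zero_apply]
  by_cases hjk : (S₁ Λ s).indicator (1 : ℝ → ℝ) (hH.eigenvalues j) =
      (S₁ Λ s).indicator 1 (hH.eigenvalues k)
  · rw [hjk]
    ring
  · have h := sub_mul_eigenMatrix_mapI_apply hW hγ hH L (hgap.le_abs_sub hs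
      (hH.eigenvalues_mem_spectrum_real j) (hH.eigenvalues_mem_spectrum_real k) hjk)
    linear_combination ((((S₁ Λ s).indicator 1 (hH.eigenvalues k) : ℝ) : ℂ) -
      (((S₁ Λ s).indicator 1 (hH.eigenvalues j) : ℝ) : ℂ)) *
        (Complex.I * h + eigenMatrix hH L j k * Complex.I_mul_I)

end GapConsequences

end SpinSystem

end

theorem proposition1 {Γ : Type*} [DecidableEq Γ] [Countable Γ]
    (gr : SimpleGraph Γ) (hconn : gr.Connected) (d : ℕ) (hd : SpinSystem.HasDimension gr d)
    (q : Γ → ℕ) (hq : ∀ x, 0 < q x) (hqb : ∃ D, ∀ x, q x ≤ D)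
    (H : SpinSystem.Family q) (hH : SpinSystem.IsLocalHamiltonian H)
    (γ : ℝ) (hγ : 0 < γ) (S₁ S₂ : Finset Γ → ℝ → Set ℝ)
    (hgap : SpinSystem.IsGapped γ H S₁ S₂)
    (W : ℝ → ℝ) (hW : SpinSystem.IsWeight γ W) :
    (∀ Λ : Finset Γ, ∀ s ∈ Set.Icc (0 : ℝ) 1, ∀ A P : SpinSystem.Obs q Λ,
      P = SpinSystem.spectralProj (H Λ s) (S₁ Λ s) →
      A = P * A * (1 - P) + (1 - P) * A * P →
      A = -Complex.I • ⁅H Λ s, SpinSystem.mapI W (H Λ s) A⁆) ∧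
    (∀ Λ : Finset Γ, ∀ s ∈ Set.Icc (0 : ℝ) 1, ∀ L P : SpinSystem.Obs q Λ,
      P = SpinSystem.spectralProj (H Λ s) (S₁ Λ s) →
      ⁅L, P⁆ - Complex.I • ⁅⁅SpinSystem.mapI W (H Λ s) L, H Λ s⁆, P⁆ = 0) ∧
    (∀ G : SpinSystem.Family q,
      H ∈ SpinSystem.classLE gr d → G ∈ SpinSystem.classLS gr d →
      SpinSystem.mapIFamily W H G ∈ SpinSystem.classLS gr d) ∧
    (∀ (G : SpinSystem.Family q) (k : ℕ),
      SpinSystem.IsTimesDiff k H → SpinSystem.IsTimesDiff k G →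
      (∀ j ≤ k, SpinSystem.timeDeriv j H ∈ SpinSystem.classLE gr d) →
      (∀ j ≤ k, SpinSystem.timeDeriv j G ∈ SpinSystem.classLS gr d) →
      SpinSystem.IsTimesDiff k (SpinSystem.mapIFamily W H G) ∧
      ∀ j, 1 ≤ j → j ≤ k →
        SpinSystem.timeDeriv j (SpinSystem.mapIFamily W H G) ∈ SpinSystem.classLS gr d) := by
  have : ∀ x, NeZero (q x) := fun x => ⟨(hq x).ne'⟩
  have hsa : ∀ Λ, ∀ s ∈ Set.Icc (0 : ℝ) 1, (H Λ s).IsHermitian := fun Λ s hs =>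
    SpinSystem.isSelfAdjoint_of_isLocalHamiltonian hH Λ hs
  refine ⟨fun Λ s hs A P hP hA => hgap.eq_neg_I_smul_lie_mapI hγ hW hs (hsa Λ s hs) hP hA,
    fun Λ s hs L P hP => hgap.lie_sub_I_smul_lie_lie_mapI hγ hW hs (hsa Λ s hs) hP,
    fun G hHE hGS => ?_, fun G k hHd hGd hHk hGk => ?_⟩
  · -- Membership in `𝓛_{𝓢,∞}` without derivatives is the case `k = 0`.
    have h := SpinSystem.timeDeriv_mapIFamily_mem_classLS hconn hd hW (k := 0) (H := H) (G := G)
      (fun Λ j hj => absurd hj (Nat.not_lt_zero j)) (fun Λ j hj => absurd hj (Nat.not_lt_zero j))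
      (fun j hj => by rwa [Nat.le_zero.1 hj, SpinSystem.timeDeriv_zero])
      (fun j hj => by rwa [Nat.le_zero.1 hj, SpinSystem.timeDeriv_zero])
    simpa only [SpinSystem.timeDeriv_zero] using h.2 0 le_rfl
  · obtain ⟨h1, h2⟩ :=
      SpinSystem.timeDeriv_mapIFamily_mem_classLS hconn hd hW hHd hGd hHk hGk
    exact ⟨h1, fun j _ hj => h2 j hj⟩
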